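/- Let $r\ge 1$ be an integer and let $d,T>0$ be real. Let $G$ be the 3-dimensional Heisenberg group of matrices $$g(x,y,z)=\begin{pmatrix}1&x&z\\0&1&y\\0&0&1\end{pmatrix},\qquad x,y,z\in\mathbb R,$$ with the basis $X,Y,Z$ of its Lie algebra given by $g(x,y,z)-1=xX+yY+zZ$, so that $[X,Y]=Z$. Let $\Gamma_r=\{g(rx,y,z)\mid x,y,z\in\mathbb Z\}$, and let $M(r,d,T)=\Gamma_r\backslash G$ carry the metric and the orientation induced by the left invariant ones on $G$ for which $e_1=-dX$, $e_2=-dY$, $e_3=T^{-1}Z$ is a positively oriented orthonormal frame. Let $\mathbb N=\{1,2,\dots\}$ and $\mathbb N_0=\{0,1,2,\dots\}$. The spinor module is $\Sigma_3=\mathbb C^2$ with Clifford multiplication $$\gamma(E_1)=\begin{pmatrix}0&i\\i&0\end{pmatrix},\quad \gamma(E_2)=\begin{pmatrix}0&-1\\1&0\end{pmatrix},\quad \gamma(E_3)=\begin{pmatrix}i&0\\0&-i\end{pmatrix}.$$ The Dirac operator is $D=\sum_i\gamma(e_i)\nabla^\Sigma_{e_i}$, acting on smooth spinor fields. A homomorphism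 $\epsilon:\Gamma_r\to\{\pm1\}$ defines the spin structure $G\times_{\Gamma_r}\mathrm{Spin}(3)$ on $M(r,d,T)$, where $g_0\in\Gamma_r$ acts on $G$ by left multiplication and on $\mathrm{Spin}(3)$ by multiplication with the central element $\epsilon(g_0)$. **Theorem.** Every spin structure on $M(r,d,T)$ is equivalent to the one defined by exactly one homomorphism $\epsilon$. Assigning to it the triple $\delta=(\delta_1,\delta_2,\delta_3)=(\epsilon(g(r,0,0)),\epsilon(g(0,1,0)),\epsilon(g(0,0,1)))$ gives a bijection from the equivalence classes of spin structures to the triples $\delta\in\{\pm1\}^3$ such that $\delta_3=1$ if $r$ is odd (so $\delta_3=-1$ occurs if and only if $r$ is even). The eigenvalues of the Dirac operator of the spin structure with triple $\delta$ are as follows. **A.** If $\delta_3=+1$: * a) $\lambda^\pm_{\alpha,\beta}=-\frac{d^2T}{4}\pm2\pi d\sqrt{\alpha^2+\beta^2}$, with multiplicity $1$ for each sign, each $\alpha\in\frac1{2r}\mathbb Z$ with $e^{2\pi ir\alpha}=\delta_1$ and each $\beta\in\frac12\mathbb Z$ with $e^{2\pi i\beta}=\delta_2$; * b) $\lambda_\tau=-\frac{d^2T}{4}-2\pi\tau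 T^{-1}$, with multiplicity $2\tau r$ for each $\tau\in\mathbb N$; * c) $\lambda^\pm_{\tau,k}=-\frac{d^2T}{4}\pm2\sqrt{\pi^2\tau^2T^{-2}+k\pi d^2\tau}$, with multiplicity $2\tau r$ for each sign and all $\tau,k\in\mathbb N$. **B.** If $\delta_3=-1$: * a) $\lambda_\tau=-\frac{d^2T}{4}-2\pi\tau T^{-1}$, with multiplicity $2\tau r$ for each $\tau\in\mathbb N_0+\frac12$; * b) $\lambda^\pm_{\tau,k}=-\frac{d^2T}{4}\pm2\sqrt{\pi^2\tau^2T^{-2}+k\pi d^2\tau}$, with multiplicity $2\tau r$ for each sign, each $\tau\in\mathbb N_0+\frac12$ and each $k\in\mathbb N$. Here multiplicities of coinciding values add up: for every $\mu\in\mathbb C$ the space of smooth spinor fields $\psi$ with $D\psi=\mu\psi$ is finite-dimensional, and its dimension is the (finite) sum of the multiplicities of all entries in the list that are equal to $\mu$. In particular there are no other eigenvalues. -/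

import Mathlib

open scoped Matrix ContDiff

noncomputable section

/-! ### The Heisenberg group and its Lie algebra -/

/-- The 3-dimensional Heisenberg group; `⟨x, y, z⟩` is the matrix `g(x, y, z)`, see `Heis.toMatrix`. -/
@[ext]
structure Heis where
  x : ℝ
  y : ℝ
  z : ℝ

namespace Heis

/-- The upper unitriangular matrix `g(x, y, z)`. -/
def toMatrix (g : Heis) : Matrix (Fin 3) (Fin 3) ℝ :=
  !![1, g.x, g.z; 0, 1, g.y; 0, 0, 1]

instance : Mul Heis := ⟨fun g h => ⟨g.x + h.x, g.y + h.y, g.z + h.z + g.x * h.y⟩⟩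
instance : One Heis := ⟨⟨0, 0, 0⟩⟩
instance : Inv Heis := ⟨fun g => ⟨-g.x, -g.y, -g.z + g.x * g.y⟩⟩

@[simp] lemma mul_x (g h : Heis) : (g * h).x = g.x + h.x := rfl
@[simp] lemma mul_y (g h : Heis) : (g * h).y = g.y + h.y := rfl
@[simp] lemma mul_z (g h : Heis) : (g * h).z = g.z + h.z + g.x * h.y := rfl
@[simp] lemma one_x : (1 : Heis).x = 0 := rfl
@[simp] lemma one_y : (1 : Heis).y = 0 := rfl
@[simp] lemma one_z : (1 : Heis).z = 0 := rfl
@[simp] lemma inv_x (g : Heis) : (g⁻¹).x = -g.x := rfl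
@[simp] lemma inv_y (g : Heis) : (g⁻¹).y = -g.y := rfl
@[simp] lemma inv_z (g : Heis) : (g⁻¹).z = -g.z + g.x * g.y := rfl

instance : Group Heis where
  mul_assoc a b c := by ext <;> simp <;> ring
  one_mul a := by ext <;> simp
  mul_one a := by ext <;> simp
  inv_mul_cancel a := by ext <;> simp

/-- The multiplication of `Heis` is matrix multiplication. -/
lemma toMatrix_mul (g h : Heis) : (g * h).toMatrix = g.toMatrix * h.toMatrix := by
  ext i j
  fin_cases i <;> fin_cases j <;> simp [toMatrix, Matrix.mul_apply, Fin.sum_univ_three] <;> ring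

lemma toMatrix_injective : Function.Injective toMatrix := by
  intro g h e
  ext
  · simpa [toMatrix] using congrFun (congrFun e 0) 1
  · simpa [toMatrix] using congrFun (congrFun e 1) 2
  · simpa [toMatrix] using congrFun (congrFun e 0) 2

/-- The global chart `g(x, y, z) ↦ (x, y, z)`. -/
def coords (g : Heis) : ℝ × ℝ × ℝ := (g.x, g.y, g.z)

/-- The inverse `(x, y, z) ↦ g(x, y, z)` of the global chart. -/
def ofCoords (p : ℝ × ℝ × ℝ) : Heis := ⟨p.1, p.2.1, p.2.2⟩

instance : TopologicalSpace Heis := TopologicalSpace.induced coords inferInstance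

end Heis

/-- The 3-dimensional Heisenberg algebra; `![ξ, η, ζ]` is the element `ξ X + η Y + ζ Z`,
i.e. the matrix `HeisAlg.toMatrix ![ξ, η, ζ]`.  Its elements are regarded as left invariant vector
fields. -/
abbrev HeisAlg : Type := Fin 3 → ℝ

namespace HeisAlg

/-- The strictly upper triangular matrix of an element of the Heisenberg algebra. -/
def toMatrix (v : HeisAlg) : Matrix (Fin 3) (Fin 3) ℝ :=
  !![0, v 0, v 2; 0, 0, v 1; 0, 0, 0]

/-- The Lie bracket: `[X, Y] = Z`, and `Z` is central. -/
def bracket (u v : HeisAlg) : HeisAlg := ![0, 0, u 0 * v 1 - u 1 * v 0]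

/-- `bracket` is the commutator of matrices. -/
lemma toMatrix_bracket (u v : HeisAlg) :
    (bracket u v).toMatrix = u.toMatrix * v.toMatrix - v.toMatrix * u.toMatrix := by
  ext i j
  fin_cases i <;> fin_cases j <;>
    simp [toMatrix, bracket]
  ring

/-- The exponential map of the Heisenberg group. -/
def exp (v : HeisAlg) : Heis := ⟨v 0, v 1, v 2 + v 0 * v 1 / 2⟩

/-- `exp` is the exponential of matrices. -/
lemma toMatrix_exp (v : HeisAlg) : (exp v).toMatrix = NormedSpace.exp v.toMatrix := by
  have h3 : v.toMatrix ^ 3 = 0 := by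
    ext i j
    fin_cases i <;> fin_cases j <;>
      simp [toMatrix, pow_succ, Matrix.mul_apply, Fin.sum_univ_three]
  have hs : NormedSpace.exp v.toMatrix
      = ∑ n ∈ Finset.range 3, ((n.factorial : ℝ)⁻¹) • v.toMatrix ^ n := by
    rw [NormedSpace.exp_eq_tsum ℝ]
    refine tsum_eq_sum fun n hn => ?_
    have : 3 ≤ n := by simpa using hn
    rw [pow_eq_zero_of_le this h3, smul_zero]
  rw [hs]
  ext i j
  fin_cases i <;> fin_cases j <;>
    simp [toMatrix, Heis.toMatrix, exp, Finset.sum_range_succ, pow_succ, Nat.factorial]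
  ring

/-- The orthonormal frame `e₁ = -d X`, `e₂ = -d Y`, `e₃ = T⁻¹ Z`. -/
def frame (d T : ℝ) : Fin 3 → HeisAlg :=
  ![![-d, 0, 0], ![0, -d, 0], ![0, 0, T⁻¹]]

/-- The left invariant metric for which `frame d T` is orthonormal. -/
def metric (d T : ℝ) (u v : HeisAlg) : ℝ :=
  (u 0 * v 0 + u 1 * v 1) / d ^ 2 + T ^ 2 * (u 2 * v 2)

lemma metric_frame {d T : ℝ} (hd : 0 < d) (hT : 0 < T) (i j : Fin 3) :
    metric d T (frame d T i) (frame d T j) = if i = j then 1 else 0 := by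
  have := hd.ne'
  have := hT.ne'
  fin_cases i <;> fin_cases j <;> simp [metric, frame] <;> field_simp

/-- The Christoffel symbols `Γᵏᵢⱼ = ⟨∇_{eᵢ} eⱼ, eₖ⟩` of the Levi-Civita connection with respect to
the left invariant frame `e`, by the Koszul formula. -/
def christoffel (d T : ℝ) (i j k : Fin 3) : ℝ :=
  (metric d T (bracket (frame d T i) (frame d T j)) (frame d T k)
    - metric d T (bracket (frame d T j) (frame d T k)) (frame d T i)
    + metric d T (bracket (frame d T k) (frame d T i)) (frame d T j)) / 2

end HeisAlg

/-! ### The Heisenberg manifold and its frame bundle -/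

/-- The lattice `Γ_r = {g(r x, y, z) | x, y, z ∈ ℤ}`. -/
def heisLattice (r : ℕ) : Subgroup Heis where
  carrier := {g | ∃ a b c : ℤ, g = ⟨r * a, b, c⟩}
  mul_mem' := by
    rintro _ _ ⟨a, b, c, rfl⟩ ⟨a', b', c', rfl⟩
    exact ⟨a + a', b + b', c + c' + r * a * b', by ext <;> simp; ring⟩
  one_mem' := ⟨0, 0, 0, by ext <;> simp⟩
  inv_mem' := by
    rintro _ ⟨a, b, c, rfl⟩
    exact ⟨-a, -b, -c + r * a * b, by ext <;> simp⟩

/-- The Heisenberg manifold `M = Γ_r \ G`: the orbits of `Γ_r` acting on `G` by left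
multiplication. -/
abbrev HeisManifold (r : ℕ) : Type := MulAction.orbitRel.Quotient (heisLattice r) Heis

/-- The projection `G → M`. -/
def heisProj (r : ℕ) (g : Heis) : HeisManifold r := Quotient.mk _ g

/-- The oriented orthonormal bases of a tangent space of `M(r, d, T)`.  Left invariant vector fields
identify every tangent space of `G`, and hence of `M`, with the Heisenberg algebra.  The orientation
is the one for which `HeisAlg.frame d T` is positive. -/
abbrev OrthFrame (d T : ℝ) : Type :=
  {b : Fin 3 → HeisAlg //
    (∀ i j, HeisAlg.metric d T (b i) (b j) = if i = j then 1 else 0) ∧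
    0 < (Matrix.of b).det * (Matrix.of (HeisAlg.frame d T)).det}

/-- The bundle of oriented orthonormal frames of `M(r, d, T)`, in the trivialization of the tangent
bundle by left invariant vector fields. -/
abbrev FrameBundle (r : ℕ) (d T : ℝ) : Type := HeisManifold r × OrthFrame d T

/-! ### Clifford multiplication and the spin group -/

/-- Clifford multiplication `γ(E₁), γ(E₂), γ(E₃)` on the spinor module `Σ₃ = ℂ²`. -/
def cliffordGamma : Fin 3 → Matrix (Fin 2) (Fin 2) ℂ :=
  ![!![0, Complex.I; Complex.I, 0], !![0, -1; 1, 0], !![Complex.I, 0; 0, -Complex.I]]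

lemma cliffordGamma_rel (i j : Fin 3) :
    cliffordGamma i * cliffordGamma j + cliffordGamma j * cliffordGamma i
      = if i = j then -2 else 0 := by
  fin_cases i <;> fin_cases j <;> ext a b <;> fin_cases a <;> fin_cases b <;>
    simp [cliffordGamma, Matrix.ofNat_apply] <;> norm_num

/-- The group `Spin(3) = SU(2)`, acting on `Σ₃ = ℂ²` by matrix multiplication. -/
abbrev Spin3 : Type := Matrix.specialUnitaryGroup (Fin 2) ℂ

/-- The matrix of the standard twofold covering `Θ : Spin(3) → SO(3)`, which is characterized by
`A γ(Eⱼ) A⁻¹ = ∑ᵢ Θ(A)ᵢⱼ γ(Eᵢ)`. -/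
def spinCover (A : Spin3) : Matrix (Fin 3) (Fin 3) ℝ :=
  Matrix.of fun i j =>
    -(Matrix.trace (cliffordGamma i * (A : Matrix (Fin 2) (Fin 2) ℂ) * cliffordGamma j *
      (A : Matrix (Fin 2) (Fin 2) ℂ)ᴴ)).re / 2

/-- The defining property of `Θ`; note `A⁻¹ = Aᴴ`. -/
lemma spinCover_spec (A : Spin3) (j : Fin 3) :
    (A : Matrix (Fin 2) (Fin 2) ℂ) * cliffordGamma j * (A : Matrix (Fin 2) (Fin 2) ℂ)ᴴ
      = ∑ i, (spinCover A i j : ℂ) • cliffordGamma i := by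
  have hgH : (cliffordGamma j)ᴴ = -cliffordGamma j := by
    ext a b
    fin_cases j <;> fin_cases a <;> fin_cases b <;>
      simp [cliffordGamma, Matrix.conjTranspose_apply]
  have hgt : (cliffordGamma j).trace = 0 := by
    fin_cases j <;> simp [cliffordGamma, Matrix.trace]
  have hA : (A : Matrix (Fin 2) (Fin 2) ℂ)ᴴ * A = 1 :=
    (Matrix.mem_unitaryGroup_iff').1 (Matrix.mem_specialUnitaryGroup_iff.1 A.2).1
  unfold spinCover
  simp only [Matrix.of_apply, mul_assoc (cliffordGamma _)]
  have hM : ((A : Matrix (Fin 2) (Fin 2) ℂ) * cliffordGamma j *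
      (A : Matrix (Fin 2) (Fin 2) ℂ)ᴴ)ᴴ = -((A : Matrix (Fin 2) (Fin 2) ℂ) * cliffordGamma j *
      (A : Matrix (Fin 2) (Fin 2) ℂ)ᴴ) := by
    simp [Matrix.conjTranspose_mul, hgH, mul_assoc]
  have ht : ((A : Matrix (Fin 2) (Fin 2) ℂ) * cliffordGamma j *
      (A : Matrix (Fin 2) (Fin 2) ℂ)ᴴ).trace = 0 := by
    rw [Matrix.trace_mul_comm, ← mul_assoc, hA, one_mul, hgt]
  simp only [mul_assoc] at hM ht ⊢
  generalize (A : Matrix (Fin 2) (Fin 2) ℂ) * (cliffordGamma j *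
      (A : Matrix (Fin 2) (Fin 2) ℂ)ᴴ) = M at hM ht ⊢
  have e00 := congrFun (congrFun hM 0) 0
  have e01 := congrFun (congrFun hM 0) 1
  simp [Matrix.conjTranspose_apply, Complex.ext_iff] at e00 e01
  simp [Matrix.trace, Complex.ext_iff] at ht
  obtain ⟨e01, e01'⟩ := e01
  obtain ⟨ht, ht'⟩ := ht
  ext a b
  fin_cases a <;> fin_cases b <;> apply Complex.ext <;>
    simp [cliffordGamma, Matrix.trace, Fin.sum_univ_three, Matrix.mul_apply] <;> linarith

/-- The central elements `±1` of `Spin(3)`. -/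
def spinSign (u : ℤˣ) : Spin3 :=
  ⟨((u : ℤ) : ℂ) • (1 : Matrix (Fin 2) (Fin 2) ℂ), by
    rcases Int.units_eq_one_or u with rfl | rfl
    · simp [one_mem]
    · rw [Matrix.mem_specialUnitaryGroup_iff, Matrix.mem_unitaryGroup_iff]
      simp [Matrix.det_fin_two]⟩

/-! ### Spin structures -/

/-- A spin structure on `M(r, d, T)`: a principal `Spin(3)`-bundle `P` over `M` together with a
twofold covering of the bundle of oriented orthonormal frames, compatible with the projections to
`M` and with the right actions of `Spin(3)` and `SO(3)`. -/
structure SpinStructure (r : ℕ) (d T : ℝ) where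
  /-- The total space. -/
  P : Type
  [top : TopologicalSpace P]
  /-- The right action of `Spin(3)`. -/
  act : P → Spin3 → P
  continuous_act : Continuous fun x : P × Spin3 => act x.1 x.2
  act_one : ∀ p, act p 1 = p
  act_mul : ∀ p A B, act p (A * B) = act (act p A) B
  /-- The map to the frame bundle; its first component is the bundle projection `P → M`. -/
  φ : P → FrameBundle r d T
  isCoveringMap : IsCoveringMap φ
  twofold : ∀ b, (φ ⁻¹' {b}).ncard = 2
  proj_act : ∀ p A, (φ (act p A)).1 = (φ p).1
  /-- `φ (p · A)` is the frame `φ p · Θ(A)`. -/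
  frame_act : ∀ p A j, (φ (act p A)).2.1 j = ∑ i, spinCover A i j • (φ p).2.1 i
  /-- Local triviality of the principal bundle `P → M`. -/
  locally_trivial : ∀ m : HeisManifold r, ∃ U : Set (HeisManifold r), IsOpen U ∧ m ∈ U ∧
    ∃ e : {p : P // (φ p).1 ∈ U} ≃ₜ U × Spin3,
      (∀ p, ((e p).1 : HeisManifold r) = (φ p.1).1) ∧
      ∀ p p' A, p'.1 = act p.1 A → (e p').2 = (e p).2 * A

attribute [instance] SpinStructure.top

namespace SpinStructure

variable {r : ℕ} {d T : ℝ}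

/-- Equivalence of spin structures: an isomorphism of principal bundles over the frame bundle. -/
def Equivalent (S S' : SpinStructure r d T) : Prop :=
  ∃ h : S.P ≃ₜ S'.P, (∀ p A, h (S.act p A) = S'.act (h p) A) ∧ ∀ p, S'.φ (h p) = S.φ p

/-- A local lift `q : U → P`, `U ⊆ G` open, of the left invariant frame `(e₁, e₂, e₃)`. -/
def IsLift (S : SpinStructure r d T) (U : Set Heis) (q : Heis → S.P) : Prop :=
  IsOpen U ∧ ContinuousOn q U ∧
    ∀ g ∈ U, (S.φ (q g)).1 = heisProj r g ∧ (S.φ (q g)).2.1 = HeisAlg.frame d T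

/-- The homomorphism `ε : Γ_r → {±1}` of a spin structure: the frame `(e₁, e₂, e₃)` lifts to a map
`s : G → P` on which left translation by `γ ∈ Γ_r` acts by `ε(γ)`.  Equivalently, `P` is
`G ×_Γ Spin(3)`, where `γ` acts on `G` by left multiplication and on `Spin(3)` by multiplication with
`ε(γ)`. -/
def HasHom (S : SpinStructure r d T) (ε : heisLattice r →* ℤˣ) : Prop :=
  ∃ s : Heis → S.P, S.IsLift Set.univ s ∧
    ∀ (γ : heisLattice r) (g : Heis), s ((γ : Heis) * g) = S.act (s g) (spinSign (ε γ))

/-- The spin structure corresponds to the triple `δ = (δ₁, δ₂, δ₃)`, where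
`δ₁ = ε(g(r, 0, 0))`, `δ₂ = ε(g(0, 1, 0))`, `δ₃ = ε(g(0, 0, 1))`. -/
def HasTriple (S : SpinStructure r d T) (δ : Fin 3 → ℤˣ) : Prop :=
  ∃ ε : heisLattice r →* ℤˣ, S.HasHom ε ∧
    ε ⟨⟨r, 0, 0⟩, 1, 0, 0, by simp⟩ = δ 0 ∧
    ε ⟨⟨0, 1, 0⟩, 0, 1, 0, by simp⟩ = δ 1 ∧
    ε ⟨⟨0, 0, 1⟩, 0, 0, 1, by simp⟩ = δ 2

end SpinStructure

/-! ### The Dirac operator -/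

/-- The spinor module `Σ₃ = ℂ²`. -/
abbrev Spinor3 : Type := Fin 2 → ℂ

/-- The derivative `∂_v σ` of `σ : G → Σ₃` along the left invariant vector field `v`. -/
def leftDeriv (v : HeisAlg) (σ : Heis → Spinor3) (g : Heis) : Spinor3 :=
  deriv (fun t : ℝ => σ (g * HeisAlg.exp (t • v))) 0

/-- The spinor connection
`∇_{eᵢ} σ = ∂_{eᵢ} σ + 1/4 ∑ⱼₖ Γᵏᵢⱼ γ(Eⱼ) γ(Eₖ) σ` in the trivialization by a lift of the frame. -/
def spinConnection (d T : ℝ) (i : Fin 3) (σ : Heis → Spinor3) (g : Heis) : Spinor3 :=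
  leftDeriv (HeisAlg.frame d T i) σ g +
    (1 / 4 : ℂ) • ∑ j, ∑ k, (HeisAlg.christoffel d T i j k : ℂ) •
      ((cliffordGamma j * cliffordGamma k) *ᵥ σ g)

/-- The Dirac operator `∑ᵢ γ(eᵢ) ∇_{eᵢ}` in the trivialization by a lift of the frame. -/
def diracG (d T : ℝ) (σ : Heis → Spinor3) (g : Heis) : Spinor3 :=
  ∑ i, cliffordGamma i *ᵥ spinConnection d T i σ g

namespace SpinStructure

variable {r : ℕ} {d T : ℝ}

/-- Smooth spinor fields, i.e. smooth sections of `ΣM = P ×_{Spin(3)} Σ₃`, as equivariant maps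
`ψ : P → Σ₃`.  Smoothness is tested on the lifts `q` of the frame, through the global chart of
`G`. -/
def IsSmoothSpinor (S : SpinStructure r d T) (ψ : S.P → Spinor3) : Prop :=
  (∀ p A, ψ (S.act p A) = ((A⁻¹ : Spin3) : Matrix (Fin 2) (Fin 2) ℂ) *ᵥ ψ p) ∧
  ∀ U q, S.IsLift U q →
    ContDiffOn ℝ ∞ (fun x : ℝ × ℝ × ℝ => ψ (q (Heis.ofCoords x))) (Heis.ofCoords ⁻¹' U)

/-- `χ = D ψ`, where `D` is the Dirac operator of the spin structure `S`: with respect to every lift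
of the frame, `χ` is given by `diracG` applied to `ψ`. -/
def IsDirac (S : SpinStructure r d T) (ψ χ : S.P → Spinor3) : Prop :=
  ∀ U q, S.IsLift U q → ∀ g ∈ U, χ (q g) = diracG d T (fun h => ψ (q h)) g

lemma IsSmoothSpinor.differentiableAt {S : SpinStructure r d T} {ψ : S.P → Spinor3}
    (hψ : S.IsSmoothSpinor ψ) {U : Set Heis} {q : Heis → S.P} (hq : S.IsLift U q) {g : Heis}
    (hg : g ∈ U) (v : HeisAlg) :
    DifferentiableAt ℝ (fun t : ℝ => ψ (q (g * HeisAlg.exp (t • v)))) 0 := by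
  have hcont : Continuous Heis.ofCoords := continuous_induced_rng.2 continuous_id
  have h1 := hψ.2 U q hq
  have hopen : IsOpen (Heis.ofCoords ⁻¹' U) := hq.1.preimage hcont
  have hmul : g * HeisAlg.exp ((0 : ℝ) • v) = g := by
    ext <;> simp [HeisAlg.exp]
  have hmem : (g * HeisAlg.exp ((0 : ℝ) • v)).coords ∈ Heis.ofCoords ⁻¹' U := by
    rw [hmul]; exact hg
  have h2 := ((h1.contDiffAt (hopen.mem_nhds hmem)).differentiableAt (by simp))
  have h3 : DifferentiableAt ℝ (fun t : ℝ => (g * HeisAlg.exp (t • v)).coords) 0 := by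
    simp only [Heis.coords, HeisAlg.exp, Heis.mul_x, Heis.mul_y, Heis.mul_z, Pi.smul_apply,
      smul_eq_mul]
    fun_prop
  exact DifferentiableAt.comp (g := fun x : ℝ × ℝ × ℝ => ψ (q (Heis.ofCoords x))) (0 : ℝ) h2 h3

/-- The eigenspace `{ψ smooth spinor field | D ψ = μ ψ}` of the Dirac operator. -/
def diracEigenspace (S : SpinStructure r d T) (μ : ℂ) : Submodule ℂ (S.P → Spinor3) where
  carrier := {ψ | S.IsSmoothSpinor ψ ∧ S.IsDirac ψ (μ • ψ)}
  zero_mem' := by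
    refine ⟨⟨fun p A => by simp, fun U q _ => contDiffOn_const⟩, fun U q _ g _ => ?_⟩
    simp [diracG, spinConnection, leftDeriv]
  add_mem' := by
    rintro a b ⟨ha, ha'⟩ ⟨hb, hb'⟩
    refine ⟨⟨fun p A => by simp [ha.1 p A, hb.1 p A, Matrix.mulVec_add],
      fun U q hq => (ha.2 U q hq).add (hb.2 U q hq)⟩, fun U q hq g hg => ?_⟩
    have e1 := ha' U q hq g hg
    have e2 := hb' U q hq g hg
    have hd : ∀ v, leftDeriv v (fun h => a (q h) + b (q h)) g
        = leftDeriv v (fun h => a (q h)) g + leftDeriv v (fun h => b (q h)) g := fun v =>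
      deriv_fun_add (ha.differentiableAt hq hg v) (hb.differentiableAt hq hg v)
    simp only [Pi.smul_apply] at e1 e2
    simp only [smul_add, Pi.add_apply, Pi.smul_apply, e1, e2, diracG, spinConnection, hd,
      Matrix.mulVec_add, Finset.sum_add_distrib]
    abel
  smul_mem' := by
    rintro c a ⟨ha, ha'⟩
    refine ⟨⟨fun p A => by simp [ha.1 p A, Matrix.mulVec_smul],
      fun U q hq => (ha.2 U q hq).const_smul c⟩, fun U q hq g hg => ?_⟩
    have e1 := ha' U q hq g hg
    have hd : ∀ v, leftDeriv v (fun h => c • a (q h)) g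
        = c • leftDeriv v (fun h => a (q h)) g := fun v =>
      deriv_fun_const_smul c (ha.differentiableAt hq hg v)
    simp only [Pi.smul_apply] at e1
    have hr : diracG d T (fun h => c • a (q h)) g = c • diracG d T (fun h => a (q h)) g := by
      simp only [diracG, spinConnection, hd, Matrix.mulVec_add, Matrix.mulVec_smul,
        Finset.smul_sum, smul_add, Matrix.mulVec_sum, smul_smul, mul_comm, mul_assoc]
    simp only [Pi.smul_apply]
    rw [hr, ← e1, smul_comm]

end SpinStructure

/-! ### The list of eigenvalues -/

/-- `λ^±_{α,β} = -d²T/4 ± 2πd √(α² + β²)`. -/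
def lamTorus (d T α β : ℝ) (s : ℤˣ) : ℝ :=
  -(d ^ 2 * T / 4) + ((s : ℤ) : ℝ) * (2 * Real.pi * d * √(α ^ 2 + β ^ 2))

/-- `λ_τ = -d²T/4 - 2πτT⁻¹`. -/
def lamTau (d T τ : ℝ) : ℝ :=
  -(d ^ 2 * T / 4) - 2 * Real.pi * τ * T⁻¹

/-- `λ^±_{τ,k} = -d²T/4 ± 2 √(π²τ²T⁻² + kπd²τ)`. -/
def lamTauK (d T τ k : ℝ) (s : ℤˣ) : ℝ :=
  -(d ^ 2 * T / 4) +
    ((s : ℤ) : ℝ) * (2 * √(Real.pi ^ 2 * τ ^ 2 * (T⁻¹) ^ 2 + k * Real.pi * d ^ 2 * τ))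

/-- The pairs `(α, β)` with `α ∈ (1/2r) ℤ`, `exp(2πirα) = δ₁`, `β ∈ (1/2) ℤ`, `exp(2πiβ) = δ₂`. -/
def torusPairs (r : ℕ) (δ : Fin 3 → ℤˣ) : Set (ℝ × ℝ) :=
  {p | (∃ m : ℤ, p.1 = 1 / (2 * r) * m) ∧
    Complex.exp (2 * Real.pi * Complex.I * r * p.1) = ((δ 0 : ℤ) : ℂ) ∧
    (∃ n : ℤ, p.2 = 1 / 2 * n) ∧
    Complex.exp (2 * Real.pi * Complex.I * p.2) = ((δ 1 : ℤ) : ℂ)}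

/-- Index set of the eigenvalues for `δ₃ = 1`, each eigenvalue occurring as often as its multiplicity
prescribes: `(α, β, ±)` once; `τ ∈ ℕ`, `2τr` times; `(τ, k, ±)` with `τ, k ∈ ℕ`, `2τr` times.
Here `ℕ = {1, 2, …}`. -/
abbrev EigenIndexA (r : ℕ) (δ : Fin 3 → ℤˣ) : Type :=
  (torusPairs r δ × ℤˣ) ⊕ (Σ τ : ℕ+, Fin (2 * τ * r)) ⊕ (Σ x : ℕ+ × ℕ+ × ℤˣ, Fin (2 * x.1 * r))

/-- The eigenvalue with a given index, for `δ₃ = 1`. -/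
def eigenvalueA (d T : ℝ) {r : ℕ} {δ : Fin 3 → ℤˣ} : EigenIndexA r δ → ℝ
  | .inl (p, s) => lamTorus d T p.1.1 p.1.2 s
  | .inr (.inl ⟨τ, _⟩) => lamTau d T (τ : ℕ)
  | .inr (.inr ⟨(τ, k, s), _⟩) => lamTauK d T (τ : ℕ) (k : ℕ) s

/-- Index set of the eigenvalues for `δ₃ = -1`: `τ = n + 1/2`, `2τr` times; `(τ, k, ±)` with
`τ = n + 1/2` and `k ∈ {1, 2, …}`, `2τr` times.  Note `2τr = (2n + 1)r`. -/
abbrev EigenIndexB (r : ℕ) : Type :=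
  (Σ n : ℕ, Fin ((2 * n + 1) * r)) ⊕ (Σ x : ℕ × ℕ+ × ℤˣ, Fin ((2 * x.1 + 1) * r))

/-- The eigenvalue with a given index, for `δ₃ = -1`. -/
def eigenvalueB (d T : ℝ) {r : ℕ} : EigenIndexB r → ℝ
  | .inl ⟨n, _⟩ => lamTau d T (n + 1 / 2)
  | .inr ⟨(n, k, s), _⟩ => lamTauK d T (n + 1 / 2) (k : ℕ) s

end

/-! Spin structures. The group G is contractible, so the left invariant frame, viewed as a map from
G to the frame bundle, lifts through the twofold covering (`exists_isLift`), uniquely up to sign.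
Left translation by a lattice element yields another lift, hence changes the given one by a sign;
this defines ε (`IsLift.exists_hom`). The lift presents P as the quotient of G × Spin(3) by the
lattice acting through ε (`isQuotientMap_ofLift`, `ofLift_eq_iff`), so ε determines P up to
equivalence. Conversely this quotient is a spin structure for every ε (`spinStructure`). The three
generators satisfy g(r,0,0) g(0,1,0) = g(0,1,0) g(r,0,0) g(0,0,1)^r, and the only constraint on
their signs is that the r-th power of the third one is 1.

Spectrum. Pulled back along the lift, spinors are pairs of functions on G which are invariant under
the lattice up to ε, and D + d²T/4 becomes the matrix with rows (iT⁻¹Z, -id(X + iY)) and (-id(X -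
iY), -iT⁻¹Z) (`diracG_eq`, `nonempty_eigenspace_equiv`). Fourier expansion in the central variable z
splits the eigenspaces into modes τ, where τ runs through ℤ or ℤ + 1/2 according to δ₃, and Z acts
as 2πiτ (`finrank_heisSpinors`).

For τ = 0 the functions live on a torus, X and Y are diagonalised by characters, and 2 × 2 matrices
with eigenvalues ±2πd√(α² + β²) remain (`finrank_torusSpinors`).

For τ > 0 put a = X - iY, b = -(X + iY), m = 2πτ/T. Then ab - ba = 4πτ, and the operator is the
matrix with rows (-m, idb) and (-ida, m). The algebra of ladder operators gives the eigenvalues -m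
and ±√(m² + 4πd²τk) with k ≥ 1, each with eigenspace isomorphic to ker a (`ladderSpinors_equiv`,
`ladderSpinors_subsingleton`). This requires ba to be bounded below, which a maximum principle for
X² + Y² provides (`eq_zero_of_raise_lower`), so no Hilbert space theory of D enters. For τ < 0
exchanging the two components reduces to the same system with |τ|.

The space ker a has dimension |τ|r (`groundEquiv`). The Fourier coefficients in y of its elements
solve a first order equation in x, and translation by r in x identifies them modulo |τ|r, which
bounds the dimension; theta functions realise every choice of the remaining values. The modes τ and
-τ together give the multiplicity 2τr. Only finitely many modes contribute to a given eigenvalue,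
since its modulus, after the shift, is at least 2π|τ|/T. -/

noncomputable section

/-! ### Linear algebra -/

/-- A vector space with a jointly injective family of coordinate maps `Q i` that admit sections `J i`
has dimension the sum of the dimensions of the targets, if this sum is finite. -/
theorem finrank_of_decomposition {V I : Type*} [AddCommGroup V] [Module ℂ V]
    {W : I → Type*} [∀ i, AddCommGroup (W i)] [∀ i, Module ℂ (W i)]
    (Q : ∀ i, V →ₗ[ℂ] W i) (J : ∀ i, W i →ₗ[ℂ] V) (hQJ : ∀ i w, Q i (J i w) = w)
    (hne : ∀ i j, i ≠ j → ∀ w, Q j (J i w) = 0) (hinj : ∀ v, (∀ i, Q i v = 0) → v = 0)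
    (hfin : ∀ i, Module.Finite ℂ (W i)) {B : I → Type*} [Finite (Σ i, B i)]
    (hB : ∀ i, Module.finrank ℂ (W i) = Nat.card (B i)) :
    Module.Finite ℂ V ∧ Module.finrank ℂ V = Nat.card (Σ i, B i) := by
  classical
  have hBf : ∀ i, Finite (B i) := fun i =>
    Finite.of_injective (fun b => (⟨i, b⟩ : Σ i, B i)) sigma_mk_injective
  -- Only indices with nonempty `B i` matter: there are finitely many of them, and `W i` vanishes
  -- for all others, so V is a finite product.
  let F := {i : I // Nonempty (B i)}
  have : Finite F := Finite.of_surjective (fun x : Σ i, B i => (⟨x.1, ⟨x.2⟩⟩ : F))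
    fun ⟨i, ⟨b⟩⟩ => ⟨⟨i, b⟩, rfl⟩
  have : Fintype F := Fintype.ofFinite F
  have hz : ∀ i, ¬ Nonempty (B i) → Subsingleton (W i) := by
    intro i hi
    have : IsEmpty (B i) := not_nonempty_iff.1 hi
    exact Module.finrank_zero_iff.1 (by rw [hB i, Nat.card_of_isEmpty])
  let L : V →ₗ[ℂ] (∀ i : F, W i) := LinearMap.pi fun i => Q i
  have hL : Function.Bijective L := by
    constructor
    · rw [injective_iff_map_eq_zero]
      intro v hv
      refine hinj v fun i => ?_
      by_cases hi : Nonempty (B i)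
      · exact congrFun hv ⟨i, hi⟩
      · have := hz i hi
        exact Subsingleton.elim _ _
    · intro w
      refine ⟨∑ i : F, J i (w i), ?_⟩
      ext i
      simp only [L, LinearMap.pi_apply, map_sum]
      rw [Finset.sum_eq_single i, hQJ]
      · exact fun j _ hj => hne _ _ (fun h => hj (Subtype.ext h)) _
      · simp
  let e := LinearEquiv.ofBijective L hL
  have h1 : Module.finrank ℂ V = Nat.card (Σ i : F, B i) := by
    rw [e.finrank_eq, Module.finrank_pi_fintype, Nat.card_sigma]
    exact Finset.sum_congr rfl fun i _ => hB i
  refine ⟨Module.Finite.equiv e.symm, h1.trans (Nat.card_congr ?_)⟩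
  exact
    { toFun := fun x => ⟨x.1.1, x.2⟩
      invFun := fun x => ⟨⟨x.1, ⟨x.2⟩⟩, x.2⟩
      left_inv := fun _ => rfl
      right_inv := fun _ => rfl }

/-! ### Ladder operators and the first order system built from them -/

section Ladder

variable {V : Type*} [AddCommGroup V] [Module ℂ V] {a b : V →ₗ[ℂ] V} {c C : ℝ}

/-- The number operator `b a` of a pair of ladder operators with `a b - b a = c > 0` has no spectrum
outside `c ℕ`, if it is bounded from below. -/
theorem ladder_eq_zero (hc : 0 < c) (hab : ∀ v, a (b v) - b (a v) = (c : ℂ) • v)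
    (hpos : ∀ N : ℂ, N.re < C → ∀ v, b (a v) = N • v → v = 0)
    {N : ℂ} (hN : ∀ k : ℕ, N ≠ c * k) {v : V} (hv : b (a v) = N • v) : v = 0 := by
  -- The number n is large enough for n lowerings by c to push the eigenvalue below the bound C.
  obtain ⟨n, hn⟩ := exists_nat_gt ((N.re - C) / c)
  rw [div_lt_iff₀ hc] at hn
  replace hn : N.re - c * n < C := by linarith
  induction n generalizing N v with
  | zero => exact hpos N (by simpa using hn) v hv
  | succ n ih =>
    have h1 : b (a (a v)) = (N - c) • a v := by
      have := hab (a v)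
      rw [hv, map_smul, sub_eq_iff_eq_add] at this
      rw [sub_smul, this]; abel
    -- The vector a v has eigenvalue N - c, so induction kills it; then N v = 0, and N ≠ 0 is the
    -- case k = 0 of the assumption.
    have h2 : a v = 0 := by
      refine ih (N := N - c) (fun k hk => hN (k + 1) ?_) h1 ?_
      · push_cast; linear_combination hk
      · push_cast at hn ⊢; simp; linarith
    rw [h2, map_zero] at hv
    exact (smul_eq_zero.1 hv.symm).resolve_left (by simpa using hN 0)

/-- The commutation relation gives b(a(a v)) = -c a v, and -c is not in cℕ. -/
theorem ladder_ker (hc : 0 < c) (hab : ∀ v, a (b v) - b (a v) = (c : ℂ) • v)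
    (hpos : ∀ N : ℂ, N.re < C → ∀ v, b (a v) = N • v → v = 0)
    {v : V} (hv : b (a v) = 0) : a v = 0 := by
  refine ladder_eq_zero hc hab hpos (N := -c) (fun k hk => ?_) ?_
  · have : -c = c * k := by exact_mod_cast hk
    have := mul_nonneg hc.le k.cast_nonneg
    linarith
  · have := hab (a v)
    rw [hv, map_zero, zero_sub] at this
    rw [neg_smul, ← this, neg_neg]

/-- All eigenspaces of the number operator are isomorphic to the space of ground states. -/
theorem ladder_eigenspace_equiv (hc : 0 < c) (hab : ∀ v, a (b v) - b (a v) = (c : ℂ) • v)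
    (hpos : ∀ N : ℂ, N.re < C → ∀ v, b (a v) = N • v → v = 0) (k : ℕ) :
    Nonempty (Module.End.eigenspace (b ∘ₗ a) (c * k : ℂ) ≃ₗ[ℂ] LinearMap.ker a) := by
  induction k with
  | zero =>
    refine ⟨LinearEquiv.ofEq _ _ ?_⟩
    ext v
    simp only [Module.End.mem_eigenspace_iff, LinearMap.comp_apply, Nat.cast_zero, mul_zero,
      zero_smul, LinearMap.mem_ker]
    exact ⟨ladder_ker hc hab hpos, fun h => by rw [h, map_zero]⟩
  | succ k ih =>
    obtain ⟨e⟩ := ih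
    have hcc : (c : ℂ) ≠ 0 := by exact_mod_cast hc.ne'
    have hk : (c * (k + 1 : ℕ) : ℂ) ≠ 0 := mul_ne_zero hcc (by exact_mod_cast k.succ_ne_zero)
    -- The operator a lowers level k + 1 to level k; its inverse is b divided by c(k + 1).
    let A : Module.End.eigenspace (b ∘ₗ a) (c * (k + 1 : ℕ) : ℂ) →ₗ[ℂ]
        Module.End.eigenspace (b ∘ₗ a) (c * k : ℂ) :=
      a.restrict fun v hv => by
        simp only [Module.End.mem_eigenspace_iff, LinearMap.comp_apply] at hv ⊢
        have := hab (a v)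
        rw [hv, map_smul, sub_eq_iff_eq_add] at this
        have h2 : b (a (a v)) = (c * (k + 1 : ℕ) : ℂ) • a v - (c : ℂ) • a v := by
          rw [this]; abel
        rw [h2, ← sub_smul]; congr 1; push_cast; ring
    refine ⟨(LinearEquiv.ofBijective A ⟨?_, ?_⟩).trans e⟩
    · rw [injective_iff_map_eq_zero]
      rintro ⟨v, hv⟩ h0
      have h0 : a v = 0 := congrArg Subtype.val h0
      simp only [Module.End.mem_eigenspace_iff, LinearMap.comp_apply, h0, map_zero] at hv
      exact Subtype.ext ((smul_eq_zero.1 hv.symm).resolve_left hk)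
    · rintro ⟨w, hw⟩
      simp only [Module.End.mem_eigenspace_iff, LinearMap.comp_apply] at hw
      have h1 : a (b w) = (c * (k + 1 : ℕ) : ℂ) • w := by
        have := hab w
        rw [hw, sub_eq_iff_eq_add, ← add_smul] at this
        rw [this]; congr 1; push_cast; ring
      refine ⟨⟨(c * (k + 1 : ℕ) : ℂ)⁻¹ • b w, ?_⟩, Subtype.ext ?_⟩
      · simp only [Module.End.mem_eigenspace_iff, LinearMap.comp_apply, map_smul, h1]
        rw [smul_comm]
      · change a ((c * (k + 1 : ℕ) : ℂ)⁻¹ • b w) = w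
        rw [map_smul, h1, inv_smul_smul₀ hk]

/-- The eigenspace for `l` of the operator `(-m, i d b; -i d a, m)`. -/
def ladderSpinors (a b : V →ₗ[ℂ] V) (m d : ℝ) (l : ℂ) : Submodule ℂ (V × V) where
  carrier := {v | -(m : ℂ) • v.1 + (Complex.I * d) • b v.2 = l • v.1 ∧
    -(Complex.I * d) • a v.1 + (m : ℂ) • v.2 = l • v.2}
  zero_mem' := by simp
  add_mem' := by
    rintro u v ⟨h1, h2⟩ ⟨h3, h4⟩
    refine ⟨?_, ?_⟩
    · simp only [Prod.fst_add, Prod.snd_add, map_add, smul_add, ← h1, ← h3]; abel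
    · simp only [Prod.fst_add, Prod.snd_add, map_add, smul_add, ← h2, ← h4]; abel
  smul_mem' := by
    rintro s v ⟨h1, h2⟩
    refine ⟨?_, ?_⟩
    · simp only [Prod.smul_fst, Prod.smul_snd, map_smul]
      rw [smul_comm l s, ← h1, smul_add, smul_comm s, smul_comm s]
    · simp only [Prod.smul_fst, Prod.smul_snd, map_smul]
      rw [smul_comm l s, ← h2, smul_add, smul_comm s, smul_comm s]

theorem mem_ladderSpinors {m d : ℝ} {l : ℂ} {v : V × V} :
    v ∈ ladderSpinors a b m d l ↔ -(m : ℂ) • v.1 + (Complex.I * d) • b v.2 = l • v.1 ∧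
      -(Complex.I * d) • a v.1 + (m : ℂ) • v.2 = l • v.2 := Iff.rfl

/-- The eigenvalues of `(-m, i d b; -i d a, m)`. -/
def IsLadderEigenvalue (c m d : ℝ) (l : ℂ) : Prop :=
  l = -m ∨ ∃ k : ℕ, 1 ≤ k ∧ l ^ 2 = m ^ 2 + d ^ 2 * c * k

variable {m d : ℝ} {l : ℂ}

/-- At l = -m the first equation reduces to b v₂ = 0, so b(a v₂) = -c v₂ and v₂ = 0; the second one
then leaves a v₁ = 0. There is no counterpart at l = m ≠ 0, which is why the eigenvalue without k
occurs with one sign only. -/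
theorem ladderSpinors_lowest (hc : 0 < c) (hab : ∀ v, a (b v) - b (a v) = (c : ℂ) • v)
    (hpos : ∀ N : ℂ, N.re < C → ∀ v, b (a v) = N • v → v = 0) (hd : 0 < d)
    (hl : l = -m) : Nonempty (ladderSpinors a b m d l ≃ₗ[ℂ] LinearMap.ker a) := by
  have hdI : Complex.I * d ≠ 0 := mul_ne_zero Complex.I_ne_zero (by exact_mod_cast hd.ne')
  have key : ∀ v ∈ ladderSpinors a b m d l, v.2 = 0 ∧ a v.1 = 0 := by
    rintro v ⟨h1, h2⟩
    rw [hl, add_eq_left] at h1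
    have h3 : b v.2 = 0 := (smul_eq_zero.1 h1).resolve_left hdI
    have h4 : v.2 = 0 := by
      refine ladder_eq_zero hc hab hpos (N := -c) (fun k hk => ?_) ?_
      · have : -c = c * k := by exact_mod_cast hk
        have := mul_nonneg hc.le k.cast_nonneg
        linarith
      · have := hab v.2
        rw [h3, map_zero, zero_sub] at this
        rw [neg_smul, ← this, neg_neg]
    refine ⟨h4, ?_⟩
    rw [h4, smul_zero, smul_zero, add_zero] at h2
    exact (smul_eq_zero.1 h2).resolve_left (neg_ne_zero.2 hdI)
  exact ⟨
    { toFun := fun v => ⟨v.1.1, (key v.1 v.2).2⟩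
      map_add' := fun _ _ => rfl
      map_smul' := fun _ _ => rfl
      invFun := fun w => ⟨(w.1, 0), by
        have hw : a w.1 = 0 := w.2
        simp [mem_ladderSpinors, hw, hl]⟩
      left_inv := fun v => Subtype.ext (Prod.ext rfl (key v.1 v.2).1.symm)
      right_inv := fun _ => rfl }⟩

/-- Away from -m the first equation expresses v₁ through b v₂. Substitution into the second gives d²
a b v₂ = (l² - m²) v₂, and ab = ba + c accounts for the shift by c. -/
theorem ladderSpinors_equiv_eigenspace (hab : ∀ v, a (b v) - b (a v) = (c : ℂ) • v) (hd : 0 < d)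
    (hl : l ≠ -m) : Nonempty (ladderSpinors a b m d l ≃ₗ[ℂ]
      Module.End.eigenspace (b ∘ₗ a) ((l ^ 2 - m ^ 2) / d ^ 2 - c)) := by
  have hd0 : (d : ℂ) ≠ 0 := by exact_mod_cast hd.ne'
  have hdI : Complex.I * d ≠ 0 := mul_ne_zero Complex.I_ne_zero hd0
  have hlm : l + m ≠ 0 := fun h => hl (eq_neg_of_add_eq_zero_left h)
  have hI := Complex.I_mul_I
  have key : ∀ v ∈ ladderSpinors a b m d l, v.1 = (Complex.I * d / (l + m)) • b v.2 := by
    rintro v ⟨h1, -⟩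
    have : (l + m) • v.1 = (Complex.I * d) • b v.2 := by
      rw [add_smul, ← h1, neg_smul]; abel
    rw [div_eq_inv_mul, mul_smul, ← this, inv_smul_smul₀ hlm]
  have key2 : ∀ w : V, a (b w) = b (a w) + (c : ℂ) • w := fun w => by rw [← hab w]; abel
  refine ⟨
    { toFun := fun v => ⟨v.1.2, ?_⟩
      map_add' := fun _ _ => rfl
      map_smul' := fun _ _ => rfl
      invFun := fun w => ⟨((Complex.I * d / (l + m)) • b w.1, w.1), ?_⟩
      left_inv := fun v => Subtype.ext (Prod.ext (key v.1 v.2).symm rfl)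
      right_inv := fun _ => rfl }⟩
  · have h2 := v.2.2
    rw [key v.1 v.2, map_smul, key2, smul_smul, smul_add, smul_smul] at h2
    have h3 : (d ^ 2 / (l + m)) • b (a v.1.2) = (l - m - d ^ 2 / (l + m) * c) • v.1.2 := by
      have e : -(Complex.I * d) * (Complex.I * d / (l + m)) = d ^ 2 / (l + m) := by
        field_simp; linear_combination (-1 : ℂ) * hI
      rw [e] at h2
      rw [sub_smul, sub_smul, ← h2]; abel
    rw [Module.End.mem_eigenspace_iff, LinearMap.comp_apply]
    have hq : ((d : ℂ) ^ 2 / (l + m)) ≠ 0 := div_ne_zero (pow_ne_zero 2 hd0) hlm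
    rw [← inv_smul_smul₀ hq (b (a v.1.2)), h3, smul_smul]
    congr 1
    field_simp
    ring
  · have hw := w.2
    rw [Module.End.mem_eigenspace_iff, LinearMap.comp_apply] at hw
    rw [mem_ladderSpinors]
    constructor
    · simp only [smul_smul, ← add_smul]
      congr 1
      field_simp
      ring
    · simp only [map_smul, key2, hw, smul_smul, ← add_smul]
      congr 1
      field_simp
      linear_combination (-1 : ℂ) * (l + m) * (l - m) * hI

/-- Because of the shift by c, the index k ≥ 1 of the eigenvalue corresponds to level k - 1 of ba,
and all levels are isomorphic to ker a. -/
theorem ladderSpinors_equiv (hc : 0 < c) (hab : ∀ v, a (b v) - b (a v) = (c : ℂ) • v)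
    (hpos : ∀ N : ℂ, N.re < C → ∀ v, b (a v) = N • v → v = 0) (hd : 0 < d)
    (hl : IsLadderEigenvalue c m d l) :
    Nonempty (ladderSpinors a b m d l ≃ₗ[ℂ] LinearMap.ker a) := by
  have hd0 : (d : ℂ) ≠ 0 := by exact_mod_cast hd.ne'
  by_cases hlm : l = -m
  · exact ladderSpinors_lowest hc hab hpos hd hlm
  · obtain ⟨k, hk, hlk⟩ := hl.resolve_left hlm
    obtain ⟨n, rfl⟩ : ∃ n, k = n + 1 := ⟨k - 1, by omega⟩
    obtain ⟨e⟩ := ladderSpinors_equiv_eigenspace (a := a) (b := b) hab hd hlm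
    obtain ⟨e'⟩ := ladder_eigenspace_equiv hc hab hpos n
    have : (l ^ 2 - m ^ 2) / d ^ 2 - c = (c * n : ℂ) := by
      rw [hlk]; field_simp; push_cast; ring
    rw [this] at e
    exact ⟨e.trans e'⟩

theorem ladderSpinors_subsingleton (hc : 0 < c) (hab : ∀ v, a (b v) - b (a v) = (c : ℂ) • v)
    (hpos : ∀ N : ℂ, N.re < C → ∀ v, b (a v) = N • v → v = 0) (hd : 0 < d)
    (hl : ¬ IsLadderEigenvalue c m d l) : Subsingleton (ladderSpinors a b m d l) := by
  have hd0 : (d : ℂ) ≠ 0 := by exact_mod_cast hd.ne'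
  rw [IsLadderEigenvalue, not_or] at hl
  obtain ⟨hlm, hk⟩ := hl
  obtain ⟨e⟩ := ladderSpinors_equiv_eigenspace (a := a) (b := b) hab hd hlm
  refine e.toEquiv.subsingleton_congr.2 ⟨fun u v => ?_⟩
  have : ∀ u : Module.End.eigenspace (b ∘ₗ a) ((l ^ 2 - m ^ 2) / d ^ 2 - c : ℂ), u = 0 := by
    rintro ⟨u, hu⟩
    rw [Module.End.mem_eigenspace_iff, LinearMap.comp_apply] at hu
    -- Level k of ba would make l the eigenvalue with index k + 1.
    refine Subtype.ext (ladder_eq_zero hc hab hpos (fun k hk' => hk ⟨k + 1, by omega, ?_⟩) hu)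
    field_simp at hk'
    push_cast
    linear_combination hk'
  rw [this u, this v]

end Ladder

/-! ### Parametric integrals -/

section ParametricIntegral

variable {P E : Type} [NormedAddCommGroup P] [NormedSpace ℝ P] [ProperSpace P]
  [NormedAddCommGroup E] [NormedSpace ℝ E] {f : P × ℝ → E}

/-- The partial derivative is bounded on the compact product of the closed unit ball around p and
the interval; this constant is the dominating function. -/
theorem hasFDerivAt_parametric_intervalIntegral (hf : ContDiff ℝ 1 f) (a b : ℝ) (p : P) :
    HasFDerivAt (fun p => ∫ t in a..b, f (p, t))
      (∫ t in a..b, (fderiv ℝ f (p, t)).comp (ContinuousLinearMap.inl ℝ P ℝ)) p := by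
  have hf' : Continuous fun q : P × ℝ =>
      (fderiv ℝ f q).comp (ContinuousLinearMap.inl ℝ P ℝ) :=
    (hf.continuous_fderiv one_ne_zero).clm_comp continuous_const
  obtain ⟨K, hK⟩ := ((isCompact_closedBall p 1).prod (isCompact_uIcc (a := a) (b := b))).exists_bound_of_continuousOn
    hf'.continuousOn
  refine intervalIntegral.hasFDerivAt_integral_of_dominated_of_fderiv_le
    (F := fun p t => f (p, t)) (F' := fun p t =>
      (fderiv ℝ f (p, t)).comp (ContinuousLinearMap.inl ℝ P ℝ))
    (bound := fun _ => K) (s := Metric.closedBall p 1)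
    (Metric.closedBall_mem_nhds p one_pos) ?_ ?_ ?_ ?_ ?_ ?_
  · exact .of_forall fun q =>
      (hf.continuous.comp (Continuous.prodMk_right q)).aestronglyMeasurable
  · exact (hf.continuous.comp (Continuous.prodMk_right p)).intervalIntegrable a b
  · exact (hf'.comp (Continuous.prodMk_right p)).aestronglyMeasurable
  · exact .of_forall fun t ht q hq => hK (q, t) ⟨hq, Set.uIoc_subset_uIcc ht⟩
  · exact intervalIntegrable_const
  · refine .of_forall fun t _ q _ => ?_
    exact ((hf.differentiable one_ne_zero (q, t)).hasFDerivAt).comp q (hasFDerivAt_prodMk_left q t)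

/-- By differentiation under the integral sign the derivative is again a parametric integral, of one
order less of smoothness and with another target space; hence the induction over all E. -/
theorem contDiff_parametric_intervalIntegral {n : ℕ} (hf : ContDiff ℝ n f) (a b : ℝ) :
    ContDiff ℝ n fun p => ∫ t in a..b, f (p, t) := by
  induction n generalizing E with
  | zero =>
    rw [Nat.cast_zero, contDiff_zero] at hf ⊢
    exact intervalIntegral.continuous_parametric_intervalIntegral_of_continuous'
      (f := fun p t => f (p, t)) hf a b
  | succ n ih =>
    have h1 : ContDiff ℝ 1 f := hf.of_le (by exact_mod_cast Nat.le_add_left 1 n)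
    have hd := hasFDerivAt_parametric_intervalIntegral h1 a b
    rw [Nat.cast_succ, contDiff_succ_iff_fderiv] at hf ⊢
    refine ⟨fun p => (hd p).differentiableAt, by simp, ?_⟩
    rw [funext fun p => (hd p).fderiv]
    exact ih (f := fun q => (fderiv ℝ f q).comp (ContinuousLinearMap.inl ℝ P ℝ))
      (hf.2.2.clm_comp contDiff_const)

theorem contDiff_infty_parametric_intervalIntegral (hf : ContDiff ℝ ∞ f) (a b : ℝ) :
    ContDiff ℝ ∞ fun p => ∫ t in a..b, f (p, t) :=
  contDiff_infty.2 fun n => contDiff_parametric_intervalIntegral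
    (hf.of_le (by exact_mod_cast le_top)) a b

theorem fderiv_parametric_intervalIntegral [CompleteSpace E] (hf : ContDiff ℝ 1 f) (a b : ℝ)
    (p v : P) : fderiv ℝ (fun p => ∫ t in a..b, f (p, t)) p v
      = ∫ t in a..b, fderiv ℝ f (p, t) (v, 0) := by
  rw [(hasFDerivAt_parametric_intervalIntegral hf a b p).fderiv,
    ContinuousLinearMap.intervalIntegral_apply]
  · simp
  · exact Continuous.intervalIntegrable (((hf.continuous_fderiv one_ne_zero).comp
      (Continuous.prodMk_right p)).clm_comp continuous_const) a b

end ParametricIntegral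

/-! ### Characters of the real line -/

/-- The character `t ↦ exp (2πiτt)`. -/
def realChar (τ t : ℝ) : ℂ := Complex.exp (2 * Real.pi * Complex.I * τ * t)

theorem realChar_add_right (τ s t : ℝ) : realChar τ (s + t) = realChar τ s * realChar τ t := by
  simp only [realChar, ← Complex.exp_add]; congr 1; push_cast; ring

theorem realChar_add_left (σ τ t : ℝ) : realChar (σ + τ) t = realChar σ t * realChar τ t := by
  simp only [realChar, ← Complex.exp_add]; congr 1; push_cast; ring

@[simp] theorem realChar_zero_left (t : ℝ) : realChar 0 t = 1 := by simp [realChar]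
@[simp] theorem realChar_zero_right (t : ℝ) : realChar t 0 = 1 := by simp [realChar]

theorem realChar_neg_left (τ t : ℝ) : realChar (-τ) t = (realChar τ t)⁻¹ := by
  simp only [realChar, ← Complex.exp_neg]; congr 1; push_cast; ring

@[simp] theorem realChar_ne_zero (τ t : ℝ) : realChar τ t ≠ 0 := Complex.exp_ne_zero _

@[simp] theorem norm_realChar (τ t : ℝ) : ‖realChar τ t‖ = 1 := by
  rw [realChar, show (2 * Real.pi * Complex.I * τ * t : ℂ) = ((2 * Real.pi * τ * t : ℝ) : ℂ) * Complex.I by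
    push_cast; ring, Complex.norm_exp_ofReal_mul_I]

theorem realChar_mul_eq_one_iff {τ t : ℝ} : realChar τ t = 1 ↔ ∃ n : ℤ, τ * t = n := by
  rw [realChar, Complex.exp_eq_one_iff]
  refine exists_congr fun n => ?_
  have : (2 * Real.pi * Complex.I : ℂ) ≠ 0 := Complex.two_pi_I_ne_zero
  constructor
  · intro h
    have h2 : ((τ * t : ℝ) : ℂ) = n := by
      apply mul_right_cancel₀ this
      push_cast; linear_combination h
    exact_mod_cast h2
  · intro h
    have h2 : ((τ * t : ℝ) : ℂ) = n := by rw [h]; push_cast; rfl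
    push_cast at h2
    linear_combination (2 * Real.pi * Complex.I : ℂ) * h2

theorem realChar_int (n m : ℤ) : realChar n m = 1 :=
  realChar_mul_eq_one_iff.2 ⟨n * m, by push_cast; rfl⟩

theorem realChar_int_one (n : ℤ) : realChar n 1 = 1 := by simpa using realChar_int n 1

theorem contDiff_realChar (τ : ℝ) : ContDiff ℝ ∞ (realChar τ) := by
  unfold realChar
  exact (contDiff_const.mul Complex.ofRealCLM.contDiff).cexp

@[fun_prop]
theorem continuous_realChar (τ : ℝ) : Continuous (realChar τ) := (contDiff_realChar τ).continuous

theorem hasDerivAt_realChar (τ t : ℝ) :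
    HasDerivAt (realChar τ) (2 * Real.pi * Complex.I * τ * realChar τ t) t := by
  have h := ((Complex.ofRealCLM.hasDerivAt (x := t)).const_mul
    (2 * Real.pi * Complex.I * τ : ℂ)).cexp
  simp only [Complex.ofRealCLM_apply, Complex.ofReal_one, mul_one] at h
  rw [mul_comm]
  exact h

/-! ### Fourier coefficients of functions that are periodic up to a character -/

/-- Orthogonality of characters: an antiderivative is a multiple of the character, which takes the
same value at both ends. -/
theorem intervalIntegral_realChar_eq_zero {τ L : ℝ} (h1 : realChar τ L = 1) (h0 : τ ≠ 0) :
    ∫ t in (0 : ℝ)..L, realChar τ t = 0 := by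
  have hc : (2 * Real.pi * Complex.I * τ : ℂ) ≠ 0 :=
    mul_ne_zero Complex.two_pi_I_ne_zero (by exact_mod_cast h0)
  have h := intervalIntegral.integral_eq_sub_of_hasDerivAt
    (fun t _ => hasDerivAt_realChar τ t)
    ((continuous_const.mul (continuous_realChar τ)).intervalIntegrable 0 L)
  rw [h1, realChar_zero_right, sub_self, intervalIntegral.integral_const_mul] at h
  exact (mul_eq_zero.1 h).resolve_left hc

/-- Integration by parts; the boundary terms cancel because f picks up exactly the factor that the
character removes. -/
theorem intervalIntegral_realChar_mul_deriv {α L : ℝ} {f f' : ℝ → ℂ}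
    (hf : ∀ t, HasDerivAt f (f' t) t) (hf' : Continuous f') (hper : f L = realChar α L * f 0) :
    ∫ t in (0 : ℝ)..L, realChar (-α) t * f' t
      = 2 * Real.pi * Complex.I * α * ∫ t in (0 : ℝ)..L, realChar (-α) t * f t := by
  have hfc : Continuous f := continuous_iff_continuousAt.2 fun t => (hf t).continuousAt
  have h := intervalIntegral.integral_eq_sub_of_hasDerivAt
    (fun t _ => (hasDerivAt_realChar (-α) t).mul (hf t))
    (Continuous.intervalIntegrable (by fun_prop) 0 L)
  simp only [Pi.mul_apply] at h
  rw [hper, realChar_zero_right, realChar_neg_left α L, one_mul,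
    inv_mul_cancel_left₀ (realChar_ne_zero _ _), sub_self, intervalIntegral.integral_add
      (Continuous.intervalIntegrable (by fun_prop) 0 L)
      (Continuous.intervalIntegrable (by fun_prop) 0 L)] at h
  rw [← intervalIntegral.integral_const_mul, eq_comm, ← sub_eq_zero, ← neg_eq_zero, neg_sub, ← h, add_comm,
    sub_eq_add_neg, ← intervalIntegral.integral_neg]
  congr 2
  ext t; push_cast; ring

/-- A continuous function that is periodic up to a character vanishes if all its Fourier
coefficients do. -/
theorem eq_zero_of_fourier_eq_zero {κ L : ℝ} (hL : 0 < L) {f : ℝ → ℂ} (hf : Continuous f)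
    (hper : ∀ t, f (t + L) = realChar κ L * f t)
    (h0 : ∀ n : ℤ, ∫ t in (0 : ℝ)..L, realChar (-(κ + n / L)) t * f t = 0) : f = 0 := by
  -- Removing the character makes the function L-periodic. The given integrals are its Fourier
  -- coefficients up to a scalar, so Parseval's identity makes its L² norm zero, and continuity does
  -- the rest.
  let g : ℝ → ℂ := fun t => realChar (-κ) t * f t
  have hg : Continuous g := by fun_prop
  have hgp : Function.Periodic g L := fun t => by
    have := realChar_ne_zero κ L
    simp only [g, hper, realChar_add_right, realChar_neg_left]
    field_simp
  obtain ⟨K, hK⟩ := isCompact_Icc.exists_bound_of_continuousOn (hg.continuousOn (s := Set.Icc 0 L))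
  have hmem : MeasureTheory.MemLp g 2 (MeasureTheory.volume.restrict (Set.Ioc 0 L)) :=
    (MeasureTheory.MemLp.of_bound hg.aestronglyMeasurable K
      ((MeasureTheory.ae_restrict_iff' measurableSet_Ioc).2
        (.of_forall fun t ht => hK t (Set.Ioc_subset_Icc_self ht))))
  have hs := hasSum_sq_fourierCoeffOn hL hmem
  have hz : ∀ n, fourierCoeffOn hL g n = 0 := by
    intro n
    suffices h : ∫ t in (0 : ℝ)..L, fourier (-n) (t : AddCircle (L - 0)) • g t = 0 by
      rw [fourierCoeffOn_eq_integral, h, smul_zero]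
    rw [← h0 n]
    refine intervalIntegral.integral_congr fun t _ => ?_
    have he : fourier (-n) (t : AddCircle (L - 0)) = realChar (-(n / L)) t := by
      simp only [fourier_coe_apply, realChar]
      congr 1
      push_cast
      ring
    simp only [g, smul_eq_mul, he, neg_add, realChar_add_left]
    ring
  simp only [hz, norm_zero, ne_eq, OfNat.ofNat_ne_zero, not_false_eq_true, zero_pow] at hs
  have hi : ∫ t in (0 : ℝ)..L, ‖g t‖ ^ 2 = 0 := by
    have := hasSum_zero.unique hs
    rw [eq_comm, smul_eq_zero] at this
    exact this.resolve_left (inv_ne_zero (by linarith))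
  have hg0 : ∀ t ∈ Set.Icc 0 L, g t = 0 := by
    intro t ht
    by_contra hne
    have := intervalIntegral.integral_pos hL (f := fun t => ‖g t‖ ^ 2)
      (by fun_prop) (fun _ _ => by positivity) ⟨t, ht, by positivity⟩
    linarith
  have hgz : ∀ t, g t = 0 := by
    intro t
    obtain ⟨y, hy, hty⟩ := hgp.exists_mem_Ico₀ hL t
    rw [hty, hg0 y ⟨hy.1, hy.2.le⟩]
  ext t
  exact (mul_eq_zero.1 (hgz t)).resolve_left (realChar_ne_zero _ _)

/-! ### Twisted functions on the torus -/

/-- The smooth functions on the plane that correspond to the Fourier coefficients at `exp (2πiτz)` of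
functions on the Heisenberg group which are invariant under the lattice up to a character. -/
def twistedFn (r : ℕ) (κ₁ κ₂ τ : ℝ) : Submodule ℂ (ℝ × ℝ → ℂ) where
  carrier := {h | ContDiff ℝ ∞ h ∧
    (∀ x y, h (x + r, y) = realChar κ₁ 1 * realChar (-(τ * r)) y * h (x, y)) ∧
    ∀ x y, h (x, y + 1) = realChar κ₂ 1 * h (x, y)}
  zero_mem' := ⟨contDiff_const, by simp, by simp⟩
  add_mem' := by
    rintro f g ⟨hf, hf1, hf2⟩ ⟨hg, hg1, hg2⟩
    refine ⟨hf.add hg, fun x y => ?_, fun x y => ?_⟩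
    · simp only [Pi.add_apply, hf1, hg1]; ring
    · simp only [Pi.add_apply, hf2, hg2]; ring
  smul_mem' := by
    rintro c f ⟨hf, hf1, hf2⟩
    refine ⟨hf.const_smul c, fun x y => ?_, fun x y => ?_⟩
    · simp only [Pi.smul_apply, hf1, smul_eq_mul]; ring
    · simp only [Pi.smul_apply, hf2, smul_eq_mul]; ring

theorem ContDiff.fderiv_apply_const {E F : Type*} [NormedAddCommGroup E] [NormedSpace ℝ E]
    [NormedAddCommGroup F] [NormedSpace ℝ F] {f : E → F} (hf : ContDiff ℝ ∞ f) (v : E) :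
    ContDiff ℝ ∞ fun p => fderiv ℝ f p v :=
  (hf.fderiv_right (m := ∞) (by simp)).clm_apply contDiff_const

theorem hasDerivAt_fst_of_contDiff {h : ℝ × ℝ → ℂ} (hh : ContDiff ℝ ∞ h) (x y : ℝ) :
    HasDerivAt (fun t => h (t, y)) (fderiv ℝ h (x, y) (1, 0)) x :=
  ((hh.differentiable (by simp) (x, y)).hasFDerivAt).comp_hasDerivAt x
    ((hasDerivAt_id x).prodMk (hasDerivAt_const x y))

theorem hasDerivAt_snd_of_contDiff {h : ℝ × ℝ → ℂ} (hh : ContDiff ℝ ∞ h) (x y : ℝ) :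
    HasDerivAt (fun t => h (x, t)) (fderiv ℝ h (x, y) (0, 1)) y :=
  ((hh.differentiable (by simp) (x, y)).hasFDerivAt).comp_hasDerivAt y
    ((hasDerivAt_const y x).prodMk (hasDerivAt_id y))

theorem fderiv_fderiv_comm {E F : Type*} [NormedAddCommGroup E] [NormedSpace ℝ E]
    [NormedAddCommGroup F] [NormedSpace ℝ F] {f : E → F} (hf : ContDiff ℝ ∞ f) (p v w : E) :
    fderiv ℝ (fun q => fderiv ℝ f q v) p w = fderiv ℝ (fun q => fderiv ℝ f q w) p v := by
  have hd : DifferentiableAt ℝ (fderiv ℝ f) p :=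
    (hf.fderiv_right (m := ∞) (by simp)).differentiable (by simp) p
  have h2 : ContDiff ℝ (2 : ℕ) f := contDiff_infty.1 hf 2
  have hs := (h2.contDiffAt (x := p)).isSymmSndFDerivAt (by simp)
  rw [fderiv_clm_apply hd (differentiableAt_const v), fderiv_clm_apply hd (differentiableAt_const w)]
  simpa using hs w v

namespace twistedFn

variable {r : ℕ} {κ₁ κ₂ τ : ℝ}

theorem smooth (h : twistedFn r κ₁ κ₂ τ) : ContDiff ℝ ∞ h.1 := h.2.1

theorem add_fst (h : twistedFn r κ₁ κ₂ τ) (x y : ℝ) :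
    h.1 (x + r, y) = realChar κ₁ 1 * realChar (-(τ * r)) y * h.1 (x, y) := h.2.2.1 x y

theorem add_snd (h : twistedFn r κ₁ κ₂ τ) (x y : ℝ) :
    h.1 (x, y + 1) = realChar κ₂ 1 * h.1 (x, y) := h.2.2.2 x y

theorem fderiv_fst_add_fst (h : twistedFn r κ₁ κ₂ τ) (x y : ℝ) :
    fderiv ℝ h.1 (x + r, y) (1, 0)
      = realChar κ₁ 1 * realChar (-(τ * r)) y * fderiv ℝ h.1 (x, y) (1, 0) := by
  have h1 := (hasDerivAt_fst_of_contDiff (smooth h) (x + r) y).comp_add_const x r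
  have h2 := (hasDerivAt_fst_of_contDiff (smooth h) x y).const_mul
    (realChar κ₁ 1 * realChar (-(τ * r)) y)
  exact h1.unique (h2.congr_of_eventuallyEq (.of_forall fun t => (add_fst h) t y))

theorem fderiv_fst_add_snd (h : twistedFn r κ₁ κ₂ τ) (x y : ℝ) :
    fderiv ℝ h.1 (x, y + 1) (1, 0) = realChar κ₂ 1 * fderiv ℝ h.1 (x, y) (1, 0) := by
  have h1 := hasDerivAt_fst_of_contDiff (smooth h) x (y + 1)
  have h2 := (hasDerivAt_fst_of_contDiff (smooth h) x y).const_mul (realChar κ₂ 1)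
  exact h1.unique (h2.congr_of_eventuallyEq (.of_forall fun t => (add_snd h) t y))

/-- The twisting factor depends on y, so ∂_y alone does not preserve twisted functions. The extra
term is cancelled by the change of 2πiτx under x ↦ x + r, so `derivY` does preserve them. -/
theorem fderiv_snd_add_fst (h : twistedFn r κ₁ κ₂ τ) (x y : ℝ) :
    fderiv ℝ h.1 (x + r, y) (0, 1) = realChar κ₁ 1 * realChar (-(τ * r)) y *
      (fderiv ℝ h.1 (x, y) (0, 1) - 2 * Real.pi * Complex.I * τ * r * h.1 (x, y)) := by
  have h1 := hasDerivAt_snd_of_contDiff (smooth h) (x + r) y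
  have h2 := (((hasDerivAt_realChar (-(τ * r)) y).const_mul (realChar κ₁ 1)).mul
    (hasDerivAt_snd_of_contDiff (smooth h) x y))
  have h3 := h1.unique (h2.congr_of_eventuallyEq (.of_forall fun t => (add_fst h) x t))
  rw [h3]
  push_cast
  ring

theorem fderiv_snd_add_snd (h : twistedFn r κ₁ κ₂ τ) (x y : ℝ) :
    fderiv ℝ h.1 (x, y + 1) (0, 1) = realChar κ₂ 1 * fderiv ℝ h.1 (x, y) (0, 1) := by
  have h1 := (hasDerivAt_snd_of_contDiff (smooth h) x (y + 1)).comp_add_const y 1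
  have h2 := (hasDerivAt_snd_of_contDiff (smooth h) x y).const_mul (realChar κ₂ 1)
  exact h1.unique (h2.congr_of_eventuallyEq (.of_forall fun t => (add_snd h) x t))

/-- The left invariant vector field `X = ∂_x` on twisted functions. -/
def derivX (r : ℕ) (κ₁ κ₂ τ : ℝ) : twistedFn r κ₁ κ₂ τ →ₗ[ℂ] twistedFn r κ₁ κ₂ τ where
  toFun h := ⟨fun p => fderiv ℝ h.1 p (1, 0), (smooth h).fderiv_apply_const _,
    (fderiv_fst_add_fst h), (fderiv_fst_add_snd h)⟩
  map_add' f g := by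
    ext p
    simp [fderiv_add ((smooth f).differentiable (by simp) p)
      ((smooth g).differentiable (by simp) p)]
  map_smul' c f := by
    ext p
    simp [fderiv_const_smul ((smooth f).differentiable (by simp) p)]

/-- The left invariant vector field `Y = ∂_y + x ∂_z` on twisted functions. -/
def derivY (r : ℕ) (κ₁ κ₂ τ : ℝ) : twistedFn r κ₁ κ₂ τ →ₗ[ℂ] twistedFn r κ₁ κ₂ τ where
  toFun h := ⟨fun p => fderiv ℝ h.1 p (0, 1) + 2 * Real.pi * Complex.I * τ * p.1 * h.1 p, by
    refine ⟨((smooth h).fderiv_apply_const _).add ((contDiff_const.mul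
      (Complex.ofRealCLM.contDiff.comp contDiff_fst)).mul (smooth h)), fun x y => ?_, fun x y => ?_⟩
    · simp only [(fderiv_snd_add_fst h), (add_fst h)]; push_cast; ring
    · simp only [(fderiv_snd_add_snd h), (add_snd h)]; ring⟩
  map_add' f g := by
    ext p
    simp [fderiv_add ((smooth f).differentiable (by simp) p)
      ((smooth g).differentiable (by simp) p)]
    ring
  map_smul' c f := by
    ext p
    simp [fderiv_const_smul ((smooth f).differentiable (by simp) p)]
    ring

theorem derivX_apply (h : twistedFn r κ₁ κ₂ τ) (p : ℝ × ℝ) :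
    (derivX r κ₁ κ₂ τ h).1 p = fderiv ℝ h.1 p (1, 0) := rfl

theorem derivY_apply (h : twistedFn r κ₁ κ₂ τ) (p : ℝ × ℝ) :
    (derivY r κ₁ κ₂ τ h).1 p
      = fderiv ℝ h.1 p (0, 1) + 2 * Real.pi * Complex.I * τ * p.1 * h.1 p := rfl

/-- This is [X, Y] = Z with Z acting as 2πiτ; the bracket comes from differentiating the factor x in
`derivY`. -/
theorem derivX_derivY (h : twistedFn r κ₁ κ₂ τ) :
    derivX r κ₁ κ₂ τ (derivY r κ₁ κ₂ τ h) = derivY r κ₁ κ₂ τ (derivX r κ₁ κ₂ τ h)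
      + (2 * Real.pi * Complex.I * τ : ℂ) • h := by
  ext ⟨x, y⟩
  have hx := hasDerivAt_fst_of_contDiff (smooth h) x y
  have hxy := hasDerivAt_fst_of_contDiff ((smooth h).fderiv_apply_const (0, 1)) x y
  have h1 := hxy.add ((((Complex.ofRealCLM.hasDerivAt (x := x)).const_mul
    (2 * Real.pi * Complex.I * τ : ℂ))).mul hx)
  have h2 := (hasDerivAt_fst_of_contDiff (smooth (derivY r κ₁ κ₂ τ h)) x y).unique h1
  simp only [Submodule.coe_add, Submodule.coe_smul, Pi.add_apply, Pi.smul_apply, derivX_apply,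
    smul_eq_mul]
  rw [h2, fderiv_fderiv_comm (smooth h), derivY_apply]
  simp only [Complex.ofRealCLM_apply, Complex.ofReal_one]
  have : (derivX r κ₁ κ₂ τ h).1 = fun p => fderiv ℝ h.1 p (1, 0) := rfl
  rw [this]
  ring

/-- The annihilation operator `X - i s Y`. -/
def lower (r : ℕ) (κ₁ κ₂ τ s : ℝ) : twistedFn r κ₁ κ₂ τ →ₗ[ℂ] twistedFn r κ₁ κ₂ τ :=
  derivX r κ₁ κ₂ τ - (Complex.I * s) • derivY r κ₁ κ₂ τ

/-- The creation operator `-(X + i s Y)`. -/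
def raise (r : ℕ) (κ₁ κ₂ τ s : ℝ) : twistedFn r κ₁ κ₂ τ →ₗ[ℂ] twistedFn r κ₁ κ₂ τ :=
  -(derivX r κ₁ κ₂ τ + (Complex.I * s) • derivY r κ₁ κ₂ τ)

/-- The ladder argument needs a positive commutator. Choosing s as the sign of τ makes it 4π|τ|, so
both signs of τ are handled at once. -/
theorem lower_raise (s : ℝ) (h : twistedFn r κ₁ κ₂ τ) :
    lower r κ₁ κ₂ τ s (raise r κ₁ κ₂ τ s h) - raise r κ₁ κ₂ τ s (lower r κ₁ κ₂ τ s h)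
      = ((4 * Real.pi * (s * τ) : ℝ) : ℂ) • h := by
  simp only [lower, raise, LinearMap.sub_apply, LinearMap.add_apply, LinearMap.neg_apply,
    LinearMap.smul_apply, map_add, map_sub, map_neg, map_smul, derivX_derivY]
  match_scalars <;> ring_nf <;> simp [Complex.I_sq]

/-- Up to a constant the number operator is -(X² + Y²), to which the maximum principle applies. -/
theorem raise_lower {s : ℝ} (hs : s ^ 2 = 1) (h : twistedFn r κ₁ κ₂ τ) :
    raise r κ₁ κ₂ τ s (lower r κ₁ κ₂ τ s h) =
      -(derivX r κ₁ κ₂ τ (derivX r κ₁ κ₂ τ h) + derivY r κ₁ κ₂ τ (derivY r κ₁ κ₂ τ h))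
      - ((2 * Real.pi * (s * τ) : ℝ) : ℂ) • h := by
  simp only [lower, raise, LinearMap.sub_apply, LinearMap.add_apply, LinearMap.neg_apply,
    LinearMap.smul_apply, map_sub, map_smul, derivX_derivY]
  have hs' : (s : ℂ) ^ 2 = 1 := by exact_mod_cast hs
  match_scalars <;> ring_nf <;> simp [Complex.I_sq, hs']

end twistedFn

/-! ### The maximum principle -/

/-- The second derivative of |k|² is 2 Re(k̄ k'') + 2|k'|². If Re(k̄ k'') were positive at the
maximum, the maximum would also be a local minimum, |k|² would be locally constant, and its second
derivative would vanish. -/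
theorem re_conj_mul_deriv_deriv_nonpos {k k₁ : ℝ → ℂ} {k₂ : ℂ} {t₀ : ℝ}
    (hk : ∀ t, HasDerivAt k (k₁ t) t) (hk₁ : HasDerivAt k₁ k₂ t₀)
    (hmax : ∀ t, ‖k t‖ ≤ ‖k t₀‖) : (starRingEnd ℂ (k t₀) * k₂).re ≤ 0 := by
  have h1 : ∀ t, HasDerivAt (fun t => ‖k t‖ ^ 2) (2 * inner ℝ (k t) (k₁ t)) t :=
    fun t => (hk t).norm_sq
  have h2 : HasDerivAt (fun t => 2 * inner ℝ (k t) (k₁ t))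
      (2 * (inner ℝ (k t₀) k₂ + inner ℝ (k₁ t₀) (k₁ t₀))) t₀ :=
    ((hk t₀).inner ℝ hk₁).const_mul 2
  have hM : IsLocalMax (fun t => ‖k t‖ ^ 2) t₀ :=
    .of_forall fun t => pow_le_pow_left₀ (norm_nonneg _) (hmax t) 2
  have hd : deriv (fun t => ‖k t‖ ^ 2) = fun t => 2 * inner ℝ (k t) (k₁ t) :=
    funext fun t => (h1 t).deriv
  by_contra! hpos
  have hin : 0 < inner ℝ (k t₀) k₂ := by
    rw [Complex.inner, mul_comm]; simpa [mul_comm] using hpos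
  have hnn : 0 ≤ inner ℝ (k₁ t₀) (k₁ t₀) := real_inner_self_nonneg
  have hm : IsLocalMin (fun t => ‖k t‖ ^ 2) t₀ := by
    refine isLocalMin_of_deriv_deriv_pos ?_ ?_ (h1 t₀).continuousAt
    · rw [hd, h2.deriv]; linarith
    · exact hM.deriv_eq_zero
  have he : (fun t => ‖k t‖ ^ 2) =ᶠ[nhds t₀] fun _ => ‖k t₀‖ ^ 2 := by
    filter_upwards [hm, hM] with t ht1 ht2 using le_antisymm ht2 ht1
  have hz : (fun t => 2 * inner ℝ (k t) (k₁ t)) =ᶠ[nhds t₀] fun _ => 0 := by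
    rw [← hd]
    have := he.deriv
    simpa using this
  have := (h2.congr_of_eventuallyEq hz.symm).unique (hasDerivAt_const t₀ 0)
  linarith

namespace twistedFn

variable {r : ℕ} {κ₁ κ₂ τ : ℝ}

/-- The twisting factors have modulus one, so |h| is doubly periodic and its maximum over a compact
rectangle is global. -/
theorem exists_norm_max (hr : 0 < r) (h : twistedFn r κ₁ κ₂ τ) :
    ∃ p₀, ∀ p, ‖h.1 p‖ ≤ ‖h.1 p₀‖ := by
  have hr' : (0 : ℝ) < r := by exact_mod_cast hr
  have hc : Continuous fun p => ‖h.1 p‖ := (smooth h).continuous.norm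
  obtain ⟨p₀, -, hp₀⟩ := ((isCompact_Icc (a := (0 : ℝ)) (b := r)).prod
    (isCompact_Icc (a := (0 : ℝ)) (b := 1))).exists_isMaxOn
    ⟨(0, 0), ⟨le_refl _, hr'.le⟩, ⟨le_refl _, zero_le_one⟩⟩ hc.continuousOn
  refine ⟨p₀, fun p => ?_⟩
  obtain ⟨x, y⟩ := p
  have h1 : ∀ y, Function.Periodic (fun x => ‖h.1 (x, y)‖) r := fun y x => by
    simp [(add_fst h)]
  have h2 : ∀ x, Function.Periodic (fun y => ‖h.1 (x, y)‖) 1 := fun x y => by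
    simp [(add_snd h)]
  obtain ⟨x', hx', e1⟩ := (h1 y).exists_mem_Ico₀ hr' x
  obtain ⟨y', hy', e2⟩ := (h2 x').exists_mem_Ico₀ one_pos y
  rw [e1, e2]
  exact hp₀ (a := (x', y')) ⟨⟨hx'.1, hx'.2.le⟩, ⟨hy'.1, hy'.2.le⟩⟩

/-- The maximum principle for the operator `X² + Y²`. -/
theorem eq_zero_of_raise_lower (hr : 0 < r) {s : ℝ} (hs : s ^ 2 = 1) {N : ℂ}
    (hN : N.re < -(2 * Real.pi * (s * τ))) (h : twistedFn r κ₁ κ₂ τ)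
    (hh : raise r κ₁ κ₂ τ s (lower r κ₁ κ₂ τ s h) = N • h) : h = 0 := by
  obtain ⟨⟨x₀, y₀⟩, hmax⟩ := exists_norm_max hr h
  set u := h.1 (x₀, y₀) with hu
  have e1 := re_conj_mul_deriv_deriv_nonpos (k := fun t => h.1 (t, y₀)) (t₀ := x₀)
    (fun t => hasDerivAt_fst_of_contDiff (smooth h) t y₀)
    (hasDerivAt_fst_of_contDiff (smooth (derivX r κ₁ κ₂ τ h)) x₀ y₀) fun t => hmax _
  -- On the line x = x₀ a factor of modulus one turns Y into the plain derivative in y, so the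
  -- one-variable inequality also applies to Y².
  have hk : ∀ (g : twistedFn r κ₁ κ₂ τ) (t : ℝ),
      HasDerivAt (fun t => realChar (τ * x₀) t * g.1 (x₀, t))
        (realChar (τ * x₀) t * (derivY r κ₁ κ₂ τ g).1 (x₀, t)) t := by
    intro g t
    refine ((hasDerivAt_realChar (τ * x₀) t).mul
      (hasDerivAt_snd_of_contDiff (smooth g) x₀ t)).congr_deriv ?_
    rw [derivY_apply]
    push_cast
    ring
  have e2 := re_conj_mul_deriv_deriv_nonpos (t₀ := y₀) (hk h) (hk (derivY r κ₁ κ₂ τ h) y₀)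
    fun t => by simpa using hmax _
  rw [← derivX_apply] at e1
  have e3 : starRingEnd ℂ (realChar (τ * x₀) y₀) * realChar (τ * x₀) y₀ = 1 := by
    rw [mul_comm, Complex.mul_conj, Complex.normSq_eq_norm_sq, norm_realChar]; simp
  have e4 : starRingEnd ℂ (realChar (τ * x₀) y₀ * h.1 (x₀, y₀)) * (realChar (τ * x₀) y₀ *
      (derivY r κ₁ κ₂ τ (derivY r κ₁ κ₂ τ h)).1 (x₀, y₀))
      = starRingEnd ℂ u * (derivY r κ₁ κ₂ τ (derivY r κ₁ κ₂ τ h)).1 (x₀, y₀) := by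
    rw [map_mul, ← hu]
    linear_combination (starRingEnd ℂ u * (derivY r κ₁ κ₂ τ (derivY r κ₁ κ₂ τ h)).1 (x₀, y₀)) * e3
  rw [e4] at e2
  have e5 := congrFun (congrArg Subtype.val (hh.symm.trans (raise_lower hs h))) (x₀, y₀)
  simp only [Submodule.coe_add, Submodule.coe_smul, Submodule.coe_sub, Submodule.coe_neg,
    Pi.add_apply, Pi.smul_apply, Pi.sub_apply, Pi.neg_apply, smul_eq_mul, ← hu] at e5
  -- The eigenvalue equation at the maximum, multiplied by ū: the left side is (Re N + 2πsτ)|u|²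
  -- with negative coefficient, the right side is nonnegative. Hence u = 0.
  have e6 : ((N + ((2 * Real.pi * (s * τ) : ℝ) : ℂ)) * (starRingEnd ℂ u * u)).re
      = -((starRingEnd ℂ u * (derivX r κ₁ κ₂ τ (derivX r κ₁ κ₂ τ h)).1 (x₀, y₀)).re
        + (starRingEnd ℂ u * (derivY r κ₁ κ₂ τ (derivY r κ₁ κ₂ τ h)).1 (x₀, y₀)).re) := by
    rw [← Complex.add_re, ← Complex.neg_re]
    congr 1
    linear_combination (starRingEnd ℂ u) * e5
  rw [mul_comm (starRingEnd ℂ u) u, Complex.mul_conj, Complex.re_mul_ofReal, Complex.add_re,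
    Complex.ofReal_re] at e6
  have e7 : Complex.normSq u ≤ 0 := by
    by_contra! hne
    have := mul_neg_of_neg_of_pos (show N.re + 2 * Real.pi * (s * τ) < 0 by linarith) hne
    linarith
  have e8 : u = 0 := Complex.normSq_eq_zero.1 (le_antisymm e7 (Complex.normSq_nonneg u))
  ext p
  have := hmax p
  rw [e8, norm_zero] at this
  simpa using this

end twistedFn

/-! ### Theta functions -/

theorem jacobiTheta₂_add_natCast (z τ : ℂ) (n : ℕ) : jacobiTheta₂ (z + n) τ = jacobiTheta₂ z τ := by
  induction n with
  | zero => simp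
  | succ n ih => rw [Nat.cast_succ, ← add_assoc, jacobiTheta₂_add_left, ih]

theorem jacobiTheta₂_add_sign_mul {s : ℝ} (hs : s ^ 2 = 1) (z τ : ℂ) :
    jacobiTheta₂ (z + s * τ) τ
      = Complex.exp (-(Real.pi * Complex.I * τ) - 2 * Real.pi * Complex.I * s * z)
        * jacobiTheta₂ z τ := by
  rcases mul_self_eq_one_iff.1 ((sq s).symm.trans hs) with rfl | rfl
  · rw [Complex.ofReal_one, one_mul, jacobiTheta₂_add_left']
    congr 2
    ring
  · have h := jacobiTheta₂_add_left' (z - τ) τ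
    rw [sub_add_cancel] at h
    rw [h, ← mul_assoc, ← Complex.exp_add]
    push_cast
    rw [show z + -1 * τ = z - τ by ring, show (-(Real.pi * Complex.I * τ) - 2 * Real.pi * Complex.I * -1 * z
      + -Real.pi * Complex.I * (τ + 2 * (z - τ)) : ℂ) = 0 by ring, Complex.exp_zero, one_mul]

theorem contDiff_jacobiTheta₂ {τ : ℂ} (hτ : 0 < τ.im) :
    ContDiff ℝ ∞ fun z => jacobiTheta₂ z τ := by
  have h : Differentiable ℂ fun z => jacobiTheta₂ z τ :=
    fun z => differentiableAt_jacobiTheta₂_fst z hτ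
  exact (h.contDiff (n := ∞)).restrict_scalars ℝ

theorem jacobiTheta₂_term_add_mul (n : ℤ) (R y : ℝ) (z τ : ℂ) :
    jacobiTheta₂_term n (R * y + z) τ = realChar (n * R) y * jacobiTheta₂_term n z τ := by
  rw [jacobiTheta₂_term, jacobiTheta₂_term, realChar, ← Complex.exp_add]
  congr 1
  push_cast
  ring

/-- As a Fourier series in y the theta function contains only frequencies divisible by R. Since |l|
< R, only n = l = 0 survives, and the corresponding term is 1. Normal convergence permits
integration term by term. -/
theorem integral_realChar_mul_jacobiTheta₂ {R : ℕ} {l : ℤ} (hl : |l| < R) (z : ℂ) {τ : ℂ}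
    (hτ : 0 < τ.im) :
    ∫ y in (0 : ℝ)..1, realChar l y * jacobiTheta₂ (R * y + z) τ = if l = 0 then 1 else 0 := by
  let f : ℤ → C(ℝ, ℂ) := fun n =>
    ⟨fun y => realChar l y * (realChar (n * R) y * jacobiTheta₂_term n z τ), by fun_prop⟩
  have hf : ∀ n y, f n y = realChar l y * jacobiTheta₂_term n (R * y + z) τ := fun n y => by
    have := jacobiTheta₂_term_add_mul n R y z τ
    push_cast at this
    rw [this]; rfl
  have hsum : Summable fun n => ‖(f n).restrict
      (⟨Set.uIcc 0 1, isCompact_uIcc⟩ : TopologicalSpace.Compacts ℝ)‖ := by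
    refine Summable.of_nonneg_of_le (fun _ => norm_nonneg _) (fun n => ?_)
      ((summable_jacobiTheta₂_term_iff z τ).2 hτ).norm
    rw [ContinuousMap.norm_le _ (norm_nonneg _)]
    intro y
    simp [f]
  have h := intervalIntegral.hasSum_intervalIntegral_of_summable_norm hsum
  have h1 : ∀ y : ℝ, ∑' n, f n y = realChar l y * jacobiTheta₂ (R * y + z) τ := fun y => by
    simp only [hf]
    rw [tsum_mul_left, jacobiTheta₂]
  simp only [h1] at h
  refine h.unique ?_
  have h2 : ∀ n, ∫ y in (0 : ℝ)..1, f n y = if n = 0 then (if l = 0 then 1 else 0) else 0 := by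
    intro n
    have e : ∀ y, f n y = realChar ((l + n * R : ℤ) : ℝ) y * jacobiTheta₂_term n z τ := fun y => by
      push_cast
      rw [realChar_add_left, mul_assoc]; rfl
    simp only [e, intervalIntegral.integral_mul_const]
    by_cases h0 : l + n * R = 0
    · have hn : n = 0 := by
        by_contra hn
        have h3 : l = -(n * R) := by linarith
        rw [h3, abs_neg, abs_mul, Nat.abs_cast] at hl
        have := Int.one_le_abs hn
        nlinarith
      subst hn
      have : l = 0 := by simpa using h0
      simp [this, jacobiTheta₂_term]
    · rw [intervalIntegral_realChar_eq_zero (realChar_int_one _) (by exact_mod_cast h0), zero_mul]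
      split_ifs with h4 h5
      · exact absurd (by rw [h4, h5]; simp) h0
      · rfl
      · rfl
  simp only [h2]
  exact hasSum_ite_eq 0 _

namespace twistedFn

variable {r : ℕ} {κ₁ κ₂ τ : ℝ}

/-! ### Fourier coefficients in the second variable -/

/-- The Fourier coefficient at `exp (2πiβy)`. -/
def fourierY (β : ℝ) (h : ℝ × ℝ → ℂ) (x : ℝ) : ℂ := ∫ y in (0 : ℝ)..1, realChar (-β) y * h (x, y)

theorem contDiff_realChar_snd_mul {h : ℝ × ℝ → ℂ} (hh : ContDiff ℝ ∞ h) (β : ℝ) :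
    ContDiff ℝ ∞ fun p : ℝ × ℝ => realChar (-β) p.2 * h p :=
  ((contDiff_realChar _).comp contDiff_snd).mul hh

theorem hasDerivAt_fourierY {h : ℝ × ℝ → ℂ} (hh : ContDiff ℝ ∞ h) (β x : ℝ) :
    HasDerivAt (fourierY β h) (fourierY β (fun p => fderiv ℝ h p (1, 0)) x) x := by
  have hc := contDiff_realChar_snd_mul hh β
  have h1 := (hasFDerivAt_parametric_intervalIntegral (hc.of_le (by exact_mod_cast le_top)) 0 1
    x).hasDerivAt
  rw [← (hasFDerivAt_parametric_intervalIntegral (hc.of_le (by exact_mod_cast le_top)) 0 1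
    x).fderiv, fderiv_parametric_intervalIntegral (hc.of_le (by exact_mod_cast le_top))] at h1
  refine h1.congr_deriv (intervalIntegral.integral_congr fun y _ => ?_)
  exact (hasDerivAt_fst_of_contDiff hc x y).unique
    ((hasDerivAt_fst_of_contDiff hh x y).const_mul (realChar (-β) y))

theorem fourierY_derivX (β : ℝ) (h : twistedFn r κ₁ κ₂ τ) (x : ℝ) :
    HasDerivAt (fourierY β h.1) (fourierY β (derivX r κ₁ κ₂ τ h).1 x) x :=
  hasDerivAt_fourierY (smooth h) β x

theorem continuous_section (h : twistedFn r κ₁ κ₂ τ) (x : ℝ) : Continuous fun y => h.1 (x, y) :=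
  (smooth h).continuous.comp (Continuous.prodMk_right x)

/-- Since Y becomes multiplication by a function of x, the equation of the ground states becomes an
ordinary differential equation in x for each frequency β. -/
theorem fourierY_derivY {β : ℝ} (hβ : realChar β 1 = realChar κ₂ 1) (h : twistedFn r κ₁ κ₂ τ)
    (x : ℝ) : fourierY β (derivY r κ₁ κ₂ τ h).1 x
      = 2 * Real.pi * Complex.I * (β + τ * x) * fourierY β h.1 x := by
  have hc := continuous_section h x
  have hc' : Continuous fun y => fderiv ℝ h.1 (x, y) (0, 1) :=
    ((smooth h).fderiv_apply_const (0, 1)).continuous.comp (Continuous.prodMk_right x)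
  have h1 := intervalIntegral_realChar_mul_deriv (α := β) (L := 1)
    (fun y => hasDerivAt_snd_of_contDiff (smooth h) x y) hc' (by
      have := add_snd h x 0
      rw [zero_add] at this
      rw [this, hβ])
  have hc2 : Continuous fun y => (2 * Real.pi * Complex.I * τ * x : ℂ) * h.1 (x, y) :=
    continuous_const.mul hc
  simp only [fourierY, derivY_apply, mul_add]
  rw [intervalIntegral.integral_add (Continuous.intervalIntegrable (by fun_prop) 0 1)
    (Continuous.intervalIntegrable (by fun_prop) 0 1), h1, add_mul]
  congr 1
  rw [← intervalIntegral.integral_const_mul]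
  refine intervalIntegral.integral_congr fun y _ => ?_
  ring

/-- The factor exp(-2πiτry) of the twist is absorbed into the character. Translation in x thus links
the frequencies modulo τr and leaves |τ|r independent ones. -/
theorem fourierY_add_fst (β : ℝ) (h : twistedFn r κ₁ κ₂ τ) (x : ℝ) :
    fourierY β h.1 (x + r) = realChar κ₁ 1 * fourierY (β + τ * r) h.1 x := by
  simp only [fourierY, add_fst, ← intervalIntegral.integral_const_mul, neg_add, realChar_add_left]
  refine intervalIntegral.integral_congr fun y _ => ?_
  ring

theorem eq_zero_of_fourierY (h : twistedFn r κ₁ κ₂ τ)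
    (h0 : ∀ (n : ℤ) x, fourierY (κ₂ + n) h.1 x = 0) : h = 0 := by
  ext ⟨x, y⟩
  refine congrFun (eq_zero_of_fourier_eq_zero (κ := κ₂) one_pos (continuous_section h x)
    (fun y => add_snd h x y) fun n => ?_) y
  rw [div_one]
  exact h0 n x

/-! ### Ground states -/

theorem hasDerivAt_ofReal (x : ℝ) : HasDerivAt (fun t : ℝ => (t : ℂ)) 1 x := by
  simpa using (hasDerivAt_id x).ofReal_comp

theorem mem_ker_lower {s : ℝ} {h : twistedFn r κ₁ κ₂ τ} :
    h ∈ LinearMap.ker (lower r κ₁ κ₂ τ s) ↔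
      derivX r κ₁ κ₂ τ h = (Complex.I * s) • derivY r κ₁ κ₂ τ h := by
  rw [LinearMap.mem_ker, lower, LinearMap.sub_apply, LinearMap.smul_apply, sub_eq_zero]

/-- The coefficient f satisfies f' = -2πs(β + τx) f, and the exponential is the integrating factor.
So f is determined by its value at x = 0. -/
theorem fourierY_of_mem_ker_lower {s : ℝ} {h : twistedFn r κ₁ κ₂ τ}
    (hh : h ∈ LinearMap.ker (lower r κ₁ κ₂ τ s)) {β : ℝ} (hβ : realChar β 1 = realChar κ₂ 1)
    (x : ℝ) : fourierY β h.1 x * Complex.exp (2 * Real.pi * s * (β * x + τ * x ^ 2 / 2))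
      = fourierY β h.1 0 := by
  have hd : ∀ x : ℝ, HasDerivAt (fun x : ℝ => fourierY β h.1 x *
      Complex.exp (2 * Real.pi * s * (β * x + τ * x ^ 2 / 2))) 0 x := by
    intro x
    have hx := hasDerivAt_ofReal x
    have h1 := fourierY_derivX β h x
    have e : fourierY β (derivX r κ₁ κ₂ τ h).1 x
        = (Complex.I * s) * fourierY β (derivY r κ₁ κ₂ τ h).1 x := by
      rw [mem_ker_lower.1 hh]
      simp only [fourierY, ← intervalIntegral.integral_const_mul, Submodule.coe_smul, Pi.smul_apply,
        smul_eq_mul]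
      refine intervalIntegral.integral_congr fun y _ => ?_
      ring
    rw [e, fourierY_derivY hβ] at h1
    refine (h1.mul ((((hx.const_mul (β : ℂ)).add (((hx.pow 2).const_mul (τ : ℂ)).div_const 2)).const_mul
      (2 * Real.pi * s : ℂ)).cexp)).congr_deriv ?_
    simp only [Pi.add_apply, Pi.pow_apply]
    push_cast
    ring_nf
    rw [Complex.I_sq]
    ring
  have := is_const_of_deriv_eq_zero (fun x => (hd x).differentiableAt) (fun x => (hd x).deriv) x 0
  simpa using this

theorem realChar_add_int_one (κ : ℝ) (n : ℤ) : realChar (κ + n) 1 = realChar κ 1 := by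
  rw [realChar_add_left, realChar_int_one, mul_one]

/-- The Fourier coefficients at `x = 0` in one period. -/
def groundCoeff (r : ℕ) (κ₁ κ₂ τ s : ℝ) (R : ℕ) :
    LinearMap.ker (lower r κ₁ κ₂ τ s) →ₗ[ℂ] (Fin R → ℂ) where
  toFun h j := fourierY (κ₂ + j) h.1.1 0
  map_add' f g := by
    ext j
    simp only [fourierY, Submodule.coe_add, Pi.add_apply, mul_add]
    have hf := continuous_section f.1 0
    have hg := continuous_section g.1 0
    exact intervalIntegral.integral_add (Continuous.intervalIntegrable (by fun_prop) 0 1)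
      (Continuous.intervalIntegrable (by fun_prop) 0 1)
  map_smul' c f := by
    ext j
    simp only [fourierY, Submodule.coe_smul, Pi.smul_apply, smul_eq_mul, RingHom.id_apply,
      ← intervalIntegral.integral_const_mul]
    refine intervalIntegral.integral_congr fun y _ => ?_
    ring

/-- A coefficient that vanishes at x = 0 vanishes identically, by the differential equation;
vanishing is R-periodic in the frequency, by translation in x. So R consecutive values at x = 0
determine h. -/
theorem groundCoeff_injective {s : ℝ} (hs : s ^ 2 = 1) {R : ℕ} (hR : 0 < R) (hτ : s * τ * r = R) :
    Function.Injective (groundCoeff r κ₁ κ₂ τ s R) := by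
  rw [injective_iff_map_eq_zero]
  rintro ⟨h, hh⟩ h0
  refine Subtype.ext (eq_zero_of_fourierY h ?_)
  have key : ∀ n : ℤ, (fourierY (κ₂ + n) h.1 0 = 0 ↔ ∀ x, fourierY (κ₂ + n) h.1 x = 0) := by
    refine fun n => ⟨fun h1 x => ?_, fun h1 => h1 0⟩
    have := fourierY_of_mem_ker_lower hh (realChar_add_int_one κ₂ n) x
    rw [h1] at this
    exact (mul_eq_zero.1 this).resolve_right (Complex.exp_ne_zero _)
  have hshift : ∀ n m : ℤ, τ * r = m → ((∀ x, fourierY (κ₂ + n) h.1 x = 0) ↔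
      ∀ x, fourierY (κ₂ + (n + m : ℤ)) h.1 x = 0) := by
    intro n m hm
    have e : ∀ x, fourierY (κ₂ + n) h.1 (x + r)
        = realChar κ₁ 1 * fourierY (κ₂ + (n + m : ℤ)) h.1 x := fun x => by
      rw [fourierY_add_fst, hm]
      push_cast
      rw [add_assoc]
    refine ⟨fun h1 x => ?_, fun h1 x => ?_⟩
    · have := e x
      rw [h1] at this
      exact (mul_eq_zero.1 this.symm).resolve_left (realChar_ne_zero _ _)
    · have := e (x - r)
      rwa [sub_add_cancel, h1, mul_zero] at this
  have hper : Function.Periodic (fun n : ℤ => ∀ x, fourierY (κ₂ + n) h.1 x = 0) (R : ℤ) := by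
    intro n
    refine propext ?_
    -- Here τr = sR, so for s = -1 the shift goes downwards and is applied starting from n + R.
    rcases mul_self_eq_one_iff.1 ((sq s).symm.trans hs) with rfl | rfl
    · exact (hshift n R (by rw [one_mul] at hτ; rw [hτ]; rfl)).symm
    · have := hshift (n + R) (-R) (by push_cast; linarith)
      rwa [add_neg_cancel_right] at this
  intro n
  have hR' : (0 : ℤ) < R := by exact_mod_cast hR
  have h1 := hper.sub_zsmul_eq (x := n) (n / R)
  have h2 : n - (n / R) • (R : ℤ) = n % R := by
    rw [smul_eq_mul, Int.emod_def, mul_comm]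
  rw [h2] at h1
  refine h1.mp ((key _).1 ?_)
  have h3 := congrFun h0 ⟨(n % R).toNat, by
    have := Int.emod_lt_of_pos n hR'
    omega⟩
  have h4 : (((n % R).toNat : ℕ) : ℝ) = ((n % R : ℤ) : ℝ) := by
    exact_mod_cast Int.toNat_of_nonneg (Int.emod_nonneg n hR'.ne')
  simp only [groundCoeff, LinearMap.coe_mk, AddHom.coe_mk, h4] at h3
  exact h3

/-- The theta function with period `R` and characteristic `b`. -/
def thetaFn (κ₁ τ s : ℝ) (R : ℕ) (b : ℝ) (p : ℝ × ℝ) : ℂ :=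
  Complex.exp (-(Real.pi * s / τ * (b + τ * p.1) ^ 2) + 2 * Real.pi * Complex.I * b * p.2) *
    jacobiTheta₂ (R * p.2 + (Complex.I * R * s / τ * (b + τ * p.1) - s * κ₁))
      (Complex.I * R ^ 2 * s / τ)

theorem im_thetaParam {s : ℝ} {R : ℕ} (hR : 0 < R) (hsτ : 0 < s * τ) :
    0 < (Complex.I * R ^ 2 * s / τ : ℂ).im := by
  have hτ0 : τ ≠ 0 := by rintro rfl; simp at hsτ
  have : (Complex.I * R ^ 2 * s / τ : ℂ) = ((R ^ 2 * (s * τ) / τ ^ 2 : ℝ) : ℂ) * Complex.I := by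
    have : (τ : ℂ) ≠ 0 := by exact_mod_cast hτ0
    push_cast
    field_simp
  rw [this, Complex.im_ofReal_mul, Complex.I_im, mul_one]
  positivity

/-- Expanded, `thetaFn` is the sum over n of exp(2πi(b + nR)y) exp(-(πs/τ)(b + nR + τx)²)
exp(-2πinsκ₁). Since τr = sR, the translation x ↦ x + r replaces n by n + s in the Gaussian, and
reindexing produces the required factor. The translation y ↦ y + 1 only sees b, as R is an integer.
-/
theorem thetaFn_mem {s : ℝ} (hs : s ^ 2 = 1) {R : ℕ} (hR : 0 < R) (hsτ : 0 < s * τ)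
    (hτ : s * τ * r = R) {b : ℝ} (hb : realChar b 1 = realChar κ₂ 1) :
    thetaFn κ₁ τ s R b ∈ twistedFn r κ₁ κ₂ τ := by
  have hτ0 : τ ≠ 0 := by rintro rfl; simp at hsτ
  have hτc : (τ : ℂ) ≠ 0 := by exact_mod_cast hτ0
  have hsc : (s : ℂ) ^ 2 = 1 := by exact_mod_cast hs
  have hRc : (R : ℂ) = s * τ * r := by exact_mod_cast hτ.symm
  refine ⟨?_, fun x y => ?_, fun x y => ?_⟩
  · have hx : ContDiff ℝ ∞ fun p : ℝ × ℝ => (p.1 : ℂ) := Complex.ofRealCLM.contDiff.comp contDiff_fst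
    have hy : ContDiff ℝ ∞ fun p : ℝ × ℝ => (p.2 : ℂ) := Complex.ofRealCLM.contDiff.comp contDiff_snd
    refine ContDiff.mul (ContDiff.cexp (by fun_prop)) ?_
    exact (contDiff_jacobiTheta₂ (im_thetaParam hR hsτ)).comp
      (g := fun z => jacobiTheta₂ z (Complex.I * R ^ 2 * s / τ)) (by fun_prop)
  · simp only [thetaFn]
    have e1 : (R * y + (Complex.I * R * s / τ * (b + τ * ((x + r : ℝ) : ℂ)) - s * κ₁) : ℂ)
        = (R * y + (Complex.I * R * s / τ * (b + τ * x) - s * κ₁))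
          + s * (Complex.I * R ^ 2 * s / τ) := by
      push_cast
      field_simp
      rw [hRc]
      linear_combination (-Complex.I * s ^ 2 * τ ^ 2 * r ^ 2) * hsc
    rw [e1, jacobiTheta₂_add_sign_mul hs, ← mul_assoc, ← mul_assoc]
    congr 1
    simp only [realChar, ← Complex.exp_add]
    congr 1
    push_cast
    field_simp
    rw [hRc]
    ring_nf
    simp only [Complex.I_sq, hsc, show (s : ℂ) ^ 3 = s by rw [pow_succ, hsc, one_mul]]
    ring
  · simp only [thetaFn]
    have e1 : (R * ((y + 1 : ℝ) : ℂ) + (Complex.I * R * s / τ * (b + τ * x) - s * κ₁) : ℂ)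
        = (R * y + (Complex.I * R * s / τ * (b + τ * x) - s * κ₁)) + R := by
      push_cast; ring
    rw [e1, jacobiTheta₂_add_natCast, ← mul_assoc, ← hb]
    congr 1
    simp only [realChar, ← Complex.exp_add]
    congr 1
    push_cast
    ring

/-- On the summand with frequency β = b + nR both X and isY act as multiplication by -2πs(β + τx).
The series itself is not needed: `jacobiTheta₂` and its derivative are treated as unknowns, whose
coefficients agree on both sides. -/
theorem thetaFn_mem_ker {s : ℝ} (hs : s ^ 2 = 1) {R : ℕ} (hR : 0 < R) (hsτ : 0 < s * τ)
    (hτ : s * τ * r = R) {b : ℝ} (hb : realChar b 1 = realChar κ₂ 1) :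
    (⟨thetaFn κ₁ τ s R b, thetaFn_mem hs hR hsτ hτ hb⟩ : twistedFn r κ₁ κ₂ τ)
      ∈ LinearMap.ker (lower r κ₁ κ₂ τ s) := by
  have hτ0 : τ ≠ 0 := by rintro rfl; simp at hsτ
  have hτc : (τ : ℂ) ≠ 0 := by exact_mod_cast hτ0
  have hsc : (s : ℂ) ^ 2 = 1 := by exact_mod_cast hs
  have him := im_thetaParam hR hsτ
  rw [mem_ker_lower]
  set h : twistedFn r κ₁ κ₂ τ := ⟨thetaFn κ₁ τ s R b, thetaFn_mem hs hR hsτ hτ hb⟩ with hh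
  ext ⟨x, y⟩
  have hx := hasDerivAt_ofReal x
  have hy := hasDerivAt_ofReal y
  have dx := (((((hx.const_mul (τ : ℂ)).const_add (b : ℂ)).pow 2).const_mul
      (Real.pi * s / τ : ℂ)).neg.add_const (2 * Real.pi * Complex.I * b * y : ℂ)).cexp.mul
    ((hasDerivAt_jacobiTheta₂_fst (R * y + (Complex.I * R * s / τ * (b + τ * x) - s * κ₁))
      him).scomp x ((((hx.const_mul (τ : ℂ)).const_add (b : ℂ)).const_mul
        (Complex.I * R * s / τ : ℂ)).sub_const (s * κ₁ : ℂ) |>.const_add (R * y : ℂ)))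
  have dy := ((hy.const_mul (2 * Real.pi * Complex.I * b : ℂ)).const_add
      (-(Real.pi * s / τ * (b + τ * x) ^ 2) : ℂ)).cexp.mul
    ((hasDerivAt_jacobiTheta₂_fst (R * y + (Complex.I * R * s / τ * (b + τ * x) - s * κ₁))
      him).scomp y ((hy.const_mul (R : ℂ)).add_const
        (Complex.I * R * s / τ * (b + τ * x) - s * κ₁ : ℂ)))
  have ex := (hasDerivAt_fst_of_contDiff (smooth h) x y).unique dx
  have ey := (hasDerivAt_snd_of_contDiff (smooth h) x y).unique dy
  rw [derivX_apply, Submodule.coe_smul, Pi.smul_apply, derivY_apply, ex, ey]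
  simp only [hh, thetaFn, smul_eq_mul, Pi.pow_apply, Function.comp_apply, Pi.neg_apply]
  field_simp
  ring_nf
  simp only [Complex.I_sq]
  ring

/-- The frequencies of the k-th theta function are κ₂ + k + nR, and the only one of them in the
window κ₂, …, κ₂ + R - 1 is κ₂ + k. So the matrix of coefficients is diagonal with Gaussian, hence
nonzero, entries. -/
theorem fourierY_thetaFn {s : ℝ} {R : ℕ} (hR : 0 < R) (hsτ : 0 < s * τ) (j k : Fin R) :
    fourierY (κ₂ + j) (thetaFn κ₁ τ s R (κ₂ + k)) 0
      = if k = j then Complex.exp (-(Real.pi * s / τ * (κ₂ + k) ^ 2)) else 0 := by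
  have him := im_thetaParam hR hsτ
  have hl : |((k : ℕ) : ℤ) - (j : ℕ)| < R := by
    have := k.2
    have := j.2
    rw [abs_lt]; omega
  have h := integral_realChar_mul_jacobiTheta₂ hl
    (Complex.I * R * s / τ * (κ₂ + (k : ℕ) + τ * 0) - s * κ₁) him
  have e : fourierY (κ₂ + j) (thetaFn κ₁ τ s R (κ₂ + k)) 0
      = Complex.exp (-(Real.pi * s / τ * (κ₂ + k) ^ 2)) * ∫ y in (0 : ℝ)..1,
        realChar (((k : ℕ) : ℤ) - ((j : ℕ) : ℤ) : ℤ) y *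
        jacobiTheta₂ (R * y + (Complex.I * R * s / τ * (κ₂ + (k : ℕ) + τ * 0) - s * κ₁))
          (Complex.I * R ^ 2 * s / τ) := by
    rw [fourierY, ← intervalIntegral.integral_const_mul]
    refine intervalIntegral.integral_congr fun y _ => ?_
    simp only [thetaFn]
    push_cast
    rw [← mul_assoc, ← mul_assoc]
    congr 1
    simp only [realChar, ← Complex.exp_add]
    congr 1
    push_cast
    ring
  rw [e, h]
  have : ((k : ℕ) : ℤ) - ((j : ℕ) : ℤ) = 0 ↔ k = j := by rw [sub_eq_zero, Fin.ext_iff]; omega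
  simp only [this, mul_ite, mul_one, mul_zero]

theorem groundCoeff_surjective {s : ℝ} (hs : s ^ 2 = 1) {R : ℕ} (hR : 0 < R) (hsτ : 0 < s * τ)
    (hτ : s * τ * r = R) : Function.Surjective (groundCoeff r κ₁ κ₂ τ s R) := by
  intro v
  let h : Fin R → LinearMap.ker (lower r κ₁ κ₂ τ s) := fun k =>
    ⟨_, thetaFn_mem_ker hs hR hsτ hτ (realChar_add_int_one κ₂ (k : ℕ))⟩
  refine ⟨∑ k : Fin R, (v k / Complex.exp (-(Real.pi * s / τ * (κ₂ + k) ^ 2))) • h k, ?_⟩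
  ext j
  rw [map_sum, Finset.sum_apply]
  have e : ∀ k, groundCoeff r κ₁ κ₂ τ s R (h k) j = _ := fun k =>
    fourierY_thetaFn (κ₁ := κ₁) (κ₂ := κ₂) hR hsτ j k
  simp only [map_smul, Pi.smul_apply, e, smul_eq_mul, mul_ite, mul_zero,
    div_mul_cancel₀ _ (Complex.exp_ne_zero _)]
  simp

/-- The space of ground states is isomorphic to `ℂ^R` where `R = |τ| r`. -/
def groundEquiv {s : ℝ} (hs : s ^ 2 = 1) {R : ℕ} (hR : 0 < R) (hsτ : 0 < s * τ)
    (hτ : s * τ * r = R) : LinearMap.ker (lower r κ₁ κ₂ τ s) ≃ₗ[ℂ] (Fin R → ℂ) :=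
  LinearEquiv.ofBijective (groundCoeff r κ₁ κ₂ τ s R)
    ⟨groundCoeff_injective hs hR hτ, groundCoeff_surjective hs hR hsτ hτ⟩

end twistedFn

/-! ### The two-dimensional torus -/

theorem realChar_mul_one (α t : ℝ) : realChar α t = realChar (α * t) 1 := by
  simp only [realChar]; congr 1; push_cast; ring

theorem realChar_one_eq_iff {a b : ℝ} : realChar a 1 = realChar b 1 ↔ ∃ n : ℤ, a = b + n := by
  have : realChar a 1 = realChar b 1 ↔ realChar (a - b) 1 = 1 := by
    rw [sub_eq_add_neg, realChar_add_left, realChar_neg_left, mul_inv_eq_one₀ (realChar_ne_zero _ _)]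
  rw [this, realChar_mul_eq_one_iff]
  refine exists_congr fun n => ?_
  rw [mul_one, sub_eq_iff_eq_add, add_comm]

/-- The characters of the plane that restrict to a given character of the lattice. -/
def torusChars (r : ℕ) (κ₁ κ₂ : ℝ) : Set (ℝ × ℝ) :=
  {p | realChar p.1 r = realChar κ₁ 1 ∧ realChar p.2 1 = realChar κ₂ 1}

theorem mem_torusChars_iff {r : ℕ} (hr : 0 < r) {κ₁ κ₂ : ℝ} {p : ℝ × ℝ} :
    p ∈ torusChars r κ₁ κ₂ ↔ ∃ m n : ℤ, p = (κ₁ / r + m / r, κ₂ + n) := by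
  have hr' : (r : ℝ) ≠ 0 := by exact_mod_cast hr.ne'
  simp only [torusChars, Set.mem_ofPred_eq, realChar_mul_one p.1, realChar_one_eq_iff]
  constructor
  · rintro ⟨⟨m, hm⟩, n, hn⟩
    refine ⟨m, n, Prod.ext ?_ hn⟩
    rw [← add_div, eq_div_iff hr']
    exact hm
  · rintro ⟨m, n, rfl⟩
    exact ⟨⟨m, by field_simp⟩, n, rfl⟩

theorem finite_torusChars {r : ℕ} (hr : 0 < r) {κ₁ κ₂ : ℝ} (K : ℝ) :
    {p ∈ torusChars r κ₁ κ₂ | p.1 ^ 2 + p.2 ^ 2 ≤ K ^ 2}.Finite := by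
  have hr' : (0 : ℝ) < r := by exact_mod_cast hr
  -- The bound comes from |κ₁ + m| ≤ |K| r and |κ₂ + n| ≤ |K|.
  obtain ⟨N, hN⟩ := exists_nat_gt (|K| * r + |κ₁| + |K| + |κ₂|)
  refine (((Set.finite_Icc (-N : ℤ) N).prod (Set.finite_Icc (-N : ℤ) N)).image
    fun q : ℤ × ℤ => (κ₁ / r + q.1 / r, κ₂ + q.2)).subset ?_
  rintro p ⟨hp, hK⟩
  obtain ⟨m, n, rfl⟩ := (mem_torusChars_iff hr).1 hp
  simp only at hK
  refine ⟨(m, n), ?_, rfl⟩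
  have h1 : |κ₁ / r + m / r| ≤ |K| := sq_le_sq.1 (by nlinarith [sq_nonneg (κ₂ + n)])
  have h2 : |κ₂ + n| ≤ |K| := sq_le_sq.1 (by nlinarith [sq_nonneg (κ₁ / r + m / r)])
  rw [← add_div, abs_div, abs_of_pos hr', div_le_iff₀ hr'] at h1
  rw [abs_le] at h1 h2
  have := neg_abs_le κ₁
  have := le_abs_self κ₁
  have := neg_abs_le κ₂
  have := le_abs_self κ₂
  have := abs_nonneg K
  have : 0 ≤ |K| * r := by positivity
  simp only [Set.mem_prod, Set.mem_Icc]
  refine ⟨⟨?_, ?_⟩, ?_, ?_⟩ <;> (rify; linarith [h1.1, h1.2, h2.1, h2.2])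

/-- The eigenspace for `l` of the matrix `(0, 2πd(α + iβ); 2πd(α - iβ), 0)`. -/
def torusSpinors (d α β : ℝ) (l : ℂ) : Submodule ℂ (ℂ × ℂ) where
  carrier := {v | 2 * Real.pi * d * (α + Complex.I * β) * v.2 = l * v.1 ∧
    2 * Real.pi * d * (α - Complex.I * β) * v.1 = l * v.2}
  zero_mem' := by simp
  add_mem' := by
    rintro u v ⟨h1, h2⟩ ⟨h3, h4⟩
    exact ⟨by simp only [Prod.fst_add, Prod.snd_add]; linear_combination h1 + h3,
      by simp only [Prod.fst_add, Prod.snd_add]; linear_combination h2 + h4⟩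
  smul_mem' := by
    rintro c v ⟨h1, h2⟩
    exact ⟨by simp only [Prod.smul_fst, Prod.smul_snd, smul_eq_mul]; linear_combination c * h1,
      by simp only [Prod.smul_fst, Prod.smul_snd, smul_eq_mul]; linear_combination c * h2⟩

theorem mem_torusSpinors {d α β : ℝ} {l : ℂ} {v : ℂ × ℂ} : v ∈ torusSpinors d α β l ↔
    2 * Real.pi * d * (α + Complex.I * β) * v.2 = l * v.1 ∧
      2 * Real.pi * d * (α - Complex.I * β) * v.1 = l * v.2 := Iff.rfl

/-- The matrix squares to q². If q ≠ 0, the eigenvalues ±q are simple. If q = 0, the matrix is zero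
and 0 has multiplicity two, in accordance with the count, as both signs then give the value 0. -/
theorem finrank_torusSpinors {d : ℝ} (hd : 0 < d) (α β : ℝ) (l : ℂ) :
    Module.finrank ℂ (torusSpinors d α β l)
      = Nat.card {s : ℤˣ // (((s : ℤ) : ℝ) * (2 * Real.pi * d * √(α ^ 2 + β ^ 2)) : ℝ) = l} := by
  set q := 2 * Real.pi * d * √(α ^ 2 + β ^ 2) with hq
  have hπ := Real.pi_pos
  have hsum : 0 ≤ α ^ 2 + β ^ 2 := by positivity
  have hq2 : (q : ℂ) ^ 2 = (2 * Real.pi * d * (α + Complex.I * β)) *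
      (2 * Real.pi * d * (α - Complex.I * β)) := by
    have : q ^ 2 = (2 * Real.pi * d) ^ 2 * (α ^ 2 + β ^ 2) := by
      rw [hq, mul_pow, Real.sq_sqrt hsum]
    have : (q : ℂ) ^ 2 = (2 * Real.pi * d) ^ 2 * (α ^ 2 + β ^ 2) := by exact_mod_cast this
    rw [this]
    linear_combination (4 * Real.pi ^ 2 * d ^ 2 * β ^ 2 : ℂ) * Complex.I_sq
  have hcard : ∀ s : ℤˣ, s = 1 ∨ s = -1 := Int.units_eq_one_or
  by_cases h0 : q = 0
  · have hs0 : α ^ 2 + β ^ 2 = 0 := by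
      have := (mul_eq_zero.1 h0).resolve_left (by positivity)
      rwa [Real.sqrt_eq_zero hsum] at this
    have hα : α = 0 := by nlinarith [sq_nonneg α, sq_nonneg β]
    have hβ : β = 0 := by nlinarith [sq_nonneg α, sq_nonneg β]
    subst hα hβ
    simp only [h0, mul_zero, Complex.ofReal_zero]
    by_cases hl : l = 0
    · subst hl
      have : torusSpinors d 0 0 0 = ⊤ := by
        ext v; simp [mem_torusSpinors]
      rw [this, finrank_top, Module.finrank_prod, Module.finrank_self]
      have e : {s : ℤˣ // (0 : ℂ) = 0} ≃ ℤˣ := Equiv.subtypeUnivEquiv fun _ => rfl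
      rw [Nat.card_congr e, Nat.card_eq_fintype_card]
      rfl
    · have : torusSpinors d 0 0 l = ⊥ := by
        rw [eq_bot_iff]
        rintro ⟨u, v⟩ ⟨h1, h2⟩
        simp [hl] at h1 h2
        simp [h1, h2]
      rw [this, finrank_bot]
      have : IsEmpty {s : ℤˣ // (0 : ℂ) = l} := ⟨fun s => hl s.2.symm⟩
      rw [Nat.card_of_isEmpty]
  · have hqc : (q : ℂ) ≠ 0 := by exact_mod_cast h0
    set w : ℂ := 2 * Real.pi * d * (α + Complex.I * β) with hw
    set w' : ℂ := 2 * Real.pi * d * (α - Complex.I * β) with hw'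
    have hw'0 : w' ≠ 0 := by
      intro h
      rw [h, mul_zero] at hq2
      exact hqc (pow_eq_zero_iff two_ne_zero |>.1 hq2)
    by_cases hl : l ^ 2 = q ^ 2
    · have hl0 : l ≠ 0 := by
        rintro rfl
        exact hqc (pow_eq_zero_iff two_ne_zero |>.1 (by rw [← hl]; ring))
      let e : torusSpinors d α β l ≃ₗ[ℂ] ℂ :=
        { toFun := fun v => v.1.2
          map_add' := fun _ _ => rfl
          map_smul' := fun _ _ => rfl
          invFun := fun v => ⟨(w * v / l, v), by
            rw [mem_torusSpinors, ← hw, ← hw']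
            constructor
            · field_simp
            · field_simp
              rw [hl, hq2]; ring⟩
          left_inv := fun v => Subtype.ext (Prod.ext (by
            have h1 : w * v.1.2 = l * v.1.1 := v.2.1
            simp only
            rw [h1, mul_div_cancel_left₀ _ hl0]) rfl)
          right_inv := fun _ => rfl }
      rw [e.finrank_eq, Module.finrank_self, eq_comm, Nat.card_eq_one_iff_unique]
      have hne : (q : ℂ) ≠ -q := fun h => hqc (by linear_combination (1 / 2 : ℂ) * h)
      rcases sq_eq_sq_iff_eq_or_eq_neg.1 hl with rfl | rfl
      · refine ⟨⟨fun s t => Subtype.ext ?_⟩, ⟨⟨1, by simp⟩⟩⟩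
        have : ∀ s : {s : ℤˣ // (((s : ℤ) : ℝ) * q : ℝ) = (q : ℂ)}, s.1 = 1 := by
          rintro ⟨s, hs⟩
          rcases hcard s with rfl | rfl
          · rfl
          · exact absurd hs.symm (by simpa using hne)
        rw [this s, this t]
      · refine ⟨⟨fun s t => Subtype.ext ?_⟩, ⟨⟨-1, by simp⟩⟩⟩
        have : ∀ s : {s : ℤˣ // (((s : ℤ) : ℝ) * q : ℝ) = (-q : ℂ)}, s.1 = -1 := by
          rintro ⟨s, hs⟩
          rcases hcard s with rfl | rfl
          · exact absurd hs (by simpa using hne)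
          · rfl
        rw [this s, this t]
    · have : torusSpinors d α β l = ⊥ := by
        rw [eq_bot_iff]
        rintro ⟨u, v⟩ ⟨h1, h2⟩
        simp only [← hw, ← hw'] at h1 h2
        have hv : v = 0 := by
          have : (l ^ 2 - q ^ 2) * v = 0 := by
            rw [hq2]; linear_combination (-l) * h2 - w' * h1
          exact (mul_eq_zero.1 this).resolve_left (sub_ne_zero.2 hl)
        rw [hv, mul_zero] at h2
        simp [hv, (mul_eq_zero.1 h2).resolve_left hw'0]
      rw [this, finrank_bot]
      have : IsEmpty {s : ℤˣ // (((s : ℤ) : ℝ) * q : ℝ) = l} := ⟨by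
        rintro ⟨s, rfl⟩
        refine hl ?_
        rcases hcard s with rfl | rfl <;> simp⟩
      rw [Nat.card_of_isEmpty]

namespace twistedFn

variable {r : ℕ} {κ₁ κ₂ : ℝ}

/-- The Fourier coefficient at `exp (2πi(αx + βy))` of a function on the torus. -/
def torusCoeff (r : ℕ) (κ₁ κ₂ α β : ℝ) : twistedFn r κ₁ κ₂ 0 →ₗ[ℂ] ℂ where
  toFun h := (r : ℂ)⁻¹ * ∫ x in (0 : ℝ)..r, realChar (-α) x * fourierY β h.1 x
  map_add' f g := by
    have hc : ∀ h : twistedFn r κ₁ κ₂ 0, Continuous (fourierY β h.1) := fun h =>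
      continuous_iff_continuousAt.2 fun x => (fourierY_derivX β h x).continuousAt
    have hf := hc f
    have hg := hc g
    have e : ∀ x, fourierY β (f + g).1 x = fourierY β f.1 x + fourierY β g.1 x := fun x => by
      simp only [fourierY, Submodule.coe_add, Pi.add_apply, mul_add]
      exact intervalIntegral.integral_add
        (((continuous_realChar _).mul (continuous_section f x)).intervalIntegrable 0 1)
        (((continuous_realChar _).mul (continuous_section g x)).intervalIntegrable 0 1)
    simp only [e, mul_add]
    rw [intervalIntegral.integral_add (Continuous.intervalIntegrable (by fun_prop) 0 _)
      (Continuous.intervalIntegrable (by fun_prop) 0 _), mul_add]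
  map_smul' c f := by
    have e : ∀ x, fourierY β (c • f).1 x = c * fourierY β f.1 x := fun x => by
      simp only [fourierY, Submodule.coe_smul, Pi.smul_apply, smul_eq_mul,
        ← intervalIntegral.integral_const_mul]
      refine intervalIntegral.integral_congr fun y _ => ?_
      ring
    simp only [e, RingHom.id_apply, smul_eq_mul, mul_left_comm _ c, intervalIntegral.integral_const_mul]

theorem torusCoeff_derivX {α β : ℝ} (hα : realChar α r = realChar κ₁ 1)
    (h : twistedFn r κ₁ κ₂ 0) : torusCoeff r κ₁ κ₂ α β (derivX r κ₁ κ₂ 0 h)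
      = 2 * Real.pi * Complex.I * α * torusCoeff r κ₁ κ₂ α β h := by
  have hc : Continuous (fourierY β (derivX r κ₁ κ₂ 0 h).1) :=
    continuous_iff_continuousAt.2 fun x => (fourierY_derivX β _ x).continuousAt
  have := intervalIntegral_realChar_mul_deriv (α := α) (L := r) (fun x => fourierY_derivX β h x) hc
    (by have := fourierY_add_fst β h 0
        rwa [zero_add, zero_mul, add_zero, ← hα] at this)
  simp only [torusCoeff, LinearMap.coe_mk, AddHom.coe_mk, this]
  ring

theorem torusCoeff_derivY {α β : ℝ} (hβ : realChar β 1 = realChar κ₂ 1)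
    (h : twistedFn r κ₁ κ₂ 0) : torusCoeff r κ₁ κ₂ α β (derivY r κ₁ κ₂ 0 h)
      = 2 * Real.pi * Complex.I * β * torusCoeff r κ₁ κ₂ α β h := by
  have : ∀ x, fourierY β (derivY r κ₁ κ₂ 0 h).1 x
      = 2 * Real.pi * Complex.I * β * fourierY β h.1 x := fun x => by
    rw [fourierY_derivY hβ]; simp
  simp only [torusCoeff, LinearMap.coe_mk, AddHom.coe_mk, this, mul_left_comm (realChar _ _),
    intervalIntegral.integral_const_mul]
  ring

theorem eq_zero_of_torusCoeff (hr : 0 < r) (h : twistedFn r κ₁ κ₂ 0)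
    (h0 : ∀ p ∈ torusChars r κ₁ κ₂, torusCoeff r κ₁ κ₂ p.1 p.2 h = 0) : h = 0 := by
  have hr' : (0 : ℝ) < r := by exact_mod_cast hr
  have hrc : (r : ℂ) ≠ 0 := by exact_mod_cast hr.ne'
  refine eq_zero_of_fourierY h fun n x => ?_
  refine congrFun (eq_zero_of_fourier_eq_zero (κ := κ₁ / r) hr' (continuous_iff_continuousAt.2
    fun x => (fourierY_derivX (κ₂ + n) h x).continuousAt) (fun t => ?_) fun m => ?_) x
  · rw [fourierY_add_fst, zero_mul, add_zero, realChar_mul_one (κ₁ / r), div_mul_cancel₀ _ hr'.ne']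
  · exact (mul_eq_zero.1 (h0 (κ₁ / r + m / r, κ₂ + n)
      ((mem_torusChars_iff hr).2 ⟨m, n, rfl⟩))).resolve_left (inv_ne_zero hrc)

/-- The function `exp (2πi(αx + βy))`. -/
def torusChar (r : ℕ) (κ₁ κ₂ : ℝ) (p : torusChars r κ₁ κ₂) : twistedFn r κ₁ κ₂ 0 :=
  ⟨fun q => realChar p.1.1 q.1 * realChar p.1.2 q.2,
    ((contDiff_realChar _).comp contDiff_fst).mul ((contDiff_realChar _).comp contDiff_snd),
    fun x y => by
      simp only [realChar_add_right, p.2.1, zero_mul, neg_zero, realChar_zero_left]; ring,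
    fun x y => by simp only [realChar_add_right, p.2.2]; ring⟩

theorem torusCoeff_torusChar (hr : 0 < r) (p q : torusChars r κ₁ κ₂) :
    torusCoeff r κ₁ κ₂ q.1.1 q.1.2 (torusChar r κ₁ κ₂ p) = if p = q then 1 else 0 := by
  have hrc : (r : ℂ) ≠ 0 := by exact_mod_cast hr.ne'
  have e : torusCoeff r κ₁ κ₂ q.1.1 q.1.2 (torusChar r κ₁ κ₂ p)
      = (r : ℂ)⁻¹ * ((∫ x in (0 : ℝ)..r, realChar (p.1.1 - q.1.1) x) *
        ∫ y in (0 : ℝ)..1, realChar (p.1.2 - q.1.2) y) := by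
    simp only [torusCoeff, fourierY, torusChar, LinearMap.coe_mk, AddHom.coe_mk]
    congr 1
    rw [← intervalIntegral.integral_mul_const]
    refine intervalIntegral.integral_congr fun x _ => ?_
    simp only [← intervalIntegral.integral_const_mul]
    refine intervalIntegral.integral_congr fun y _ => ?_
    simp only [sub_eq_add_neg, realChar_add_left]
    ring
  rw [e]
  split_ifs with h
  · subst h
    simp [hrc]
  · by_cases h1 : p.1.1 = q.1.1
    · have h2 : p.1.2 ≠ q.1.2 := fun h2 => h (Subtype.ext (Prod.ext h1 h2))
      rw [intervalIntegral_realChar_eq_zero (τ := p.1.2 - q.1.2) _ (sub_ne_zero.2 h2)]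
      · simp
      · rw [sub_eq_add_neg, realChar_add_left, realChar_neg_left, p.2.2, q.2.2,
          mul_inv_cancel₀ (realChar_ne_zero _ _)]
    · rw [intervalIntegral_realChar_eq_zero (τ := p.1.1 - q.1.1) _ (sub_ne_zero.2 h1)]
      · simp
      · rw [sub_eq_add_neg, realChar_add_left, realChar_neg_left, p.2.1, q.2.1,
          mul_inv_cancel₀ (realChar_ne_zero _ _)]

theorem derivX_torusChar (p : torusChars r κ₁ κ₂) :
    derivX r κ₁ κ₂ 0 (torusChar r κ₁ κ₂ p)
      = (2 * Real.pi * Complex.I * p.1.1 : ℂ) • torusChar r κ₁ κ₂ p := by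
  ext ⟨x, y⟩
  refine ((hasDerivAt_fst_of_contDiff (smooth (torusChar r κ₁ κ₂ p)) x y).unique
    ((hasDerivAt_realChar p.1.1 x).mul_const (realChar p.1.2 y))).trans ?_
  simp only [torusChar, Submodule.coe_smul, Pi.smul_apply, smul_eq_mul]
  ring

theorem derivY_torusChar (p : torusChars r κ₁ κ₂) :
    derivY r κ₁ κ₂ 0 (torusChar r κ₁ κ₂ p)
      = (2 * Real.pi * Complex.I * p.1.2 : ℂ) • torusChar r κ₁ κ₂ p := by
  ext ⟨x, y⟩
  rw [derivY_apply, (hasDerivAt_snd_of_contDiff (smooth (torusChar r κ₁ κ₂ p)) x y).unique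
    ((hasDerivAt_realChar p.1.2 y).const_mul (realChar p.1.1 x))]
  simp only [torusChar, Submodule.coe_smul, Pi.smul_apply, smul_eq_mul]
  push_cast
  ring

end twistedFn

/-! ### Dirac eigenspaces in a single central Fourier mode -/

open twistedFn

/-- The eigenspace for `l` of the Dirac operator (up to an additive constant) on spinors that are
twisted functions. -/
def twistedSpinors (r : ℕ) (κ₁ κ₂ τ d T : ℝ) (l : ℂ) :
    Submodule ℂ (twistedFn r κ₁ κ₂ τ × twistedFn r κ₁ κ₂ τ) :=
  ladderSpinors (lower r κ₁ κ₂ τ 1) (raise r κ₁ κ₂ τ 1) (2 * Real.pi * τ * T⁻¹) d l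

/-- The Fourier coefficient at `exp (2πi(αx + βy))` of a spinor on the torus. -/
def torusSpinorCoeff (r : ℕ) (κ₁ κ₂ d T : ℝ) (l : ℂ) (p : torusChars r κ₁ κ₂) :
    twistedSpinors r κ₁ κ₂ 0 d T l →ₗ[ℂ] torusSpinors d p.1.1 p.1.2 l :=
  ((torusCoeff r κ₁ κ₂ p.1.1 p.1.2).prodMap (torusCoeff r κ₁ κ₂ p.1.1 p.1.2)).restrict (by
    rintro ⟨f, g⟩ ⟨h1, h2⟩
    -- Passing to coefficients replaces X by 2πiα and Y by 2πiβ in both component equations.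
    have h1 := congrArg (torusCoeff r κ₁ κ₂ p.1.1 p.1.2) h1
    have h2 := congrArg (torusCoeff r κ₁ κ₂ p.1.1 p.1.2) h2
    simp only [lower, raise, map_add, map_smul, map_sub, map_neg, LinearMap.add_apply,
      LinearMap.sub_apply, LinearMap.smul_apply, LinearMap.neg_apply, torusCoeff_derivX p.2.1,
      torusCoeff_derivY p.2.2, smul_eq_mul, mul_zero, zero_mul, Complex.ofReal_zero, neg_zero,
      zero_add, add_zero, Complex.ofReal_one] at h1 h2
    rw [mem_torusSpinors]
    simp only [LinearMap.prodMap_apply]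
    rw [← h1, ← h2]
    constructor <;> ring_nf <;> simp only [Complex.I_sq, show Complex.I ^ 3 = -Complex.I by
      rw [pow_succ, Complex.I_sq, neg_one_mul]] <;> ring)

/-- The spinor on the torus that is a given multiple of `exp (2πi(αx + βy))`. -/
def torusSpinorChar (r : ℕ) (κ₁ κ₂ d T : ℝ) (l : ℂ) (p : torusChars r κ₁ κ₂) :
    torusSpinors d p.1.1 p.1.2 l →ₗ[ℂ] twistedSpinors r κ₁ κ₂ 0 d T l :=
  ((LinearMap.toSpanSingleton ℂ _ (torusChar r κ₁ κ₂ p)).prodMap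
    (LinearMap.toSpanSingleton ℂ _ (torusChar r κ₁ κ₂ p))).restrict (by
    rintro ⟨u, v⟩ ⟨h1, h2⟩
    simp only at h1 h2
    rw [twistedSpinors, mem_ladderSpinors]
    simp only [LinearMap.prodMap_apply, LinearMap.toSpanSingleton_apply, lower, raise,
      LinearMap.add_apply, LinearMap.sub_apply, LinearMap.smul_apply, LinearMap.neg_apply,
      map_smul, derivX_torusChar, derivY_torusChar, smul_smul]
    rw [← h1, ← h2]
    constructor <;> match_scalars <;> ring_nf <;>
      simp only [Complex.I_sq, show Complex.I ^ 3 = -Complex.I by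
        rw [pow_succ, Complex.I_sq, neg_one_mul]] <;> ring)

theorem torusSpinorCoeff_torusSpinorChar {r : ℕ} (hr : 0 < r) (κ₁ κ₂ d T : ℝ) (l : ℂ)
    (p q : torusChars r κ₁ κ₂) (w : torusSpinors d p.1.1 p.1.2 l) :
    (torusSpinorCoeff r κ₁ κ₂ d T l q (torusSpinorChar r κ₁ κ₂ d T l p w)).1
      = (if p = q then w.1 else 0) := by
  refine Prod.ext ?_ ?_
  · change torusCoeff r κ₁ κ₂ q.1.1 q.1.2 (w.1.1 • torusChar r κ₁ κ₂ p) = _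
    rw [map_smul, torusCoeff_torusChar hr]
    split_ifs <;> simp
  · change torusCoeff r κ₁ κ₂ q.1.1 q.1.2 (w.1.2 • torusChar r κ₁ κ₂ p) = _
    rw [map_smul, torusCoeff_torusChar hr]
    split_ifs <;> simp

/-- For τ = 0 the fields X and Y commute and the characters diagonalise both, so the eigenspace
splits into the 2 × 2 problems of `torusSpinors`. -/
theorem finrank_twistedSpinors_zero {r : ℕ} (hr : 0 < r) (κ₁ κ₂ : ℝ) {d : ℝ} (hd : 0 < d) (T : ℝ)
    (l : ℂ) [Finite (Σ p : torusChars r κ₁ κ₂, {s : ℤˣ //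
      (((s : ℤ) : ℝ) * (2 * Real.pi * d * √(p.1.1 ^ 2 + p.1.2 ^ 2)) : ℝ) = l})] :
    Module.Finite ℂ (twistedSpinors r κ₁ κ₂ 0 d T l) ∧
      Module.finrank ℂ (twistedSpinors r κ₁ κ₂ 0 d T l)
        = Nat.card (Σ p : torusChars r κ₁ κ₂, {s : ℤˣ //
          (((s : ℤ) : ℝ) * (2 * Real.pi * d * √(p.1.1 ^ 2 + p.1.2 ^ 2)) : ℝ) = l}) := by
  have h1 : ∀ (p : torusChars r κ₁ κ₂) (w : torusSpinors d p.1.1 p.1.2 l),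
      torusSpinorCoeff r κ₁ κ₂ d T l p (torusSpinorChar r κ₁ κ₂ d T l p w) = w := fun p w =>
    Subtype.ext (by rw [torusSpinorCoeff_torusSpinorChar hr, if_pos rfl])
  have h2 : ∀ p q : torusChars r κ₁ κ₂, p ≠ q → ∀ w : torusSpinors d p.1.1 p.1.2 l,
      torusSpinorCoeff r κ₁ κ₂ d T l q (torusSpinorChar r κ₁ κ₂ d T l p w) = 0 := fun p q h w =>
    Subtype.ext (by rw [torusSpinorCoeff_torusSpinorChar hr, if_neg h, Submodule.coe_zero])
  have h3 : ∀ v : twistedSpinors r κ₁ κ₂ 0 d T l,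
      (∀ p, torusSpinorCoeff r κ₁ κ₂ d T l p v = 0) → v = 0 := by
    rintro ⟨⟨f, g⟩, hv⟩ h0
    refine Subtype.ext (Prod.ext ?_ ?_)
    · exact eq_zero_of_torusCoeff hr f fun p hp => congrArg (fun v => v.1.1) (h0 ⟨p, hp⟩)
    · exact eq_zero_of_torusCoeff hr g fun p hp => congrArg (fun v => v.1.2) (h0 ⟨p, hp⟩)
  have h4 : ∀ p : torusChars r κ₁ κ₂, Module.Finite ℂ (torusSpinors d p.1.1 p.1.2 l) :=
    fun p => inferInstance
  have h5 := fun p : torusChars r κ₁ κ₂ => finrank_torusSpinors hd p.1.1 p.1.2 l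
  exact finrank_of_decomposition (V := twistedSpinors r κ₁ κ₂ 0 d T l) 
    (W := fun p : torusChars r κ₁ κ₂ => torusSpinors d p.1.1 p.1.2 l)
    (torusSpinorCoeff r κ₁ κ₂ d T l) (torusSpinorChar r κ₁ κ₂ d T l) h1 h2 h3 h4 h5

/-- The eigenspaces for `τ ≠ 0` have dimension `|τ| r` or vanish. -/
theorem finrank_twistedSpinors_ne_zero {r : ℕ} (hr : 0 < r) (κ₁ κ₂ : ℝ) {τ d T : ℝ} (hd : 0 < d)
    (l : ℂ) {s : ℝ} (hs : s ^ 2 = 1) (hsτ : 0 < s * τ) {R : ℕ} (hR : s * τ * r = R) :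
    Module.Finite ℂ (twistedSpinors r κ₁ κ₂ τ d T l) ∧
      Module.finrank ℂ (twistedSpinors r κ₁ κ₂ τ d T l) = Nat.card {_j : Fin R //
        IsLadderEigenvalue (4 * Real.pi * (s * τ)) (2 * Real.pi * (s * τ) * T⁻¹) d l} := by
  have hr' : (0 : ℝ) < r := by exact_mod_cast hr
  have hR0 : 0 < R := by
    have : (0 : ℝ) < R := by rw [← hR]; positivity
    exact_mod_cast this
  have hc : 0 < 4 * Real.pi * (s * τ) := by have := Real.pi_pos; positivity
  have hab := lower_raise (r := r) (κ₁ := κ₁) (κ₂ := κ₂) (τ := τ) s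
  have hpos : ∀ N : ℂ, N.re < -(2 * Real.pi * (s * τ)) → ∀ v : twistedFn r κ₁ κ₂ τ,
      raise r κ₁ κ₂ τ s (lower r κ₁ κ₂ τ s v) = N • v → v = 0 :=
    fun N hN v hv => eq_zero_of_raise_lower hr hs hN v hv
  -- For s = -1 lowering is minus the raising operator for s = 1, and vice versa, so swapping the
  -- components gives the same system with m replaced by -m. Thus the lowest eigenvalue is -2π|τ|/T
  -- for both signs of τ.
  have key : Nonempty (twistedSpinors r κ₁ κ₂ τ d T l ≃ₗ[ℂ]
      ladderSpinors (lower r κ₁ κ₂ τ s) (raise r κ₁ κ₂ τ s) (2 * Real.pi * (s * τ) * T⁻¹) d l) := by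
    rcases mul_self_eq_one_iff.1 ((sq s).symm.trans hs) with rfl | rfl
    · rw [one_mul]
      exact ⟨LinearEquiv.refl _ _⟩
    · have e1 : lower r κ₁ κ₂ τ (-1) = -raise r κ₁ κ₂ τ 1 := by
        simp only [lower, raise]
        push_cast
        module
      have e2 : raise r κ₁ κ₂ τ (-1) = -lower r κ₁ κ₂ τ 1 := by
        simp only [lower, raise]
        push_cast
        module
      have hm : ∀ v : twistedFn r κ₁ κ₂ τ × twistedFn r κ₁ κ₂ τ,
          v ∈ twistedSpinors r κ₁ κ₂ τ d T l ↔ v.swap ∈ ladderSpinors (lower r κ₁ κ₂ τ (-1))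
            (raise r κ₁ κ₂ τ (-1)) (2 * Real.pi * (-1 * τ) * T⁻¹) d l := by
        intro v
        rw [twistedSpinors, mem_ladderSpinors, mem_ladderSpinors, e1, e2, and_comm]
        simp only [Prod.fst_swap, Prod.snd_swap, LinearMap.neg_apply, smul_neg]
        push_cast
        refine and_congr ?_ ?_
        · refine Eq.congr ?_ rfl
          module
        · refine Eq.congr ?_ rfl
          module
      exact ⟨
        { toFun := fun v => ⟨v.1.swap, (hm v.1).1 v.2⟩
          map_add' := fun _ _ => rfl
          map_smul' := fun _ _ => rfl
          invFun := fun v => ⟨v.1.swap, (hm v.1.swap).2 (by rw [Prod.swap_swap]; exact v.2)⟩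
          left_inv := fun _ => rfl
          right_inv := fun _ => rfl }⟩
  obtain ⟨e⟩ := key
  by_cases hl : IsLadderEigenvalue (4 * Real.pi * (s * τ)) (2 * Real.pi * (s * τ) * T⁻¹) d l
  · obtain ⟨e'⟩ := ladderSpinors_equiv hc hab hpos hd hl
    let e'' := (e.trans e').trans (groundEquiv hs hR0 hsτ hR)
    refine ⟨Module.Finite.equiv e''.symm, ?_⟩
    rw [e''.finrank_eq, Nat.card_congr (Equiv.subtypeUnivEquiv fun _ => hl)]
    simp
  · have := ladderSpinors_subsingleton hc hab hpos hd hl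
    have := e.toEquiv.subsingleton
    have : IsEmpty {_j : Fin R // IsLadderEigenvalue (4 * Real.pi * (s * τ))
      (2 * Real.pi * (s * τ) * T⁻¹) d l} := ⟨fun j => hl j.2⟩
    exact ⟨inferInstance, by rw [Module.finrank_zero_of_subsingleton, Nat.card_of_isEmpty]⟩

/-! ### Functions on the Heisenberg group -/

/-- The smooth functions on the Heisenberg group, in the coordinates `(x, y, z)`, which are invariant
under the lattice up to a character. -/
def heisFn (r : ℕ) (κ₁ κ₂ κ₃ : ℝ) : Submodule ℂ (ℝ × ℝ × ℝ → ℂ) where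
  carrier := {f | ContDiff ℝ ∞ f ∧
    (∀ x y z, f (x + r, y, z + r * y) = realChar κ₁ 1 * f (x, y, z)) ∧
    (∀ x y z, f (x, y + 1, z) = realChar κ₂ 1 * f (x, y, z)) ∧
    ∀ x y z, f (x, y, z + 1) = realChar κ₃ 1 * f (x, y, z)}
  zero_mem' := ⟨contDiff_const, by simp, by simp, by simp⟩
  add_mem' := by
    rintro f g ⟨hf, hf1, hf2, hf3⟩ ⟨hg, hg1, hg2, hg3⟩
    refine ⟨hf.add hg, fun x y z => ?_, fun x y z => ?_, fun x y z => ?_⟩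
    · simp only [Pi.add_apply, hf1, hg1]; ring
    · simp only [Pi.add_apply, hf2, hg2]; ring
    · simp only [Pi.add_apply, hf3, hg3]; ring
  smul_mem' := by
    rintro c f ⟨hf, hf1, hf2, hf3⟩
    refine ⟨hf.const_smul c, fun x y z => ?_, fun x y z => ?_, fun x y z => ?_⟩
    · simp only [Pi.smul_apply, hf1, smul_eq_mul]; ring
    · simp only [Pi.smul_apply, hf2, smul_eq_mul]; ring
    · simp only [Pi.smul_apply, hf3, smul_eq_mul]; ring

/-- The eigenspace for `l` of the Dirac operator (up to an additive constant) on spinors on the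
Heisenberg group that are invariant under the lattice up to a character. -/
def heisSpinors (r : ℕ) (κ₁ κ₂ κ₃ d T : ℝ) (l : ℂ) :
    Submodule ℂ (heisFn r κ₁ κ₂ κ₃ × heisFn r κ₁ κ₂ κ₃) where
  carrier := {u | ∀ p,
    Complex.I * T⁻¹ * fderiv ℝ u.1.1 p (0, 0, 1) - Complex.I * d * (fderiv ℝ u.2.1 p (1, 0, 0)
      + Complex.I * fderiv ℝ u.2.1 p (0, 1, p.1)) = l * u.1.1 p ∧
    -(Complex.I * d) * (fderiv ℝ u.1.1 p (1, 0, 0) - Complex.I * fderiv ℝ u.1.1 p (0, 1, p.1))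
      - Complex.I * T⁻¹ * fderiv ℝ u.2.1 p (0, 0, 1) = l * u.2.1 p}
  zero_mem' := by simp
  add_mem' := by
    rintro u v hu hv p
    have hd : ∀ f : heisFn r κ₁ κ₂ κ₃, DifferentiableAt ℝ f.1 p :=
      fun f => f.2.1.differentiable (by simp) p
    obtain ⟨h1, h2⟩ := hu p
    obtain ⟨h3, h4⟩ := hv p
    simp only [Prod.fst_add, Prod.snd_add, Submodule.coe_add, fderiv_add (hd _) (hd _),
      add_apply, Pi.add_apply]
    exact ⟨by linear_combination h1 + h3, by linear_combination h2 + h4⟩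
  smul_mem' := by
    rintro c u hu p
    have hd : ∀ f : heisFn r κ₁ κ₂ κ₃, DifferentiableAt ℝ f.1 p :=
      fun f => f.2.1.differentiable (by simp) p
    obtain ⟨h1, h2⟩ := hu p
    simp only [Prod.smul_fst, Prod.smul_snd, Submodule.coe_smul, fderiv_const_smul (hd _),
      smul_apply, Pi.smul_apply, smul_eq_mul]
    exact ⟨by linear_combination c * h1, by linear_combination c * h2⟩

namespace heisFn

variable {r : ℕ} {κ₁ κ₂ κ₃ τ : ℝ}

theorem smooth (f : heisFn r κ₁ κ₂ κ₃) : ContDiff ℝ ∞ f.1 := f.2.1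

theorem add_x (f : heisFn r κ₁ κ₂ κ₃) (x y z : ℝ) :
    f.1 (x + r, y, z + r * y) = realChar κ₁ 1 * f.1 (x, y, z) := f.2.2.1 x y z

theorem add_y (f : heisFn r κ₁ κ₂ κ₃) (x y z : ℝ) :
    f.1 (x, y + 1, z) = realChar κ₂ 1 * f.1 (x, y, z) := f.2.2.2.1 x y z

theorem add_z (f : heisFn r κ₁ κ₂ κ₃) (x y z : ℝ) :
    f.1 (x, y, z + 1) = realChar κ₃ 1 * f.1 (x, y, z) := f.2.2.2.2 x y z

theorem hasDerivAt_x {f : ℝ × ℝ × ℝ → ℂ} (hf : ContDiff ℝ ∞ f) (x y z : ℝ) :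
    HasDerivAt (fun t => f (t, y, z)) (fderiv ℝ f (x, y, z) (1, 0, 0)) x :=
  ((hf.differentiable (by simp) (x, y, z)).hasFDerivAt).comp_hasDerivAt x
    ((hasDerivAt_id x).prodMk (hasDerivAt_const x (y, z)))

theorem hasDerivAt_y {f : ℝ × ℝ × ℝ → ℂ} (hf : ContDiff ℝ ∞ f) (x y z : ℝ) :
    HasDerivAt (fun t => f (x, t, z)) (fderiv ℝ f (x, y, z) (0, 1, 0)) y :=
  ((hf.differentiable (by simp) (x, y, z)).hasFDerivAt).comp_hasDerivAt y
    ((hasDerivAt_const y x).prodMk ((hasDerivAt_id y).prodMk (hasDerivAt_const y z)))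

theorem hasDerivAt_z {f : ℝ × ℝ × ℝ → ℂ} (hf : ContDiff ℝ ∞ f) (x y z : ℝ) :
    HasDerivAt (fun t => f (x, y, t)) (fderiv ℝ f (x, y, z) (0, 0, 1)) z :=
  ((hf.differentiable (by simp) (x, y, z)).hasFDerivAt).comp_hasDerivAt z
    ((hasDerivAt_const z x).prodMk ((hasDerivAt_const z y).prodMk (hasDerivAt_id z)))

theorem fderiv_y_add_z (f : ℝ × ℝ × ℝ → ℂ) (p : ℝ × ℝ × ℝ) (x : ℝ) :
    fderiv ℝ f p (0, 1, x) = fderiv ℝ f p (0, 1, 0) + x * fderiv ℝ f p (0, 0, 1) := by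
  have : ((0, 1, x) : ℝ × ℝ × ℝ) = (0, 1, 0) + x • (0, 0, 1) := by simp
  rw [this, map_add, map_smul, Complex.real_smul]

theorem continuous_line {f : ℝ × ℝ × ℝ → ℂ} (hf : Continuous f) (p : ℝ × ℝ) :
    Continuous fun z => f (p.1, p.2, z) := by fun_prop

/-! ### Fourier coefficients in the central direction -/

/-- The Fourier coefficient at `exp (2πiτz)`. -/
def fourierZ (τ : ℝ) (f : ℝ × ℝ × ℝ → ℂ) (p : ℝ × ℝ) : ℂ :=
  ∫ z in (0 : ℝ)..1, realChar (-τ) z * f (p.1, p.2, z)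

theorem contDiff_realChar_mul {f : ℝ × ℝ × ℝ → ℂ} (hf : ContDiff ℝ ∞ f) (τ : ℝ) :
    ContDiff ℝ ∞ fun q : (ℝ × ℝ) × ℝ => realChar (-τ) q.2 * f (q.1.1, q.1.2, q.2) :=
  ((contDiff_realChar _).comp contDiff_snd).mul (hf.comp (by fun_prop))

theorem contDiff_fourierZ {f : ℝ × ℝ × ℝ → ℂ} (hf : ContDiff ℝ ∞ f) (τ : ℝ) :
    ContDiff ℝ ∞ (fourierZ τ f) :=
  contDiff_infty_parametric_intervalIntegral (contDiff_realChar_mul hf τ) 0 1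

theorem fderiv_fourierZ {f : ℝ × ℝ × ℝ → ℂ} (hf : ContDiff ℝ ∞ f) (τ : ℝ) (p v : ℝ × ℝ) :
    fderiv ℝ (fourierZ τ f) p v = fourierZ τ (fun q => fderiv ℝ f q (v.1, v.2, 0)) p := by
  have hc := contDiff_realChar_mul hf τ
  refine (fderiv_parametric_intervalIntegral (hc.of_le (by exact_mod_cast le_top)) 0 1 p v).trans
    (intervalIntegral.integral_congr fun z _ => ?_)
  -- Both integrands are the derivative at t = 0 of the same function along the line p + tv.
  have h1 : HasDerivAt (fun t : ℝ => realChar (-τ) z * f (p.1 + t * v.1, p.2 + t * v.2, z))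
      (fderiv ℝ (fun q : (ℝ × ℝ) × ℝ => realChar (-τ) q.2 * f (q.1.1, q.1.2, q.2)) (p, z) (v, 0))
      0 := by
    have hl : HasDerivAt (fun t : ℝ => ((p.1 + t * v.1, p.2 + t * v.2), z)) (v, (0 : ℝ)) 0 := by
      refine HasDerivAt.prodMk (HasDerivAt.prodMk ?_ ?_) (hasDerivAt_const _ _)
      · simpa using ((hasDerivAt_id (0 : ℝ)).mul_const v.1).const_add p.1
      · simpa using ((hasDerivAt_id (0 : ℝ)).mul_const v.2).const_add p.2
    refine HasFDerivAt.comp_hasDerivAt (0 : ℝ)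
      (l := fun q : (ℝ × ℝ) × ℝ => realChar (-τ) q.2 * f (q.1.1, q.1.2, q.2)) ?_ hl
    simpa using (hc.differentiable (by simp) (p, z)).hasFDerivAt
  have h2 : HasDerivAt (fun t : ℝ => realChar (-τ) z * f (p.1 + t * v.1, p.2 + t * v.2, z))
      (realChar (-τ) z * fderiv ℝ f (p.1, p.2, z) (v.1, v.2, 0)) 0 := by
    have hl : HasDerivAt (fun t : ℝ => (p.1 + t * v.1, p.2 + t * v.2, z)) (v.1, v.2, (0 : ℝ)) 0 := by
      refine HasDerivAt.prodMk ?_ (HasDerivAt.prodMk ?_ (hasDerivAt_const _ _))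
      · simpa using ((hasDerivAt_id (0 : ℝ)).mul_const v.1).const_add p.1
      · simpa using ((hasDerivAt_id (0 : ℝ)).mul_const v.2).const_add p.2
    refine HasDerivAt.const_mul _ (HasFDerivAt.comp_hasDerivAt (0 : ℝ) (l := f) ?_ hl)
    simpa using (hf.differentiable (by simp) (p.1, p.2, z)).hasFDerivAt
  exact h1.unique h2

theorem fourierZ_add {f g : ℝ × ℝ × ℝ → ℂ} (hf : Continuous f) (hg : Continuous g) (p : ℝ × ℝ) :
    fourierZ τ (fun q => f q + g q) p = fourierZ τ f p + fourierZ τ g p := by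
  simp only [fourierZ, mul_add]
  exact intervalIntegral.integral_add
    (((continuous_realChar _).mul (continuous_line hf p)).intervalIntegrable 0 1)
    (((continuous_realChar _).mul (continuous_line hg p)).intervalIntegrable 0 1)

theorem fourierZ_const_mul (c : ℂ) (f : ℝ × ℝ × ℝ → ℂ) (p : ℝ × ℝ) :
    fourierZ τ (fun q => c * f q) p = c * fourierZ τ f p := by
  simp only [fourierZ, ← intervalIntegral.integral_const_mul]
  refine intervalIntegral.integral_congr fun z _ => ?_
  ring

theorem fourierZ_fderiv_z (hτ : realChar τ 1 = realChar κ₃ 1) (f : heisFn r κ₁ κ₂ κ₃) (p : ℝ × ℝ) :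
    fourierZ τ (fun q => fderiv ℝ f.1 q (0, 0, 1)) p
      = 2 * Real.pi * Complex.I * τ * fourierZ τ f.1 p := by
  refine intervalIntegral_realChar_mul_deriv (fun z => hasDerivAt_z (smooth f) p.1 p.2 z)
    (continuous_line ((smooth f).fderiv_apply_const _).continuous p) ?_
  have := add_z f p.1 p.2 0
  rwa [zero_add, ← hτ] at this

/-- Left translation by g(r, 0, 0) also moves z by ry. The substitution z ↦ z - ry turns this into
the twist exp(-2πiτry), and periodicity of the integrand restores the interval of integration. -/
theorem fourierZ_mem (hτ : realChar τ 1 = realChar κ₃ 1) (f : heisFn r κ₁ κ₂ κ₃) :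
    fourierZ τ f.1 ∈ twistedFn r κ₁ κ₂ τ := by
  refine ⟨contDiff_fourierZ (smooth f) τ, fun x y => ?_, fun x y => ?_⟩
  · let g : ℝ → ℂ := fun z => realChar (-τ) z * f.1 (x, y, z)
    have hg : Function.Periodic g 1 := fun z => by
      simp only [g, add_z, realChar_add_right, realChar_neg_left, hτ]
      have := realChar_ne_zero κ₃ 1
      have := realChar_ne_zero τ z
      field_simp
    have h1 : ∀ z, realChar (-τ) z * f.1 (x + r, y, z)
        = realChar κ₁ 1 * realChar (-(τ * r)) y * g (z - r * y) := fun z => by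
      have := add_x f x y (z - r * y)
      rw [sub_add_cancel] at this
      have e : realChar (-τ) z = realChar (-(τ * r)) y * realChar (-τ) (z - r * y) := by
        simp only [realChar, ← Complex.exp_add]
        congr 1
        push_cast
        ring
      rw [this, e]
      ring
    simp only [fourierZ, h1, intervalIntegral.integral_const_mul]
    congr 1
    have h2 := hg.intervalIntegral_add_eq (0 - r * y) 0
    rw [zero_add] at h2
    rw [intervalIntegral.integral_comp_sub_right (fun z => g z),
      show (1 - r * y : ℝ) = 0 - r * y + 1 by ring, h2]
  · simp only [fourierZ, add_y, ← intervalIntegral.integral_const_mul]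
    refine intervalIntegral.integral_congr fun z _ => ?_
    ring

/-- The Fourier coefficient at `exp (2πiτz)` as a linear map. -/
def fourierZL (hτ : realChar τ 1 = realChar κ₃ 1) :
    heisFn r κ₁ κ₂ κ₃ →ₗ[ℂ] twistedFn r κ₁ κ₂ τ where
  toFun f := ⟨fourierZ τ f.1, fourierZ_mem hτ f⟩
  map_add' f g := by
    ext p
    exact fourierZ_add (smooth f).continuous (smooth g).continuous p
  map_smul' c f := by
    ext p
    exact fourierZ_const_mul c f.1 p

theorem fourierZL_apply (hτ : realChar τ 1 = realChar κ₃ 1) (f : heisFn r κ₁ κ₂ κ₃) (p : ℝ × ℝ) :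
    (fourierZL hτ f).1 p = fourierZ τ f.1 p := rfl

theorem derivX_fourierZL (hτ : realChar τ 1 = realChar κ₃ 1) (f : heisFn r κ₁ κ₂ κ₃) (p : ℝ × ℝ) :
    (twistedFn.derivX r κ₁ κ₂ τ (fourierZL hτ f)).1 p
      = fourierZ τ (fun q => fderiv ℝ f.1 q (1, 0, 0)) p :=
  fderiv_fourierZ (smooth f) τ p (1, 0)

/-- The coordinate x is constant along the line of integration and ∂_z integrates by parts to 2πiτ,
so ∂_y + x∂_z becomes ∂_y + 2πiτx. -/
theorem derivY_fourierZL (hτ : realChar τ 1 = realChar κ₃ 1) (f : heisFn r κ₁ κ₂ κ₃) (p : ℝ × ℝ) :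
    (twistedFn.derivY r κ₁ κ₂ τ (fourierZL hτ f)).1 p
      = fourierZ τ (fun q => fderiv ℝ f.1 q (0, 1, q.1)) p := by
  have h0 : (fun q => fderiv ℝ f.1 q (0, 1, q.1))
      = fun q => fderiv ℝ f.1 q (0, 1, 0) + q.1 * fderiv ℝ f.1 q (0, 0, 1) :=
    funext fun q => fderiv_y_add_z _ _ _
  have h1 := ((smooth f).fderiv_apply_const (0, 1, 0)).continuous
  have h2 := ((smooth f).fderiv_apply_const (0, 0, 1)).continuous
  have h3 : fourierZ τ (fun q => (q.1 : ℂ) * fderiv ℝ f.1 q (0, 0, 1)) p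
      = p.1 * fourierZ τ (fun q => fderiv ℝ f.1 q (0, 0, 1)) p :=
    fourierZ_const_mul (p.1 : ℂ) (fun q => fderiv ℝ f.1 q (0, 0, 1)) p
  rw [h0, fourierZ_add h1 (by fun_prop), h3, fourierZ_fderiv_z hτ, twistedFn.derivY_apply]
  refine congrArg₂ (· + ·) (fderiv_fourierZ (smooth f) τ p (0, 1)) ?_
  rw [fourierZL_apply]
  ring

theorem eq_zero_of_fourierZ (f : heisFn r κ₁ κ₂ κ₃)
    (h0 : ∀ τ, realChar τ 1 = realChar κ₃ 1 → ∀ p, fourierZ τ f.1 p = 0) : f = 0 := by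
  ext ⟨x, y, z⟩
  refine congrFun (eq_zero_of_fourier_eq_zero (κ := κ₃) one_pos
    (continuous_line (smooth f).continuous (x, y)) (fun z => add_z f x y z) fun n => ?_) z
  rw [div_one]
  exact h0 _ (twistedFn.realChar_add_int_one κ₃ n) (x, y)

/-- The function `exp (2πiτz) h(x, y)`. -/
def ofTwisted (hτ : realChar τ 1 = realChar κ₃ 1) :
    twistedFn r κ₁ κ₂ τ →ₗ[ℂ] heisFn r κ₁ κ₂ κ₃ where
  toFun h := ⟨fun p => realChar τ p.2.2 * h.1 (p.1, p.2.1), by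
    refine ⟨((contDiff_realChar τ).comp (by fun_prop : ContDiff ℝ ∞ fun p : ℝ × ℝ × ℝ => p.2.2)).mul
      ((twistedFn.smooth h).comp (by fun_prop)), fun x y z => ?_, fun x y z => ?_, fun x y z => ?_⟩
    · have e : realChar τ (z + r * y) * realChar (-(τ * r)) y = realChar τ z := by
        simp only [realChar, ← Complex.exp_add]
        congr 1
        push_cast
        ring
      simp only [twistedFn.add_fst]
      rw [← e]
      ring
    · simp only [twistedFn.add_snd]; ring
    · simp only [realChar_add_right, hτ]; ring⟩
  map_add' f g := by ext p; simp [mul_add]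
  map_smul' c f := by ext p; simp [mul_left_comm]

theorem ofTwisted_apply (hτ : realChar τ 1 = realChar κ₃ 1) (h : twistedFn r κ₁ κ₂ τ)
    (p : ℝ × ℝ × ℝ) : (ofTwisted hτ h).1 p = realChar τ p.2.2 * h.1 (p.1, p.2.1) := rfl

theorem fderiv_x_ofTwisted (hτ : realChar τ 1 = realChar κ₃ 1) (h : twistedFn r κ₁ κ₂ τ)
    (p : ℝ × ℝ × ℝ) : fderiv ℝ (ofTwisted hτ h).1 p (1, 0, 0)
      = realChar τ p.2.2 * (twistedFn.derivX r κ₁ κ₂ τ h).1 (p.1, p.2.1) :=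
  (hasDerivAt_x (smooth (ofTwisted hτ h)) p.1 p.2.1 p.2.2).unique
    ((hasDerivAt_fst_of_contDiff (twistedFn.smooth h) p.1 p.2.1).const_mul (realChar τ p.2.2))

theorem fderiv_z_ofTwisted (hτ : realChar τ 1 = realChar κ₃ 1) (h : twistedFn r κ₁ κ₂ τ)
    (p : ℝ × ℝ × ℝ) : fderiv ℝ (ofTwisted hτ h).1 p (0, 0, 1)
      = 2 * Real.pi * Complex.I * τ * (realChar τ p.2.2 * h.1 (p.1, p.2.1)) := by
  rw [← mul_assoc]
  exact (hasDerivAt_z (smooth (ofTwisted hτ h)) p.1 p.2.1 p.2.2).unique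
    ((hasDerivAt_realChar τ p.2.2).mul_const (h.1 (p.1, p.2.1)))

theorem fderiv_y_ofTwisted (hτ : realChar τ 1 = realChar κ₃ 1) (h : twistedFn r κ₁ κ₂ τ)
    (p : ℝ × ℝ × ℝ) : fderiv ℝ (ofTwisted hτ h).1 p (0, 1, p.1)
      = realChar τ p.2.2 * (twistedFn.derivY r κ₁ κ₂ τ h).1 (p.1, p.2.1) := by
  rw [fderiv_y_add_z, fderiv_z_ofTwisted, twistedFn.derivY_apply,
    (hasDerivAt_y (smooth (ofTwisted hτ h)) p.1 p.2.1 p.2.2).unique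
    ((hasDerivAt_snd_of_contDiff (twistedFn.smooth h) p.1 p.2.1).const_mul (realChar τ p.2.2))]
  ring

theorem fourierZ_ofTwisted {σ : ℝ} (hσ : realChar σ 1 = realChar κ₃ 1)
    (hτ : realChar τ 1 = realChar κ₃ 1) (h : twistedFn r κ₁ κ₂ τ) (p : ℝ × ℝ) :
    fourierZ σ (ofTwisted hτ h).1 p = if τ = σ then h.1 p else 0 := by
  have e : fourierZ σ (ofTwisted hτ h).1 p = (∫ z in (0 : ℝ)..1, realChar (τ - σ) z) * h.1 p := by
    rw [fourierZ, ← intervalIntegral.integral_mul_const]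
    refine intervalIntegral.integral_congr fun z _ => ?_
    simp only [ofTwisted_apply, sub_eq_add_neg, realChar_add_left]
    ring
  rw [e]
  split_ifs with h0
  · subst h0
    simp
  · rw [intervalIntegral_realChar_eq_zero _ (sub_ne_zero.2 h0), zero_mul]
    rw [sub_eq_add_neg, realChar_add_left, realChar_neg_left, hσ, hτ,
      mul_inv_cancel₀ (realChar_ne_zero _ _)]

/-- The Fourier coefficient at `exp (2πiτz)` of a spinor. -/
def spinorCoeff (d T : ℝ) (l : ℂ) (hτ : realChar τ 1 = realChar κ₃ 1) :
    heisSpinors r κ₁ κ₂ κ₃ d T l →ₗ[ℂ] twistedSpinors r κ₁ κ₂ τ d T l :=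
  ((fourierZL hτ).prodMap (fourierZL hτ)).restrict (by
    rintro ⟨f, g⟩ h
    have hc : ∀ (f : heisFn r κ₁ κ₂ κ₃) (v : ℝ × ℝ × ℝ), Continuous fun q => fderiv ℝ f.1 q v :=
      fun f v => ((smooth f).fderiv_apply_const v).continuous
    have hc' : ∀ f : heisFn r κ₁ κ₂ κ₃, Continuous fun q : ℝ × ℝ × ℝ => fderiv ℝ f.1 q (0, 1, q.1) :=
      fun f => ((smooth f).continuous_fderiv (by simp)).clm_apply (by fun_prop)
    have hcm : ∀ (c : ℂ) (f : heisFn r κ₁ κ₂ κ₃) (v : ℝ × ℝ × ℝ),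
        Continuous fun q => c * fderiv ℝ f.1 q v := fun c f v => continuous_const.mul (hc f v)
    have hcm' : ∀ (c : ℂ) (f : heisFn r κ₁ κ₂ κ₃),
        Continuous fun q : ℝ × ℝ × ℝ => c * fderiv ℝ f.1 q (0, 1, q.1) :=
      fun c f => continuous_const.mul (hc' f)
    rw [twistedSpinors, mem_ladderSpinors]
    constructor
    · ext p
      have h1 : fourierZ τ (fun q => (Complex.I * T⁻¹) * fderiv ℝ f.1 q (0, 0, 1)
          + ((-(Complex.I * d)) * fderiv ℝ g.1 q (1, 0, 0)
            + (d : ℂ) * fderiv ℝ g.1 q (0, 1, q.1))) p = fourierZ τ (fun q => l * f.1 q) p := by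
        congr 1
        ext q
        rw [← (h q).1]
        linear_combination ((d : ℂ) * fderiv ℝ g.1 q (0, 1, q.1)) * Complex.I_mul_I
      rw [fourierZ_add (hcm _ _ _) (Continuous.fun_add (hcm _ _ _) (hcm' _ _)),
        fourierZ_add (hcm _ _ _) (hcm' _ _), fourierZ_const_mul, fourierZ_const_mul, fourierZ_const_mul,
        fourierZ_const_mul, fourierZ_fderiv_z hτ, ← derivX_fourierZL hτ, ← derivY_fourierZL hτ] at h1
      simp only [LinearMap.prodMap_apply, twistedFn.raise, LinearMap.neg_apply, LinearMap.add_apply,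
        LinearMap.smul_apply, Submodule.coe_add, Submodule.coe_smul, Submodule.coe_neg, Pi.add_apply,
        Pi.smul_apply, Pi.neg_apply, smul_eq_mul, fourierZL_apply] at h1 ⊢
      rw [← h1]
      push_cast
      ring_nf
      simp only [Complex.I_sq]
      ring
    · ext p
      have h1 : fourierZ τ (fun q => (-(Complex.I * d)) * fderiv ℝ f.1 q (1, 0, 0)
          + ((-d : ℂ) * fderiv ℝ f.1 q (0, 1, q.1)
            + (-(Complex.I * T⁻¹)) * fderiv ℝ g.1 q (0, 0, 1))) p
          = fourierZ τ (fun q => l * g.1 q) p := by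
        congr 1
        ext q
        rw [← (h q).2]
        linear_combination (-(d : ℂ) * fderiv ℝ f.1 q (0, 1, q.1)) * Complex.I_mul_I
      rw [fourierZ_add (hcm _ _ _) (Continuous.fun_add (hcm' _ _) (hcm _ _ _)),
        fourierZ_add (hcm' _ _) (hcm _ _ _), fourierZ_const_mul, fourierZ_const_mul, fourierZ_const_mul,
        fourierZ_const_mul, fourierZ_fderiv_z hτ, ← derivX_fourierZL hτ, ← derivY_fourierZL hτ] at h1
      simp only [LinearMap.prodMap_apply, twistedFn.lower, LinearMap.sub_apply,
        LinearMap.smul_apply, Submodule.coe_add, Submodule.coe_smul, Submodule.coe_sub, Pi.add_apply,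
        Pi.smul_apply, Pi.sub_apply, smul_eq_mul, fourierZL_apply] at h1 ⊢
      rw [← h1]
      push_cast
      ring_nf
      simp only [Complex.I_sq]
      ring)

/-- The spinor `exp (2πiτz) ψ(x, y)`. -/
def spinorOfTwisted (d T : ℝ) (l : ℂ) (hτ : realChar τ 1 = realChar κ₃ 1) :
    twistedSpinors r κ₁ κ₂ τ d T l →ₗ[ℂ] heisSpinors r κ₁ κ₂ κ₃ d T l :=
  ((ofTwisted hτ).prodMap (ofTwisted hτ)).restrict (by
    rintro ⟨f, g⟩ ⟨h1, h2⟩ p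
    have h1 := congrFun (congrArg Subtype.val h1) (p.1, p.2.1)
    have h2 := congrFun (congrArg Subtype.val h2) (p.1, p.2.1)
    simp only [twistedFn.lower, twistedFn.raise, LinearMap.sub_apply, LinearMap.neg_apply,
      LinearMap.add_apply, LinearMap.smul_apply, Submodule.coe_add, Submodule.coe_smul,
      Submodule.coe_sub, Submodule.coe_neg, Pi.add_apply, Pi.smul_apply, Pi.sub_apply, Pi.neg_apply,
      smul_eq_mul] at h1 h2
    push_cast at h1 h2
    simp only [LinearMap.prodMap_apply, fderiv_x_ofTwisted, fderiv_y_ofTwisted, fderiv_z_ofTwisted,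
      ofTwisted_apply, Complex.ofReal_inv]
    constructor
    · linear_combination realChar τ p.2.2 * h1
        + (realChar τ p.2.2 * 2 * Real.pi * τ * (T : ℂ)⁻¹ * f.1 (p.1, p.2.1)) * Complex.I_mul_I
    · linear_combination realChar τ p.2.2 * h2
        - (realChar τ p.2.2 * 2 * Real.pi * τ * (T : ℂ)⁻¹ * g.1 (p.1, p.2.1)) * Complex.I_mul_I)

end heisFn

open heisFn

/-- The Fourier decomposition of the Dirac eigenspaces in the central direction. -/
theorem finrank_heisSpinors {r : ℕ} {κ₁ κ₂ κ₃ d T : ℝ} {l : ℂ} {I : Type*} (t : I → ℝ)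
    (ht : Function.Injective t) (hrange : ∀ τ, realChar τ 1 = realChar κ₃ 1 ↔ ∃ i, t i = τ)
    {B : I → Type*} [Finite (Σ i, B i)]
    (hB : ∀ i, Module.Finite ℂ (twistedSpinors r κ₁ κ₂ (t i) d T l) ∧
      Module.finrank ℂ (twistedSpinors r κ₁ κ₂ (t i) d T l) = Nat.card (B i)) :
    Module.Finite ℂ (heisSpinors r κ₁ κ₂ κ₃ d T l) ∧
      Module.finrank ℂ (heisSpinors r κ₁ κ₂ κ₃ d T l) = Nat.card (Σ i, B i) := by
  have hi : ∀ i, realChar (t i) 1 = realChar κ₃ 1 := fun i => (hrange _).2 ⟨i, rfl⟩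
  have h1 : ∀ i j (w : twistedSpinors r κ₁ κ₂ (t i) d T l) (p : ℝ × ℝ),
      (spinorCoeff d T l (hi j) (spinorOfTwisted d T l (hi i) w)).1.1.1 p
        = (if t i = t j then w.1.1.1 p else 0) ∧
      (spinorCoeff d T l (hi j) (spinorOfTwisted d T l (hi i) w)).1.2.1 p
        = (if t i = t j then w.1.2.1 p else 0) := fun i j w p =>
    ⟨fourierZ_ofTwisted (hi j) (hi i) w.1.1 p, fourierZ_ofTwisted (hi j) (hi i) w.1.2 p⟩
  refine finrank_of_decomposition (V := heisSpinors r κ₁ κ₂ κ₃ d T l)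
    (W := fun i => twistedSpinors r κ₁ κ₂ (t i) d T l) (fun i => spinorCoeff d T l (hi i))
    (fun i => spinorOfTwisted d T l (hi i)) (fun i w => ?_) (fun i j hij w => ?_) ?_
    (fun i => (hB i).1) (fun i => (hB i).2)
  · refine Subtype.ext (Prod.ext ?_ ?_)
    · ext p; rw [(h1 i i w p).1, if_pos rfl]
    · ext p; rw [(h1 i i w p).2, if_pos rfl]
  · have hij' : t i ≠ t j := fun h => hij (ht h)
    refine Subtype.ext (Prod.ext ?_ ?_)
    · ext p; rw [(h1 i j w p).1, if_neg hij']; rfl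
    · ext p; rw [(h1 i j w p).2, if_neg hij']; rfl
  · rintro ⟨⟨f, g⟩, hv⟩ h0
    refine Subtype.ext (Prod.ext ?_ ?_)
    · refine eq_zero_of_fourierZ f fun τ hτ p => ?_
      obtain ⟨i, rfl⟩ := (hrange τ).1 hτ
      exact congrArg (fun v => v.1.1.1 p) (h0 i)
    · refine eq_zero_of_fourierZ g fun τ hτ p => ?_
      obtain ⟨i, rfl⟩ := (hrange τ).1 hτ
      exact congrArg (fun v => v.1.2.1 p) (h0 i)

/-! ### Comparison with the list of eigenvalues -/

theorem lamTau_eq_iff {d T t : ℝ} {μ : ℂ} :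
    (lamTau d T t : ℂ) = μ ↔ μ + (d ^ 2 * T / 4 : ℝ) = ((-(2 * Real.pi * t * T⁻¹) : ℝ) : ℂ) := by
  rw [← sub_eq_zero, ← sub_eq_zero (b := ((-(2 * Real.pi * t * T⁻¹) : ℝ) : ℂ)), ← neg_eq_zero]
  refine Eq.congr ?_ rfl
  simp only [lamTau]
  push_cast
  ring

/-- With m = 2πt/T and c = 4πt one has m² + d²ck = 4(π²t²/T² + kπd²t). -/
theorem lamTauK_eq_iff {d T t k : ℝ} {s : ℤˣ} {μ : ℂ} :
    (lamTauK d T t k s : ℂ) = μ ↔ μ + (d ^ 2 * T / 4 : ℝ)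
      = ((((s : ℤ) : ℝ) * √((2 * Real.pi * t * T⁻¹) ^ 2 + d ^ 2 * (4 * Real.pi * t) * k) : ℝ) : ℂ) := by
  have h : √((2 * Real.pi * t * T⁻¹) ^ 2 + d ^ 2 * (4 * Real.pi * t) * k)
      = 2 * √(Real.pi ^ 2 * t ^ 2 * (T⁻¹) ^ 2 + k * Real.pi * d ^ 2 * t) := by
    rw [show (2 * Real.pi * t * T⁻¹) ^ 2 + d ^ 2 * (4 * Real.pi * t) * k
      = 2 ^ 2 * (Real.pi ^ 2 * t ^ 2 * (T⁻¹) ^ 2 + k * Real.pi * d ^ 2 * t) by ring,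
      Real.sqrt_mul (by norm_num), Real.sqrt_sq (by norm_num)]
  rw [h, ← sub_eq_zero, ← sub_eq_zero (b := ((((s : ℤ) : ℝ) * _ : ℝ) : ℂ)), ← neg_eq_zero]
  refine Eq.congr ?_ rfl
  simp only [lamTauK]
  push_cast
  ring

theorem lamTorus_eq_iff {d T α β : ℝ} {s : ℤˣ} {μ : ℂ} :
    (lamTorus d T α β s : ℂ) = μ ↔
      ((((s : ℤ) : ℝ) * (2 * Real.pi * d * √(α ^ 2 + β ^ 2)) : ℝ) : ℂ)
        = μ + (d ^ 2 * T / 4 : ℝ) := by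
  rw [← sub_eq_zero, ← sub_eq_zero (b := μ + _)]
  refine Eq.congr ?_ rfl
  simp only [lamTorus]
  push_cast
  ring

theorem sq_intUnits (s : ℤˣ) : ((s : ℤ) : ℝ) ^ 2 = 1 := by
  rcases Int.units_eq_one_or s with rfl | rfl <;> norm_num

theorem sq_signed_sqrt (s : ℤˣ) {q : ℝ} (hq : 0 ≤ q) : (((s : ℤ) : ℝ) * √q) ^ 2 = q := by
  rw [mul_pow, sq_intUnits, one_mul, Real.sq_sqrt hq]

theorem isLadderEigenvalue_iff {c m d : ℝ} {l : ℂ} (hc : 0 < c) :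
    IsLadderEigenvalue c m d l ↔ l = ((-m : ℝ) : ℂ) ∨ ∃ (k : ℕ+) (s : ℤˣ),
      l = ((((s : ℤ) : ℝ) * √(m ^ 2 + d ^ 2 * c * (k : ℕ)) : ℝ) : ℂ) := by
  rw [IsLadderEigenvalue, Complex.ofReal_neg]
  refine or_congr_right ⟨?_, ?_⟩
  · rintro ⟨k, hk, h⟩
    have hq : 0 ≤ m ^ 2 + d ^ 2 * c * k := by positivity
    have e : l ^ 2 = ((√(m ^ 2 + d ^ 2 * c * k) : ℝ) : ℂ) ^ 2 := by
      rw [← Complex.ofReal_pow, Real.sq_sqrt hq, h]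
      push_cast
      rfl
    rcases sq_eq_sq_iff_eq_or_eq_neg.1 e with e | e
    · exact ⟨⟨k, hk⟩, 1, by simpa using e⟩
    · exact ⟨⟨k, hk⟩, -1, by simpa using e⟩
  · rintro ⟨k, s, rfl⟩
    refine ⟨k, k.2, ?_⟩
    rw [← Complex.ofReal_pow, sq_signed_sqrt s (by positivity)]
    push_cast
    rfl

/-- With m = 2π|τ|/T this bounds the modes that can contribute to a given eigenvalue. -/
theorem le_norm_of_isLadderEigenvalue {c m d : ℝ} {l : ℂ} (hc : 0 < c) (hm : 0 ≤ m)
    (h : IsLadderEigenvalue c m d l) : m ≤ ‖l‖ := by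
  obtain rfl | ⟨k, s, rfl⟩ := (isLadderEigenvalue_iff hc).1 h
  · simp [abs_of_nonneg hm]
  · rw [Complex.norm_real, Real.norm_eq_abs]
    refine le_of_abs_le (sq_le_sq.1 ?_)
    rw [sq_signed_sqrt s (by positivity)]
    have : 0 ≤ d ^ 2 * c * (k : ℕ) := by positivity
    linarith

/-- The eigenvalues `lamTau` and `lamTauK` with indices. -/
def tailEigenvalue (d T : ℝ) {ι : Type*} (t : ι → ℝ) (W : ι → ℕ) :
    (Σ n, Fin (W n)) ⊕ (Σ x : ι × ℕ+ × ℤˣ, Fin (W x.1)) → ℝ :=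
  Sum.elim (fun x => lamTau d T (t x.1))
    fun x => lamTauK d T (t x.1.1) (x.1.2.1 : ℕ) x.1.2.2

/-- For fixed n the values -m and ±√(m² + d²ck), k ≥ 1, are pairwise distinct. So among the indices
with value μ the pair (k, s) can be forgotten: it is determined by n. -/
theorem nonempty_tail_equiv {d T : ℝ} (hd : 0 < d) {ι : Type*} {t : ι → ℝ} (ht : ∀ n, 0 < t n)
    (W : ι → ℕ) (μ : ℂ) :
    Nonempty ({x // (tailEigenvalue d T t W x : ℂ) = μ} ≃ {x : Σ n, Fin (W n) //
      IsLadderEigenvalue (4 * Real.pi * t x.1) (2 * Real.pi * t x.1 * T⁻¹) d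
        (μ + (d ^ 2 * T / 4 : ℝ))}) := by
  have hπ := Real.pi_pos
  have hc : ∀ n, 0 < 4 * Real.pi * t n := fun n => by have := ht n; positivity
  set q : ι → ℕ+ → ℝ := fun n k =>
    (2 * Real.pi * t n * T⁻¹) ^ 2 + d ^ 2 * (4 * Real.pi * t n) * (k : ℕ) with hq
  have hq0 : ∀ n k, 0 < q n k := fun n k => by
    have := hc n
    have : (0 : ℝ) < (k : ℕ) := by exact_mod_cast k.2
    positivity
  let F : {x // (tailEigenvalue d T t W x : ℂ) = μ} → {x : Σ n, Fin (W n) //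
      IsLadderEigenvalue (4 * Real.pi * t x.1) (2 * Real.pi * t x.1 * T⁻¹) d
        (μ + (d ^ 2 * T / 4 : ℝ))} := fun x => match x with
    | ⟨.inl x, h⟩ => ⟨x, (isLadderEigenvalue_iff (hc _)).2 (.inl (lamTau_eq_iff.1 h))⟩
    | ⟨.inr x, h⟩ => ⟨⟨x.1.1, x.2⟩, (isLadderEigenvalue_iff (hc _)).2
        (.inr ⟨x.1.2.1, x.1.2.2, lamTauK_eq_iff.1 h⟩)⟩
  -- The squares of the two sides differ by d²ck > 0.
  have hsep : ∀ n k (s : ℤˣ), -(2 * Real.pi * t n * T⁻¹) ≠ ((s : ℤ) : ℝ) * √(q n k) := by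
    intro n k s h
    have h1 := congrArg (· ^ 2) h
    simp only [sq_signed_sqrt s (hq0 n k).le, neg_sq] at h1
    simp only [hq] at h1
    have h2 : 0 < d ^ 2 * (4 * Real.pi * t n) * (k : ℕ) := by
      have := hc n
      have : (0 : ℝ) < (k : ℕ) := by exact_mod_cast k.2
      positivity
    linarith
  refine ⟨Equiv.ofBijective F ⟨?_, ?_⟩⟩
  · rintro ⟨⟨n, j⟩ | ⟨⟨n, k, s⟩, j⟩, h⟩ ⟨⟨n', j'⟩ | ⟨⟨n', k', s'⟩, j'⟩, h'⟩ e
    · simp only [F, Subtype.mk.injEq] at e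
      simp only [e]
    · simp only [F, Subtype.mk.injEq, Sigma.mk.injEq] at e
      obtain ⟨rfl, -⟩ := e
      exact absurd (Complex.ofReal_injective
        ((lamTau_eq_iff.1 h).symm.trans (lamTauK_eq_iff.1 h'))) (hsep n k' s')
    · simp only [F, Subtype.mk.injEq, Sigma.mk.injEq] at e
      obtain ⟨rfl, -⟩ := e
      exact absurd (Complex.ofReal_injective
        ((lamTau_eq_iff.1 h').symm.trans (lamTauK_eq_iff.1 h))) (hsep n k s)
    · simp only [F, Subtype.mk.injEq, Sigma.mk.injEq] at e
      obtain ⟨rfl, e⟩ := e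
      obtain rfl := eq_of_heq e
      have h1 : ((s : ℤ) : ℝ) * √(q n k) = ((s' : ℤ) : ℝ) * √(q n k') := Complex.ofReal_injective
        ((lamTauK_eq_iff.1 h).symm.trans (lamTauK_eq_iff.1 h'))
      have h2 := congrArg (· ^ 2) h1
      simp only [sq_signed_sqrt _ (hq0 n _).le] at h2
      have h3 : k = k' := by
        simp only [hq] at h2
        have h3 := mul_left_cancel₀ (mul_pos (pow_pos hd 2) (hc n)).ne' (add_left_cancel h2)
        exact PNat.eq (by exact_mod_cast h3)
      subst h3
      have h4 := mul_right_cancel₀ (Real.sqrt_pos.2 (hq0 n k)).ne' h1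
      have h5 : s = s' := Units.ext (by exact_mod_cast h4)
      subst h5
      rfl
  · rintro ⟨⟨n, j⟩, h⟩
    rcases (isLadderEigenvalue_iff (hc n)).1 h with h | ⟨k, s, h⟩
    · exact ⟨⟨.inl ⟨n, j⟩, lamTau_eq_iff.2 h⟩, rfl⟩
    · exact ⟨⟨.inr ⟨(n, k, s), j⟩, lamTauK_eq_iff.2 h⟩, rfl⟩

/-- The modes τ and -τ contribute R n each, whereas the list of eigenvalues attaches 2 R n copies to
the single index τ. -/
theorem nonempty_signed_equiv {ι : Type*} (P : ι → Prop) (R W : ι → ℕ) (hW : ∀ n, W n = 2 * R n) :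
    Nonempty ((Σ x : ι × ℤˣ, {_j : Fin (R x.1) // P x.1}) ≃ {x : Σ n, Fin (W n) // P x.1}) := by
  have e : ∀ n, ℤˣ × Fin (R n) ≃ Fin (W n) := fun n => Fintype.equivOfCardEq (by simp [hW])
  refine ⟨Equiv.mk (fun x => ⟨⟨x.1.1, e x.1.1 (x.1.2, x.2.1)⟩, x.2.2⟩)
    (fun x => ⟨(x.1.1, ((e x.1.1).symm x.1.2).1), ⟨((e x.1.1).symm x.1.2).2, x.2⟩⟩) ?_ ?_⟩
  · rintro ⟨⟨n, s⟩, j, h⟩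
    have := (e n).symm_apply_apply (s, j)
    refine Sigma.ext (Prod.ext rfl (congrArg Prod.fst this)) (heq_of_eq (Subtype.ext ?_))
    exact congrArg Prod.snd this
  · rintro ⟨⟨n, j⟩, h⟩
    simp only [Prod.mk.eta, Equiv.apply_symm_apply]

theorem finite_ladder_tail {d T : ℝ} (hT : 0 < T) {ι : Type*} {t : ι → ℝ} (ht : ∀ n, 0 < t n)
    (hfin : ∀ K, {n | t n ≤ K}.Finite) (W : ι → ℕ) (l : ℂ) :
    Finite {x : Σ n, Fin (W n) //
      IsLadderEigenvalue (4 * Real.pi * t x.1) (2 * Real.pi * t x.1 * T⁻¹) d l} := by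
  have hπ := Real.pi_pos
  have := (hfin (‖l‖ * T / (2 * Real.pi))).to_subtype
  refine Finite.of_injective (β := Σ n : {n | t n ≤ ‖l‖ * T / (2 * Real.pi)}, Fin (W n))
    (fun x => ⟨⟨x.1.1, ?_⟩, x.1.2⟩) ?_
  · have h1 := ht x.1.1
    have h := le_norm_of_isLadderEigenvalue (by positivity) (by positivity) x.2
    rw [← div_eq_mul_inv, div_le_iff₀ hT] at h
    rw [Set.mem_ofPred_eq, le_div_iff₀ (by positivity)]
    linarith
  · rintro ⟨⟨n, j⟩, h⟩ ⟨⟨n', j'⟩, h'⟩ e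
    simp only [Sigma.mk.injEq, Subtype.mk.injEq] at e
    obtain ⟨rfl, e⟩ := e
    obtain rfl := eq_of_heq e
    rfl

theorem finite_torus_eigenvalues {r : ℕ} (hr : 0 < r) (κ₁ κ₂ : ℝ) {d : ℝ} (hd : 0 < d) (l : ℂ) :
    Finite (Σ p : torusChars r κ₁ κ₂, {s : ℤˣ //
      (((s : ℤ) : ℝ) * (2 * Real.pi * d * √(p.1.1 ^ 2 + p.1.2 ^ 2)) : ℝ) = l}) := by
  have hπ := Real.pi_pos
  have hf := finite_torusChars hr (κ₁ := κ₁) (κ₂ := κ₂) (‖l‖ / (2 * Real.pi * d))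
  have := hf.to_subtype
  refine Finite.of_injective (β := {p ∈ torusChars r κ₁ κ₂ |
    p.1 ^ 2 + p.2 ^ 2 ≤ (‖l‖ / (2 * Real.pi * d)) ^ 2} × ℤˣ)
    (fun x => (⟨x.1.1, x.1.2, ?_⟩, x.2.1)) ?_
  · obtain ⟨p, s, rfl⟩ := x
    have h0 : 0 ≤ p.1.1 ^ 2 + p.1.2 ^ 2 := by positivity
    rw [Complex.norm_real, Real.norm_eq_abs, div_pow, sq_abs, mul_pow _ (_ * _), sq_intUnits,
      mul_pow _ (√_), Real.sq_sqrt h0, one_mul, mul_div_cancel_left₀ _ (by positivity)]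
  · rintro ⟨p, s, h⟩ ⟨p', s', h'⟩ e
    simp only [Prod.mk.injEq, Subtype.mk.injEq] at e
    obtain ⟨e, rfl⟩ := e
    obtain rfl := Subtype.ext e
    rfl

/-- A logarithm of the sign `u`. -/
def signLog (u : ℤˣ) : ℝ := if u = 1 then 0 else 1 / 2

theorem realChar_signLog (u : ℤˣ) : realChar (signLog u) 1 = ((u : ℤ) : ℂ) := by
  rcases Int.units_eq_one_or u with rfl | rfl
  · simp [signLog, realChar]
  · rw [signLog, if_neg (by decide), realChar]
    push_cast
    rw [show 2 * Real.pi * Complex.I * (1 / 2) * 1 = Real.pi * Complex.I by ring,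
      Complex.exp_pi_mul_I]

/-- The half-integrality conditions follow from the conditions on the exponentials, because the
square of a sign is 1. -/
theorem torusPairs_eq {r : ℕ} (hr : 0 < r) (δ : Fin 3 → ℤˣ) :
    torusPairs r δ = torusChars r (signLog (δ 0)) (signLog (δ 1)) := by
  have hr' : (r : ℝ) ≠ 0 := by exact_mod_cast hr.ne'
  have hsq : ∀ (u : ℤˣ) (a b : ℝ), realChar a b = ((u : ℤ) : ℂ) → ∃ m : ℤ, a * b = 1 / 2 * m := by
    intro u a b h
    have : realChar a (b + b) = 1 := by
      rw [realChar_add_right, h, ← Int.cast_mul, Int.units_coe_mul_self, Int.cast_one]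
    obtain ⟨m, hm⟩ := realChar_mul_eq_one_iff.1 this
    exact ⟨m, by linarith⟩
  ext p
  have e1 : Complex.exp (2 * Real.pi * Complex.I * r * p.1) = realChar p.1 r := by
    rw [realChar]; congr 1; push_cast; ring
  have e2 : Complex.exp (2 * Real.pi * Complex.I * p.2) = realChar p.2 1 := by
    rw [realChar]; congr 1; push_cast; ring
  simp only [torusPairs, torusChars, Set.mem_ofPred_eq, realChar_signLog, e1, e2]
  refine ⟨fun h => ⟨h.2.1, h.2.2.2⟩, fun h => ⟨?_, h.1, ?_, h.2⟩⟩
  · obtain ⟨m, hm⟩ := hsq _ _ _ h.1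
    refine ⟨m, ?_⟩
    field_simp
    linarith
  · obtain ⟨m, hm⟩ := hsq _ _ _ h.2
    exact ⟨m, by linarith⟩

theorem finrank_tail_component {r : ℕ} (hr : 0 < r) (κ₁ κ₂ : ℝ) {d T : ℝ} (hd : 0 < d) (l : ℂ)
    {t : ℝ} (ht : 0 < t) (s : ℤˣ) {R : ℕ} (hR : t * r = R) :
    Module.Finite ℂ (twistedSpinors r κ₁ κ₂ (((s : ℤ) : ℝ) * t) d T l) ∧
      Module.finrank ℂ (twistedSpinors r κ₁ κ₂ (((s : ℤ) : ℝ) * t) d T l) = Nat.card {_j : Fin R //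
        IsLadderEigenvalue (4 * Real.pi * t) (2 * Real.pi * t * T⁻¹) d l} := by
  have h : ((s : ℤ) : ℝ) * (((s : ℤ) : ℝ) * t) = t := by
    rw [← mul_assoc, ← sq, sq_intUnits, one_mul]
  have := finrank_twistedSpinors_ne_zero (T := T) hr κ₁ κ₂ (τ := ((s : ℤ) : ℝ) * t) hd l
    (sq_intUnits s) (by rwa [h]) (R := R) (by rwa [h])
  rwa [h] at this

theorem signed_injective {ι : Type*} {t : ι → ℝ} (ht : ∀ n, 0 < t n) (hti : Function.Injective t) :
    Function.Injective fun x : ι × ℤˣ => ((x.2 : ℤ) : ℝ) * t x.1 := by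
  rintro ⟨n, s⟩ ⟨n', s'⟩ h
  simp only at h
  have h1 := ht n
  have h2 := ht n'
  rcases Int.units_eq_one_or s with rfl | rfl <;> rcases Int.units_eq_one_or s' with rfl | rfl <;>
    simp at h
  · rw [hti h]
  · linarith
  · linarith
  · rw [hti h]

/-- The dimension of the Dirac eigenspaces for `δ₃ = 1`. -/
theorem finrank_heisSpinors_of_eq_one {r : ℕ} (hr : 0 < r) {d T : ℝ} (hd : 0 < d) (hT : 0 < T)
    {δ : Fin 3 → ℤˣ} (hδ : δ 2 = 1) (μ : ℂ) :
    {i : EigenIndexA r δ | (eigenvalueA d T i : ℂ) = μ}.Finite ∧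
      Module.Finite ℂ (heisSpinors r (signLog (δ 0)) (signLog (δ 1)) (signLog (δ 2)) d T
        (μ + (d ^ 2 * T / 4 : ℝ))) ∧
      Module.finrank ℂ (heisSpinors r (signLog (δ 0)) (signLog (δ 1)) (signLog (δ 2)) d T
        (μ + (d ^ 2 * T / 4 : ℝ))) = {i : EigenIndexA r δ | (eigenvalueA d T i : ℂ) = μ}.ncard := by
  set l : ℂ := μ + (d ^ 2 * T / 4 : ℝ) with hl
  let t : ℕ+ → ℝ := fun n => (n : ℕ)
  have ht : ∀ n, 0 < t n := fun n => by simp [t]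
  have hti : Function.Injective t := fun n n' h => PNat.eq (Nat.cast_injective h)
  let R : ℕ+ → ℕ := fun n => n * r
  let W : ℕ+ → ℕ := fun n => 2 * n * r
  have hfin : ∀ K, {n | t n ≤ K}.Finite := fun K => by
    obtain ⟨N, hN⟩ := exists_nat_ge K
    refine Set.Finite.of_finite_image (f := PNat.val) ((Set.finite_Iic N).subset ?_)
      PNat.coe_injective.injOn
    rintro _ ⟨n, hn, rfl⟩
    exact Nat.cast_le.1 (le_trans hn hN)
  let P : ℕ+ → Prop := fun n =>
    IsLadderEigenvalue (4 * Real.pi * t n) (2 * Real.pi * t n * T⁻¹) d l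
  obtain ⟨e1⟩ := nonempty_tail_equiv (T := T) hd ht W μ
  obtain ⟨e2⟩ := nonempty_signed_equiv P R W fun n => mul_assoc 2 (n : ℕ) r
  have : Finite {x : Σ n, Fin (W n) // P x.1} := finite_ladder_tail hT ht hfin W l
  have := finite_torus_eigenvalues hr (signLog (δ 0)) (signLog (δ 1)) hd l
  let C := Σ p : torusChars r (signLog (δ 0)) (signLog (δ 1)), {s : ℤˣ //
    ((((s : ℤ) : ℝ) * (2 * Real.pi * d * √(p.1.1 ^ 2 + p.1.2 ^ 2)) : ℝ) : ℂ) = l}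
  -- The summand `Unit` is the mode τ = 0, and the pair (n, s) is the mode τ = sn.
  let B : Unit ⊕ ℕ+ × ℤˣ → Type := Sum.elim (fun _ => C) fun x => {_j : Fin (R x.1) // P x.1}
  have he : ∀ i : EigenIndexA r δ, eigenvalueA d T i
      = Sum.elim (fun x : torusPairs r δ × ℤˣ => lamTorus d T x.1.1.1 x.1.1.2 x.2)
        (tailEigenvalue d T t W) i := by
    rintro (_ | _ | _) <;> rfl
  let e3 : {i : EigenIndexA r δ // (eigenvalueA d T i : ℂ) = μ} ≃
      {x : torusPairs r δ × ℤˣ // (lamTorus d T x.1.1.1 x.1.1.2 x.2 : ℂ) = μ} ⊕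
        {x // (tailEigenvalue d T t W x : ℂ) = μ} :=
    (Equiv.subtypeEquivRight fun i => by rw [he]).trans (Equiv.subtypeSum
      (p := fun i => ((Sum.elim (fun x : torusPairs r δ × ℤˣ => lamTorus d T x.1.1.1 x.1.1.2 x.2)
        (tailEigenvalue d T t W) i : ℝ) : ℂ) = μ))
  let e4 : {x : torusPairs r δ × ℤˣ // (lamTorus d T x.1.1.1 x.1.1.2 x.2 : ℂ) = μ} ≃ C :=
    { toFun x := ⟨⟨x.1.1.1, torusPairs_eq hr δ ▸ x.1.1.2⟩, x.1.2, lamTorus_eq_iff.1 x.2⟩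
      invFun x := ⟨(⟨x.1.1, (torusPairs_eq hr δ).symm ▸ x.1.2⟩, x.2.1), lamTorus_eq_iff.2 x.2.2⟩
      left_inv x := rfl
      right_inv x := rfl }
  let e5 : (Σ i, B i) ≃ C ⊕ (Σ x : ℕ+ × ℤˣ, {_j : Fin (R x.1) // P x.1}) :=
    (Equiv.sumSigmaDistrib B).trans (Equiv.sumCongr (Equiv.uniqueSigma _) (Equiv.refl _))
  let e : {i : EigenIndexA r δ // (eigenvalueA d T i : ℂ) = μ} ≃ Σ i, B i :=
    e3.trans ((Equiv.sumCongr e4 (e1.trans e2.symm)).trans e5.symm)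
  have : Finite (Σ i, B i) := by
    have := Finite.of_equiv _ e2.symm
    exact Finite.of_equiv _ e5.symm
  have h1 := Finite.of_equiv _ e.symm
  rw [← Nat.card_coe_set_eq]
  refine ⟨Set.finite_coe_iff.1 h1, ?_⟩
  rw [Set.coe_ofPred, Nat.card_congr e]
  refine finrank_heisSpinors (Sum.elim (fun _ => 0) fun x => ((x.2 : ℤ) : ℝ) * t x.1) ?_ ?_ ?_
  · refine Function.Injective.sumElim (fun _ _ _ => rfl) (signed_injective ht hti) ?_
    rintro _ ⟨n, s⟩ h
    rcases Int.units_eq_one_or s with rfl | rfl <;> simp [(ht n).ne, (ht n).ne'] at h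
  · intro τ
    rw [realChar_signLog, hδ]
    have : realChar τ 1 = ((1 : ℤˣ) : ℤ) ↔ ∃ n : ℤ, τ = n := by
      simpa using realChar_mul_eq_one_iff (τ := τ) (t := 1)
    rw [this]
    constructor
    · rintro ⟨n, rfl⟩
      rcases lt_trichotomy n 0 with h | rfl | h
      · refine ⟨.inr (⟨(-n).toNat, by omega⟩, -1), ?_⟩
        have : (((-n).toNat : ℤ) : ℝ) = ((-n : ℤ) : ℝ) := by rw [Int.toNat_of_nonneg (by omega)]
        simp only [Sum.elim_inr, t, PNat.mk_coe]
        push_cast at this ⊢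
        rw [this]
        ring
      · exact ⟨.inl (), by simp⟩
      · refine ⟨.inr (⟨n.toNat, by omega⟩, 1), ?_⟩
        have : ((n.toNat : ℤ) : ℝ) = (n : ℝ) := by rw [Int.toNat_of_nonneg (by omega)]
        simp only [Sum.elim_inr, t, PNat.mk_coe]
        push_cast at this ⊢
        rw [this]
        ring
    · rintro ⟨_ | ⟨n, s⟩, rfl⟩
      · exact ⟨0, by simp⟩
      · exact ⟨s * n, by simp [t]⟩
  · rintro (_ | ⟨n, s⟩)
    · exact finrank_twistedSpinors_zero hr _ _ hd T l
    · exact finrank_tail_component hr _ _ hd l (ht n) s (by simp [t, R])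

/-- The dimension of the Dirac eigenspaces for `δ₃ = -1`. -/
theorem finrank_heisSpinors_of_eq_neg_one {r : ℕ} (hr : 0 < r) (hr2 : Even r) {d T : ℝ} (hd : 0 < d)
    (hT : 0 < T) {δ : Fin 3 → ℤˣ} (hδ : δ 2 = -1) (μ : ℂ) :
    {i : EigenIndexB r | (eigenvalueB d T i : ℂ) = μ}.Finite ∧
      Module.Finite ℂ (heisSpinors r (signLog (δ 0)) (signLog (δ 1)) (signLog (δ 2)) d T
        (μ + (d ^ 2 * T / 4 : ℝ))) ∧
      Module.finrank ℂ (heisSpinors r (signLog (δ 0)) (signLog (δ 1)) (signLog (δ 2)) d T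
        (μ + (d ^ 2 * T / 4 : ℝ))) = {i : EigenIndexB r | (eigenvalueB d T i : ℂ) = μ}.ncard := by
  set l : ℂ := μ + (d ^ 2 * T / 4 : ℝ) with hl
  obtain ⟨q, hq⟩ := hr2
  let t : ℕ → ℝ := fun n => n + 1 / 2
  have ht : ∀ n, 0 < t n := fun n => by positivity
  have hti : Function.Injective t := fun n n' h => by simpa [t] using h
  -- Here r = 2q, so |τ|r = (n + 1/2)·2q = (2n + 1)q is an integer although τ is not.
  let R : ℕ → ℕ := fun n => (2 * n + 1) * q
  let W : ℕ → ℕ := fun n => (2 * n + 1) * r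
  have hfin : ∀ K, {n | t n ≤ K}.Finite := fun K => by
    obtain ⟨N, hN⟩ := exists_nat_ge K
    refine (Set.finite_Iic N).subset fun n hn => ?_
    have h : (n : ℝ) + 1 / 2 ≤ K := hn
    have : (n : ℝ) ≤ N := by linarith
    exact_mod_cast this
  let P : ℕ → Prop := fun n =>
    IsLadderEigenvalue (4 * Real.pi * t n) (2 * Real.pi * t n * T⁻¹) d l
  obtain ⟨e1⟩ := nonempty_tail_equiv (T := T) hd ht W μ
  obtain ⟨e2⟩ := nonempty_signed_equiv P R W fun n => by simp only [W, R, hq]; ring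
  have : Finite {x : Σ n, Fin (W n) // P x.1} := finite_ladder_tail hT ht hfin W l
  have he : ∀ i : EigenIndexB r, eigenvalueB d T i = tailEigenvalue d T t W i := by
    rintro (_ | _) <;> rfl
  let e3 : {i : EigenIndexB r // (eigenvalueB d T i : ℂ) = μ} ≃
      {x // (tailEigenvalue d T t W x : ℂ) = μ} := Equiv.subtypeEquivRight fun i => by rw [he]
  let e := e3.trans (e1.trans e2.symm)
  have := Finite.of_equiv _ e2.symm
  have h1 := Finite.of_equiv _ e.symm
  rw [← Nat.card_coe_set_eq]
  refine ⟨Set.finite_coe_iff.1 h1, ?_⟩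
  rw [Set.coe_ofPred, Nat.card_congr e]
  refine finrank_heisSpinors (fun x : ℕ × ℤˣ => ((x.2 : ℤ) : ℝ) * t x.1) (signed_injective ht hti)
    ?_ ?_
  · intro τ
    have h : signLog (δ 2) = 1 / 2 := by rw [signLog, hδ, if_neg (by decide)]
    rw [h, realChar_one_eq_iff]
    constructor
    · rintro ⟨n, rfl⟩
      rcases lt_or_ge n 0 with h | h
      -- For n < 0 one has 1/2 + n = -((-n - 1) + 1/2).
      · refine ⟨((-n - 1).toNat, -1), ?_⟩
        have : (((-n - 1).toNat : ℤ) : ℝ) = ((-n - 1 : ℤ) : ℝ) := by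
          rw [Int.toNat_of_nonneg (by omega)]
        simp only [t]
        push_cast at this ⊢
        rw [this]
        ring
      · refine ⟨(n.toNat, 1), ?_⟩
        have : ((n.toNat : ℤ) : ℝ) = (n : ℝ) := by rw [Int.toNat_of_nonneg (by omega)]
        simp only [t]
        push_cast at this ⊢
        rw [this]
        ring
    · rintro ⟨⟨n, s⟩, rfl⟩
      rcases Int.units_eq_one_or s with rfl | rfl
      · exact ⟨n, by simp [t]; ring⟩
      · exact ⟨-n - 1, by simp [t]; ring⟩
  · rintro ⟨n, s⟩
    refine finrank_tail_component hr _ _ hd l (ht n) s ?_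
    simp only [t, R, hq]
    push_cast
    ring

/-! ### Topology of the Heisenberg group -/

namespace Heis

/-- The global chart as a homeomorphism. -/
def coordsHomeo : Heis ≃ₜ ℝ × ℝ × ℝ where
  toFun := coords
  invFun := ofCoords
  left_inv _ := rfl
  right_inv _ := rfl
  continuous_toFun := continuous_induced_dom
  continuous_invFun := continuous_induced_rng.2 continuous_id

theorem continuous_coords : Continuous coords := coordsHomeo.continuous

theorem continuous_ofCoords : Continuous ofCoords := coordsHomeo.symm.continuous

theorem continuous_iff {X : Type*} [TopologicalSpace X] {f : X → Heis} :
    Continuous f ↔ Continuous fun x => (f x).coords := continuous_induced_rng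

theorem continuous_x : Continuous Heis.x := continuous_fst.comp continuous_coords

theorem continuous_y : Continuous Heis.y := continuous_fst.comp (continuous_snd.comp continuous_coords)

theorem continuous_z : Continuous Heis.z := continuous_snd.comp (continuous_snd.comp continuous_coords)

instance : ContractibleSpace Heis := coordsHomeo.contractibleSpace

instance : LocallyPathConnectedSpace Heis := coordsHomeo.isOpenEmbedding.locallyPathConnectedSpace

theorem continuous_const_mul (g : Heis) : Continuous fun h : Heis => g * h := by
  rw [continuous_iff]
  have := continuous_x
  have := continuous_y
  have := continuous_z
  simp only [coords, mul_x, mul_y, mul_z]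
  fun_prop

end Heis

namespace heisLattice

variable {r : ℕ}

instance : ContinuousConstSMul (heisLattice r) Heis := ⟨fun γ => Heis.continuous_const_mul γ.1⟩

/-- The generator `g(r, 0, 0)`. -/
def genX (r : ℕ) : heisLattice r := ⟨⟨r, 0, 0⟩, 1, 0, 0, by simp⟩

/-- The generator `g(0, 1, 0)`. -/
def genY (r : ℕ) : heisLattice r := ⟨⟨0, 1, 0⟩, 0, 1, 0, by simp⟩

/-- The generator `g(0, 0, 1)`. -/
def genZ (r : ℕ) : heisLattice r := ⟨⟨0, 0, 1⟩, 0, 0, 1, by simp⟩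

theorem coe_genX_zpow (n : ℤ) : ((genX r ^ n : heisLattice r) : Heis) = ⟨r * n, 0, 0⟩ := by
  induction n using Int.induction_on with
  | zero => ext <;> simp
  | succ n ih =>
    rw [zpow_add_one, Subgroup.coe_mul, ih]
    ext <;> simp [genX]
    ring
  | pred n ih =>
    rw [zpow_sub_one, Subgroup.coe_mul, ih]
    ext <;> simp [genX]
    ring

theorem coe_genY_zpow (n : ℤ) : ((genY r ^ n : heisLattice r) : Heis) = ⟨0, n, 0⟩ := by
  induction n using Int.induction_on with
  | zero => ext <;> simp
  | succ n ih =>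
    rw [zpow_add_one, Subgroup.coe_mul, ih]
    ext <;> simp [genY]
  | pred n ih =>
    rw [zpow_sub_one, Subgroup.coe_mul, ih]
    ext <;> simp [genY]
    ring

theorem coe_genZ_zpow (n : ℤ) : ((genZ r ^ n : heisLattice r) : Heis) = ⟨0, 0, n⟩ := by
  induction n using Int.induction_on with
  | zero => ext <;> simp
  | succ n ih =>
    rw [zpow_add_one, Subgroup.coe_mul, ih]
    ext <;> simp [genZ]
  | pred n ih =>
    rw [zpow_sub_one, Subgroup.coe_mul, ih]
    ext <;> simp [genZ]
    ring

theorem eq_top_of_gen_mem {K : Subgroup (heisLattice r)} (hx : genX r ∈ K) (hy : genY r ∈ K)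
    (hz : genZ r ∈ K) : K = ⊤ := by
  refine (Subgroup.eq_top_iff' K).2 ?_
  rintro ⟨_, a, b, c, rfl⟩
  -- With the y-generator on the left, the term xy' of the multiplication vanishes and z needs no
  -- correction.
  have : (⟨⟨r * a, b, c⟩, a, b, c, rfl⟩ : heisLattice r) = genY r ^ b * genX r ^ a * genZ r ^ c := by
    refine Subtype.ext ?_
    rw [Subgroup.coe_mul, Subgroup.coe_mul, coe_genX_zpow, coe_genY_zpow, coe_genZ_zpow]
    ext <;> simp
  rw [this]
  exact K.mul_mem (K.mul_mem (K.zpow_mem hy b) (K.zpow_mem hx a)) (K.zpow_mem hz c)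

theorem hom_ext {M : Type*} [Group M] {ε ε' : heisLattice r →* M} (hx : ε (genX r) = ε' (genX r))
    (hy : ε (genY r) = ε' (genY r)) (hz : ε (genZ r) = ε' (genZ r)) : ε = ε' :=
  MonoidHom.eq_of_eqOn_top (by
    rw [← eq_top_of_gen_mem (K := ε.eqLocus ε') hx hy hz]
    exact fun _ h => h)

/-- In the abelian group {±1} this relation becomes ε(genZ)^r = 1, the origin of the parity
condition. -/
theorem genX_mul_genY : genX r * genY r = genY r * genX r * genZ r ^ r := by
  refine Subtype.ext ?_
  rw [← zpow_natCast, Subgroup.coe_mul, Subgroup.coe_mul, Subgroup.coe_mul, coe_genZ_zpow]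
  ext <;> simp [genX, genY]

theorem even_of_hom_genZ {ε : heisLattice r →* ℤˣ} (h : ε (genZ r) = -1) : Even r := by
  have h1 := congrArg ε (genX_mul_genY (r := r))
  rw [map_mul, map_mul, map_mul, map_pow, h, mul_comm (ε (genX r)), left_eq_mul] at h1
  by_contra hr
  rw [(Nat.not_even_iff_odd.1 hr).neg_one_pow] at h1
  exact absurd h1 (by decide)

end heisLattice

section HeisProj

variable {r : ℕ}

theorem continuous_heisProj : Continuous (heisProj r) := continuous_quot_mk

theorem isOpenMap_heisProj : IsOpenMap (heisProj r) :=
  (MulAction.isOpenQuotientMap_quotientMk (Γ := heisLattice r) (T := Heis)).isOpenMap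

theorem surjective_heisProj : Function.Surjective (heisProj r) := Quot.mk_surjective

theorem heisProj_eq_iff {g h : Heis} :
    heisProj r g = heisProj r h ↔ ∃ γ : heisLattice r, (γ : Heis) * h = g := Quotient.eq

theorem heisProj_mul (γ : heisLattice r) (g : Heis) : heisProj r ((γ : Heis) * g) = heisProj r g :=
  heisProj_eq_iff.2 ⟨γ, rfl⟩

end HeisProj

/-! ### The spin group -/

theorem coe_spinSign (u : ℤˣ) :
    (spinSign u : Matrix (Fin 2) (Fin 2) ℂ) = ((u : ℤ) : ℂ) • (1 : Matrix (Fin 2) (Fin 2) ℂ) := rfl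

theorem spinSign_one : spinSign 1 = 1 := Subtype.ext (by simp [coe_spinSign])

theorem spinSign_mul (u v : ℤˣ) : spinSign (u * v) = spinSign u * spinSign v :=
  Subtype.ext (by simp [coe_spinSign, smul_smul, mul_comm])

theorem spinSign_injective : Function.Injective spinSign := fun u v h => by
  have h1 := congrFun (congrFun (congrArg Subtype.val h) 0) 0
  simp only [coe_spinSign, Matrix.smul_apply, Matrix.one_apply_eq, smul_eq_mul, mul_one] at h1
  exact Units.ext (by exact_mod_cast h1)

theorem spinSign_comm (u : ℤˣ) (A : Spin3) : spinSign u * A = A * spinSign u :=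
  Subtype.ext (by simp [coe_spinSign])

theorem spinSign_inv (u : ℤˣ) : (spinSign u)⁻¹ = spinSign u :=
  inv_eq_of_mul_eq_one_right (by rw [← spinSign_mul, Int.units_mul_self, spinSign_one])

theorem spinCover_spinSign (u : ℤˣ) : spinCover (spinSign u) = 1 := by
  have h : ∀ i j : Fin 3,
      -(Matrix.trace (cliffordGamma i * cliffordGamma j)).re / 2 = (1 : Matrix _ _ ℝ) i j := by
    intro i j
    fin_cases i <;> fin_cases j <;> simp [cliffordGamma, Matrix.trace]
  have hu : ((u : ℤ) : ℂ) * ((u : ℤ) : ℂ) = 1 := by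
    rcases Int.units_eq_one_or u with rfl | rfl <;> simp
  ext i j
  rw [← h, spinCover, Matrix.of_apply, coe_spinSign]
  simp only [Matrix.conjTranspose_smul, Matrix.conjTranspose_one, Matrix.mul_smul, Matrix.smul_mul,
    mul_one, smul_smul, star_intCast, hu, one_smul]

/-- The frame `(e₁, e₂, e₃)` as an oriented orthonormal basis. -/
def stdFrame {d T : ℝ} (hd : 0 < d) (hT : 0 < T) : OrthFrame d T :=
  ⟨HeisAlg.frame d T, HeisAlg.metric_frame hd hT, by
    have : (Matrix.of (HeisAlg.frame d T)).det ≠ 0 := by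
      simp [Matrix.det_fin_three, HeisAlg.frame, hd.ne', hT.ne']
    exact mul_self_pos.2 this⟩

/-! ### Global lifts of the frame -/

namespace SpinStructure

variable {r : ℕ} {d T : ℝ} (S : SpinStructure r d T)

/-- The Spin(3)-component of a local trivialisation, extended by 1: an equivariant coordinate on P,
injective on fibres. The later uses of local triviality go through it. -/
theorem exists_localSection (m : HeisManifold r) : ∃ U : Set (HeisManifold r), IsOpen U ∧ m ∈ U ∧
    ∃ c : S.P → Spin3, ContinuousOn c {p | (S.φ p).1 ∈ U} ∧
      (∀ p A, (S.φ p).1 ∈ U → c (S.act p A) = c p * A) ∧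
      ∀ p p', (S.φ p).1 ∈ U → (S.φ p').1 = (S.φ p).1 → c p = c p' → p = p' := by
  classical
  obtain ⟨U, hU, hm, e, he1, he2⟩ := S.locally_trivial m
  refine ⟨U, hU, hm, fun p => if h : (S.φ p).1 ∈ U then (e ⟨p, h⟩).2 else 1, ?_, ?_, ?_⟩
  · rw [continuousOn_iff_continuous_domRestrict]
    refine (continuous_snd.comp e.continuous).congr fun p => ?_
    have hp : (S.φ p.1).1 ∈ U := p.2
    simp only [Function.comp_apply, Set.domRestrict_apply, dif_pos hp]
  · intro p A hp
    have hp' : (S.φ (S.act p A)).1 ∈ U := by rwa [S.proj_act]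
    simp only [dif_pos hp, dif_pos hp']
    exact he2 ⟨p, hp⟩ ⟨_, hp'⟩ A rfl
  · intro p p' hp hpp h
    have hp' : (S.φ p').1 ∈ U := by rwa [hpp]
    simp only [dif_pos hp, dif_pos hp'] at h
    have : e ⟨p, hp⟩ = e ⟨p', hp'⟩ := by
      refine Prod.ext (Subtype.ext ?_) h
      rw [he1, he1]
      exact hpp.symm
    exact congrArg Subtype.val (e.injective this)

theorem act_injective (p : S.P) : Function.Injective (S.act p) := by
  intro A B h
  obtain ⟨U, -, hm, c, -, hc, -⟩ := S.exists_localSection (S.φ p).1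
  have := congrArg c h
  rw [hc p A hm, hc p B hm] at this
  exact mul_left_cancel this

theorem exists_act_eq {p p' : S.P} (h : (S.φ p').1 = (S.φ p).1) : ∃ A, S.act p A = p' := by
  obtain ⟨U, -, hm, c, -, hc, hi⟩ := S.exists_localSection (S.φ p).1
  refine ⟨(c p)⁻¹ * c p', hi _ _ (by rwa [S.proj_act]) (by rw [S.proj_act, h]) ?_⟩
  rw [hc p _ hm, mul_inv_cancel_left]

theorem φ_act_spinSign (p : S.P) (u : ℤˣ) : S.φ (S.act p (spinSign u)) = S.φ p := by
  refine Prod.ext (S.proj_act _ _) (Subtype.ext (funext fun j => ?_))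
  rw [S.frame_act, spinCover_spinSign]
  simp [Matrix.one_apply]

/-- The points p and p·(-1) are distinct and lie in the same fibre, which has only two elements. -/
theorem exists_spinSign {p p' : S.P} (h : S.φ p' = S.φ p) : ∃ u, p' = S.act p (spinSign u) := by
  have h2 := S.twofold (S.φ p)
  have hsub : ({p, S.act p (spinSign (-1))} : Set S.P) ⊆ S.φ ⁻¹' {S.φ p} := by
    rintro _ (rfl | rfl)
    · rfl
    · exact S.φ_act_spinSign _ _
  have hne : p ≠ S.act p (spinSign (-1)) := fun h => by
    have h3 := S.act_injective p ((S.act_one p).trans h)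
    rw [← spinSign_one] at h3
    exact absurd (spinSign_injective h3) (by decide)
  have hfin : (S.φ ⁻¹' {S.φ p}).Finite := Set.finite_of_ncard_ne_zero (by rw [h2]; decide)
  have heq := Set.eq_of_subset_of_ncard_le hsub (by rw [h2, Set.ncard_pair hne]) hfin
  have : p' ∈ S.φ ⁻¹' {S.φ p} := h
  rw [← heq] at this
  rcases this with rfl | h
  · exact ⟨1, by rw [spinSign_one, S.act_one]⟩
  · exact ⟨-1, h⟩

theorem continuous_act_const (A : Spin3) : Continuous fun p => S.act p A :=
  S.continuous_act.comp (Continuous.prodMk_left A)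

variable {S}

theorem isLift_univ_iff {s : Heis → S.P} : S.IsLift Set.univ s ↔ Continuous s ∧
    ∀ g, (S.φ (s g)).1 = heisProj r g ∧ (S.φ (s g)).2.1 = HeisAlg.frame d T := by
  simp [IsLift, continuousOn_univ]

theorem IsLift.φ_eq {U U' : Set Heis} {q q' : Heis → S.P} (hq : S.IsLift U q) (hq' : S.IsLift U' q')
    {g g' : Heis} (hg : g ∈ U) (hg' : g' ∈ U') (h : heisProj r g = heisProj r g') :
    S.φ (q g) = S.φ (q' g') := by
  obtain ⟨h1, h2⟩ := hq.2.2 g hg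
  obtain ⟨h3, h4⟩ := hq'.2.2 g' hg'
  exact Prod.ext (by rw [h1, h3, h]) (Subtype.ext (by rw [h2, h4]))

/-- The frame defines a continuous map from G to the frame bundle, which lifts because G is
contractible and locally path connected. -/
theorem exists_isLift (S : SpinStructure r d T) (hd : 0 < d) (hT : 0 < T) :
    ∃ s, S.IsLift Set.univ s := by
  let F : C(Heis, FrameBundle r d T) :=
    ⟨fun g => (heisProj r g, stdFrame hd hT), continuous_heisProj.prodMk continuous_const⟩
  have hne : (S.φ ⁻¹' {F 1}).Nonempty :=
    Set.nonempty_of_ncard_ne_zero (by rw [S.twofold]; decide)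
  obtain ⟨p, hp⟩ := hne
  obtain ⟨s, ⟨-, hs⟩, -⟩ := S.isCoveringMap.existsUnique_continuousMap_lifts F 1 p hp
  refine ⟨s, isLift_univ_iff.2 ⟨s.continuous, fun g => ?_⟩⟩
  have : S.φ (s g) = F g := congrFun hs g
  exact ⟨congrArg Prod.fst this, congrArg (fun x => x.2.1) this⟩

/-- Lifts through a covering that agree at one point of a connected space agree everywhere; the sign
is read off at 1. -/
theorem IsLift.exists_eq_act {s s' : Heis → S.P} (hs : S.IsLift Set.univ s) (hc : Continuous s')
    (h : ∀ g, S.φ (s' g) = S.φ (s g)) : ∃ u, ∀ g, s' g = S.act (s g) (spinSign u) := by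
  obtain ⟨u, hu⟩ := S.exists_spinSign (h 1)
  refine ⟨u, congrFun (S.isCoveringMap.eq_of_comp_eq hc
    ((S.continuous_act_const _).comp (isLift_univ_iff.1 hs).1) (funext fun g => ?_) 1 hu)⟩
  rw [Function.comp_apply, Function.comp_apply, S.φ_act_spinSign, h]

/-- The frame is left invariant, so g ↦ s(γg) lifts the same map as s and differs from it by a sign.
Composing two translations shows multiplicativity. -/
theorem IsLift.exists_hom {s : Heis → S.P} (hs : S.IsLift Set.univ s) :
    ∃ ε : heisLattice r →* ℤˣ, ∀ (γ : heisLattice r) (g : Heis),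
      s ((γ : Heis) * g) = S.act (s g) (spinSign (ε γ)) := by
  have h : ∀ γ : heisLattice r, ∃ u, ∀ g, s ((γ : Heis) * g) = S.act (s g) (spinSign u) := fun γ =>
    hs.exists_eq_act ((isLift_univ_iff.1 hs).1.comp (Heis.continuous_const_mul γ.1))
      fun g => hs.φ_eq hs trivial trivial (heisProj_mul γ g)
  choose ε hε using h
  refine ⟨MonoidHom.mk' ε fun γ γ' => ?_, hε⟩
  refine spinSign_injective (S.act_injective (s 1) ?_)
  rw [← hε, Subgroup.coe_mul, mul_assoc, hε, hε, ← S.act_mul, mul_comm (ε γ), spinSign_mul]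

theorem exists_hasHom (S : SpinStructure r d T) (hd : 0 < d) (hT : 0 < T) : ∃ ε, S.HasHom ε := by
  obtain ⟨s, hs⟩ := S.exists_isLift hd hT
  obtain ⟨ε, hε⟩ := hs.exists_hom
  exact ⟨ε, s, hs, hε⟩

/-- Another lift differs by a sign, which is central in Spin(3) and therefore does not affect ε. -/
theorem HasHom.unique {ε ε' : heisLattice r →* ℤˣ} (h : S.HasHom ε) (h' : S.HasHom ε') : ε = ε' := by
  obtain ⟨s, hs, hε⟩ := h
  obtain ⟨s', hs', hε'⟩ := h'
  obtain ⟨u, hu⟩ := hs.exists_eq_act (isLift_univ_iff.1 hs').1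
    fun g => hs'.φ_eq hs trivial trivial rfl
  ext1 γ
  refine spinSign_injective (S.act_injective (s' 1) ?_)
  rw [← hε', hu (_ * 1), hε, hu 1, ← S.act_mul, ← S.act_mul, spinSign_comm]

theorem hasTriple_iff {δ : Fin 3 → ℤˣ} : S.HasTriple δ ↔ ∃ ε, S.HasHom ε ∧
    ε (heisLattice.genX r) = δ 0 ∧ ε (heisLattice.genY r) = δ 1 ∧ ε (heisLattice.genZ r) = δ 2 :=
  Iff.rfl

theorem existsUnique_hasTriple (S : SpinStructure r d T) (hd : 0 < d) (hT : 0 < T) :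
    ∃! δ : Fin 3 → ℤˣ, S.HasTriple δ := by
  obtain ⟨ε, hε⟩ := S.exists_hasHom hd hT
  refine ⟨![ε (heisLattice.genX r), ε (heisLattice.genY r), ε (heisLattice.genZ r)],
    hasTriple_iff.2 ⟨ε, hε, rfl, rfl, rfl⟩, fun δ hδ => ?_⟩
  obtain ⟨ε', hε', h0, h1, h2⟩ := hasTriple_iff.1 hδ
  rw [hε'.unique hε] at h0 h1 h2
  ext i
  fin_cases i
  · exact congrArg _ h0.symm
  · exact congrArg _ h1.symm
  · exact congrArg _ h2.symm

theorem HasTriple.even {δ : Fin 3 → ℤˣ} (h : S.HasTriple δ) (hδ : δ 2 = -1) : Even r := by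
  obtain ⟨ε, -, -, -, h2⟩ := hasTriple_iff.1 h
  exact heisLattice.even_of_hom_genZ (h2.trans hδ)

end SpinStructure

theorem coe_spin3_inv (A : Spin3) :
    ((A⁻¹ : Spin3) : Matrix (Fin 2) (Fin 2) ℂ) = (A : Matrix (Fin 2) (Fin 2) ℂ)ᴴ := rfl

instance : ContinuousInv Spin3 :=
  ⟨continuous_induced_rng.2 continuous_subtype_val.matrix_conjTranspose⟩

namespace SpinStructure

open Topology

variable {r : ℕ} {d T : ℝ} {S S' : SpinStructure r d T}

/-! ### Equivalence of spin structures -/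

/-- The map `G × Spin(3) → P` given by a lift of the frame. -/
def ofLift (S : SpinStructure r d T) (s : Heis → S.P) (x : Heis × Spin3) : S.P := S.act (s x.1) x.2

theorem ofLift_act (s : Heis → S.P) (g : Heis) (A B : Spin3) :
    S.act (S.ofLift s (g, A)) B = S.ofLift s (g, A * B) := (S.act_mul _ _ _).symm

theorem IsLift.continuous_ofLift {s : Heis → S.P} (hs : S.IsLift Set.univ s) :
    Continuous (S.ofLift s) :=
  S.continuous_act.comp
    (((isLift_univ_iff.1 hs).1.comp continuous_fst).prodMk continuous_snd)

theorem IsLift.fst_φ_ofLift {s : Heis → S.P} (hs : S.IsLift Set.univ s) (x : Heis × Spin3) :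
    (S.φ (S.ofLift s x)).1 = heisProj r x.1 := by
  rw [ofLift, S.proj_act, (hs.2.2 x.1 trivial).1]

theorem IsLift.surjective_ofLift {s : Heis → S.P} (hs : S.IsLift Set.univ s) :
    Function.Surjective (S.ofLift s) := by
  intro p
  obtain ⟨g, hg⟩ := surjective_heisProj (S.φ p).1
  obtain ⟨A, hA⟩ := S.exists_act_eq (p := s g) (p' := p) (by rw [(hs.2.2 g trivial).1, hg])
  exact ⟨(g, A), hA⟩

/-- A point p near s(g₀)A₀ equals s(g)A, where g near g₀ lies over the base point of p, as
`heisProj` is open, and A = c(s g)⁻¹ c(p) depends continuously on (g, p). Openness shows that P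
carries the quotient topology of G × Spin(3). -/
theorem IsLift.isOpenMap_ofLift {s : Heis → S.P} (hs : S.IsLift Set.univ s) :
    IsOpenMap (S.ofLift s) := by
  rw [isOpenMap_iff_nhds_le]
  rintro ⟨g₀, A₀⟩ O hO
  obtain ⟨U, hU, hm, c, hc, hca, hci⟩ := S.exists_localSection (heisProj r g₀)
  have hcont : Continuous fun p => (S.φ p).1 := S.isCoveringMap.continuous.fst
  have hUo : IsOpen {p | (S.φ p).1 ∈ U} := hU.preimage hcont
  have hp₀ : (S.φ (S.ofLift s (g₀, A₀))).1 ∈ U := by rwa [hs.fst_φ_ofLift]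
  have hs₀ : (S.φ (s g₀)).1 ∈ U := by rwa [(hs.2.2 g₀ trivial).1]
  have h1 : Filter.Tendsto (fun x : Heis × S.P => (x.1, (c (s x.1))⁻¹ * c x.2))
      (𝓝 (g₀, S.ofLift s (g₀, A₀))) (𝓝 (g₀, A₀)) := by
    have h2 : ContinuousAt (fun x : Heis × S.P => (x.1, (c (s x.1))⁻¹ * c x.2))
        (g₀, S.ofLift s (g₀, A₀)) := by
      refine continuousAt_fst.prodMk (ContinuousAt.mul (ContinuousAt.inv ?_) ?_)
      · refine ContinuousAt.comp (f := fun x : Heis × S.P => s x.1) (g := c)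
          (x := (g₀, S.ofLift s (g₀, A₀))) (hc.continuousAt (hUo.mem_nhds hs₀)) ?_
        exact ((isLift_univ_iff.1 hs).1.comp continuous_fst).continuousAt
      · exact ContinuousAt.comp (f := fun x : Heis × S.P => x.2) (g := c)
          (x := (g₀, S.ofLift s (g₀, A₀))) (hc.continuousAt (hUo.mem_nhds hp₀)) continuousAt_snd
    have h3 : (c (s g₀))⁻¹ * c (S.ofLift s (g₀, A₀)) = A₀ := by
      rw [ofLift, hca _ _ hs₀, inv_mul_cancel_left]
    rw [ContinuousAt, h3] at h2
    exact h2
  have h2 := h1 (Filter.mem_map.1 hO)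
  rw [Filter.mem_map, nhds_prod_eq, Filter.mem_prod_iff] at h2
  obtain ⟨N, hN, Q, hQ, hNQ⟩ := h2
  have hN' : heisProj r '' N ∈ 𝓝 (S.φ (S.ofLift s (g₀, A₀))).1 := by
    rw [hs.fst_φ_ofLift]
    exact isOpenMap_heisProj.image_mem_nhds hN
  filter_upwards [hQ, hcont.continuousAt hN', hUo.mem_nhds hp₀] with p hp1 hp2 hp3
  obtain ⟨g, hg, hgp⟩ := hp2
  have h4 : (S.φ (s g)).1 = (S.φ p).1 := by rw [(hs.2.2 g trivial).1, hgp]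
  have hpU : (S.φ p).1 ∈ U := hp3
  have hgU : (S.φ (s g)).1 ∈ U := by rwa [h4]
  have h5 : S.ofLift s (g, (c (s g))⁻¹ * c p) = p := by
    refine hci _ _ ?_ ?_ ?_
    · rwa [hs.fst_φ_ofLift, ← (hs.2.2 g trivial).1]
    · rw [hs.fst_φ_ofLift, ← (hs.2.2 g trivial).1, h4]
    · rw [ofLift, hca _ _ hgU, mul_inv_cancel_left]
  have h6 : (g, p) ∈ N ×ˢ Q := ⟨hg, hp1⟩
  have h7 := hNQ h6
  rw [← h5]
  exact h7

theorem IsLift.isQuotientMap_ofLift {s : Heis → S.P} (hs : S.IsLift Set.univ s) :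
    IsQuotientMap (S.ofLift s) :=
  hs.isOpenMap_ofLift.isQuotientMap hs.continuous_ofLift hs.surjective_ofLift

/-- The fibres of G × Spin(3) → P are the lattice orbits of the action twisted by ε, so they depend
on ε alone. -/
theorem IsLift.ofLift_eq_iff {s : Heis → S.P} (hs : S.IsLift Set.univ s) {ε : heisLattice r →* ℤˣ}
    (hε : ∀ (γ : heisLattice r) (g : Heis), s ((γ : Heis) * g) = S.act (s g) (spinSign (ε γ)))
    {g g' : Heis} {A A' : Spin3} : S.ofLift s (g, A) = S.ofLift s (g', A') ↔
      ∃ γ : heisLattice r, (γ : Heis) * g' = g ∧ A' = spinSign (ε γ) * A := by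
  constructor
  · intro h
    have h1 := congrArg (fun p => (S.φ p).1) h
    simp only [hs.fst_φ_ofLift] at h1
    obtain ⟨γ, rfl⟩ := heisProj_eq_iff.1 h1
    refine ⟨γ, rfl, S.act_injective (s g') ?_⟩
    rw [ofLift, hε, ← S.act_mul] at h
    exact h.symm
  · rintro ⟨γ, rfl, rfl⟩
    rw [ofLift, ofLift, hε, S.act_mul]

/-- Both total spaces are quotients of G × Spin(3) with the same fibres, so the identity of G ×
Spin(3) descends to a homeomorphism. -/
theorem HasHom.equivalent {ε : heisLattice r →* ℤˣ} (h : S.HasHom ε) (h' : S'.HasHom ε) :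
    S.Equivalent S' := by
  obtain ⟨s, hs, hε⟩ := h
  obtain ⟨s', hs', hε'⟩ := h'
  have key : ∀ x y, S.ofLift s x = S.ofLift s y ↔ S'.ofLift s' x = S'.ofLift s' y := by
    rintro ⟨g, A⟩ ⟨g', A'⟩
    rw [hs.ofLift_eq_iff hε, hs'.ofLift_eq_iff hε']
  let f : S.P → S'.P := fun p => S'.ofLift s' (Function.surjInv hs.surjective_ofLift p)
  let f' : S'.P → S.P := fun p => S.ofLift s (Function.surjInv hs'.surjective_ofLift p)
  have hf : ∀ x, f (S.ofLift s x) = S'.ofLift s' x := fun x =>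
    (key _ _).1 (Function.surjInv_eq _ _)
  have hf' : ∀ x, f' (S'.ofLift s' x) = S.ofLift s x := fun x =>
    (key _ _).2 (Function.surjInv_eq _ _)
  refine ⟨⟨⟨f, f', fun p => ?_, fun p => ?_⟩, ?_, ?_⟩, fun p B => ?_, fun p => ?_⟩
  · obtain ⟨x, rfl⟩ := hs.surjective_ofLift p
    rw [hf, hf']
  · obtain ⟨x, rfl⟩ := hs'.surjective_ofLift p
    rw [hf', hf]
  · exact hs.isQuotientMap_ofLift.continuous_iff.2 (hs'.continuous_ofLift.congr fun x => (hf x).symm)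
  · exact hs'.isQuotientMap_ofLift.continuous_iff.2 (hs.continuous_ofLift.congr fun x => (hf' x).symm)
  · obtain ⟨⟨g, A⟩, rfl⟩ := hs.surjective_ofLift p
    change f _ = S'.act (f _) B
    rw [ofLift_act, hf, hf, ofLift_act]
  · obtain ⟨⟨g, A⟩, rfl⟩ := hs.surjective_ofLift p
    change S'.φ (f _) = _
    rw [hf]
    refine Prod.ext ?_ (Subtype.ext (funext fun j => ?_))
    · rw [hs.fst_φ_ofLift, hs'.fst_φ_ofLift]
    · rw [ofLift, ofLift, S.frame_act, S'.frame_act, (hs.2.2 g trivial).2, (hs'.2.2 g trivial).2]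

theorem Equivalent.hasHom {ε : heisLattice r →* ℤˣ} (h : S.Equivalent S') (hS : S.HasHom ε) :
    S'.HasHom ε := by
  obtain ⟨f, hf, hφ⟩ := h
  obtain ⟨s, hs, hε⟩ := hS
  refine ⟨f ∘ s, isLift_univ_iff.2 ⟨f.continuous.comp (isLift_univ_iff.1 hs).1, fun g => ?_⟩,
    fun γ g => ?_⟩
  · rw [Function.comp_apply, hφ]
    exact hs.2.2 g trivial
  · rw [Function.comp_apply, hε, hf, Function.comp_apply]

theorem HasTriple.equivalent_iff {δ δ' : Fin 3 → ℤˣ} (h : S.HasTriple δ) (h' : S'.HasTriple δ') :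
    S.Equivalent S' ↔ δ = δ' := by
  obtain ⟨ε, hε, h0, h1, h2⟩ := hasTriple_iff.1 h
  obtain ⟨ε', hε', h0', h1', h2'⟩ := hasTriple_iff.1 h'
  constructor
  · intro hS
    have := (hS.hasHom hε).unique hε'
    subst this
    ext i
    fin_cases i
    · exact congrArg _ (h0.symm.trans h0')
    · exact congrArg _ (h1.symm.trans h1')
    · exact congrArg _ (h2.symm.trans h2')
  · rintro rfl
    have : ε = ε' :=
      heisLattice.hom_ext (h0.trans h0'.symm) (h1.trans h1'.symm) (h2.trans h2'.symm)
    subst this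
    exact hε.equivalent hε'

/-! ### The Dirac operator in coordinates -/

/-- After a sign is adjusted at g, both lifts have the same image in the frame bundle, and the
covering is locally injective. This reduces smoothness and the Dirac equation from arbitrary local
lifts to one global lift. -/
theorem IsLift.eventually_eq {s : Heis → S.P} (hs : S.IsLift Set.univ s) {U : Set Heis}
    {q : Heis → S.P} (hq : S.IsLift U q) {g : Heis} (hg : g ∈ U) :
    ∃ u, ∀ᶠ h in 𝓝 g, q h = S.act (s h) (spinSign u) := by
  obtain ⟨u, hu⟩ := S.exists_spinSign (hq.φ_eq hs hg trivial rfl)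
  refine ⟨u, ?_⟩
  obtain ⟨O, hO, hgO, hi⟩ := S.isCoveringMap.isLocalHomeomorph.isLocallyInjective (q g)
  have hgO' : S.act (s g) (spinSign u) ∈ O := hu ▸ hgO
  have hq' : ContinuousAt q g := hq.2.1.continuousAt (hq.1.mem_nhds hg)
  have hs' : ContinuousAt (fun h => S.act (s h) (spinSign u)) g :=
    ((S.continuous_act_const _).comp (isLift_univ_iff.1 hs).1).continuousAt
  filter_upwards [hq' (hO.mem_nhds hgO), hs' (hO.mem_nhds hgO'), hq.1.mem_nhds hg]
    with h h1 h2 h3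
  exact hi h1 h2 (by rw [S.φ_act_spinSign, hq.φ_eq hs h3 trivial rfl])

end SpinStructure

open Topology in
theorem leftDeriv_congr {σ σ' : Heis → Spinor3} {g : Heis} (h : σ =ᶠ[𝓝 g] σ') (v : HeisAlg) :
    leftDeriv v σ g = leftDeriv v σ' g := by
  have hc : Continuous fun t : ℝ => g * HeisAlg.exp (t • v) := by
    rw [Heis.continuous_iff]
    simp only [Heis.coords, HeisAlg.exp, Heis.mul_x, Heis.mul_y, Heis.mul_z, Pi.smul_apply,
      smul_eq_mul]
    fun_prop
  have h0 : g * HeisAlg.exp ((0 : ℝ) • v) = g := by ext <;> simp [HeisAlg.exp]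
  refine Filter.EventuallyEq.deriv_eq ?_
  have := hc.tendsto 0
  rw [h0] at this
  exact this.eventually h

open Topology in
theorem diracG_congr {d T : ℝ} {σ σ' : Heis → Spinor3} {g : Heis} (h : σ =ᶠ[𝓝 g] σ') :
    diracG d T σ g = diracG d T σ' g := by
  simp only [diracG, spinConnection, leftDeriv_congr h, h.eq_of_nhds]

theorem leftDeriv_apply {σ : Heis → Spinor3} (hσ : ContDiff ℝ ∞ fun x => σ (Heis.ofCoords x))
    (v : HeisAlg) (g : Heis) (i : Fin 2) : leftDeriv v σ g i
      = fderiv ℝ (fun x => σ (Heis.ofCoords x) i) g.coords (v 0, v 1, v 2 + g.x * v 1) := by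
  have hl : HasDerivAt (fun t : ℝ => (g * HeisAlg.exp (t • v)).coords)
      (v 0, v 1, v 2 + g.x * v 1) 0 := by
    simp only [Heis.coords, HeisAlg.exp, Heis.mul_x, Heis.mul_y, Heis.mul_z, Pi.smul_apply,
      smul_eq_mul]
    refine HasDerivAt.prodMk ?_ (HasDerivAt.prodMk ?_ ?_)
    · simpa using ((hasDerivAt_id (0 : ℝ)).mul_const (v 0)).const_add g.x
    · simpa using ((hasDerivAt_id (0 : ℝ)).mul_const (v 1)).const_add g.y
    · have h1 := (hasDerivAt_id (0 : ℝ)).mul_const (v 0)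
      have h2 := (hasDerivAt_id (0 : ℝ)).mul_const (v 1)
      have h3 := (hasDerivAt_id (0 : ℝ)).mul_const (v 2)
      simpa using ((h3.fun_add ((h1.fun_mul h2).div_const 2)).const_add g.z).fun_add (h2.const_mul g.x)
  have h0 : (g * HeisAlg.exp ((0 : ℝ) • v)).coords = g.coords := by
    simp [Heis.coords, HeisAlg.exp]
  have hd : ∀ j, HasDerivAt (fun t : ℝ => σ (g * HeisAlg.exp (t • v)) j)
      (fderiv ℝ (fun x => σ (Heis.ofCoords x) j) g.coords (v 0, v 1, v 2 + g.x * v 1)) 0 := by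
    intro j
    have h1 : ContDiff ℝ ∞ fun x => σ (Heis.ofCoords x) j := contDiff_pi.1 hσ j
    refine HasFDerivAt.comp_hasDerivAt (l := fun x => σ (Heis.ofCoords x) j) (0 : ℝ) ?_ hl
    rw [h0]
    exact (h1.differentiable (by simp) _).hasFDerivAt
  rw [leftDeriv, (hasDerivAt_pi.2 hd).deriv]

/-- The zero order term of the Dirac operator. -/
theorem sum_christoffel {d T : ℝ} (hd : 0 < d) (hT : 0 < T) (w : Spinor3) :
    ∑ i, cliffordGamma i *ᵥ ((1 / 4 : ℂ) • ∑ j, ∑ k, (HeisAlg.christoffel d T i j k : ℂ) •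
      ((cliffordGamma j * cliffordGamma k) *ᵥ w)) = (-(d ^ 2 * T / 4) : ℂ) • w := by
  have h1 := hd.ne'
  have h2 := hT.ne'
  -- The only nonzero bracket of the frame, up to order, is [e₁, e₂] = d²Z = d²T e₃, so every symbol
  -- is 0 or ±d²T/2.
  have hc : ∀ i j k, HeisAlg.christoffel d T i j k = d ^ 2 * T / 2 *
      (![![![0, 0, 0], ![0, 0, 1], ![0, -1, 0]], ![![0, 0, -1], ![0, 0, 0], ![1, 0, 0]],
        ![![0, -1, 0], ![1, 0, 0], ![0, 0, 0]]] : Fin 3 → Fin 3 → Fin 3 → ℝ) i j k := by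
    intro i j k
    fin_cases i <;> fin_cases j <;> fin_cases k <;>
      simp [HeisAlg.christoffel, HeisAlg.metric, HeisAlg.bracket, HeisAlg.frame] <;> field_simp
  simp only [hc]
  ext a
  fin_cases a <;> simp [Fin.sum_univ_three, cliffordGamma] <;> ring

theorem diracG_eq {d T : ℝ} (hd : 0 < d) (hT : 0 < T) {σ : Heis → Spinor3}
    (hσ : ContDiff ℝ ∞ fun x => σ (Heis.ofCoords x)) (g : Heis) :
    diracG d T σ g = ![
      Complex.I * T⁻¹ * fderiv ℝ (fun x => σ (Heis.ofCoords x) 0) g.coords (0, 0, 1)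
        - Complex.I * d * (fderiv ℝ (fun x => σ (Heis.ofCoords x) 1) g.coords (1, 0, 0)
          + Complex.I * fderiv ℝ (fun x => σ (Heis.ofCoords x) 1) g.coords (0, 1, g.x)),
      -(Complex.I * d) * (fderiv ℝ (fun x => σ (Heis.ofCoords x) 0) g.coords (1, 0, 0)
          - Complex.I * fderiv ℝ (fun x => σ (Heis.ofCoords x) 0) g.coords (0, 1, g.x))
        - Complex.I * T⁻¹ * fderiv ℝ (fun x => σ (Heis.ofCoords x) 1) g.coords (0, 0, 1)]
      + (-(d ^ 2 * T / 4) : ℂ) • σ g := by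
  rw [← sum_christoffel hd hT]
  simp only [diracG, spinConnection, Matrix.mulVec_add, Finset.sum_add_distrib]
  congr 1
  have e1 : ∀ (f : ℝ × ℝ × ℝ → ℂ), fderiv ℝ f g.coords (-d, 0, 0)
      = -(d : ℂ) * fderiv ℝ f g.coords (1, 0, 0) := fun f => by
    have : ((-d, 0, 0) : ℝ × ℝ × ℝ) = (-d) • (1, 0, 0) := by simp
    rw [this, map_smul, Complex.real_smul, Complex.ofReal_neg]
  have e2 : ∀ (f : ℝ × ℝ × ℝ → ℂ), fderiv ℝ f g.coords (0, -d, -(g.x * d))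
      = -(d : ℂ) * fderiv ℝ f g.coords (0, 1, g.x) := fun f => by
    have : ((0, -d, -(g.x * d)) : ℝ × ℝ × ℝ) = (-d) • (0, 1, g.x) := by simp [mul_comm]
    rw [this, map_smul, Complex.real_smul, Complex.ofReal_neg]
  have e3 : ∀ (f : ℝ × ℝ × ℝ → ℂ), fderiv ℝ f g.coords (0, 0, T⁻¹)
      = (T⁻¹ : ℝ) * fderiv ℝ f g.coords (0, 0, 1) := fun f => by
    have : ((0, 0, T⁻¹) : ℝ × ℝ × ℝ) = T⁻¹ • (0, 0, 1) := by simp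
    rw [this, map_smul, Complex.real_smul]
  ext a
  fin_cases a <;>
    simp [Fin.sum_univ_three, cliffordGamma, leftDeriv_apply hσ, HeisAlg.frame, e1, e2, e3] <;> ring_nf <;> simp <;> ring

namespace SpinStructure

open Topology

variable {r : ℕ} {d T : ℝ} {S : SpinStructure r d T}

/-! ### The Dirac eigenspaces in coordinates -/

theorem apply_act_spinSign {ψ : S.P → Spinor3}
    (hψ : ∀ p A, ψ (S.act p A) = ((A⁻¹ : Spin3) : Matrix (Fin 2) (Fin 2) ℂ) *ᵥ ψ p) (p : S.P)
    (u : ℤˣ) : ψ (S.act p (spinSign u)) = ((u : ℤ) : ℂ) • ψ p := by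
  rw [hψ, spinSign_inv, coe_spinSign, Matrix.smul_mulVec, Matrix.one_mulVec]

theorem IsLift.contDiff {s : Heis → S.P} (hs : S.IsLift Set.univ s) {ψ : S.P → Spinor3}
    (hψ : S.IsSmoothSpinor ψ) : ContDiff ℝ ∞ fun x => ψ (s (Heis.ofCoords x)) := by
  have := hψ.2 _ _ hs
  rwa [Set.preimage_univ, contDiffOn_univ] at this

theorem IsLift.isSmoothSpinor {s : Heis → S.P} (hs : S.IsLift Set.univ s) {ψ : S.P → Spinor3}
    (hψ : ∀ p A, ψ (S.act p A) = ((A⁻¹ : Spin3) : Matrix (Fin 2) (Fin 2) ℂ) *ᵥ ψ p)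
    (h : ContDiff ℝ ∞ fun x => ψ (s (Heis.ofCoords x))) : S.IsSmoothSpinor ψ := by
  refine ⟨hψ, fun U q hq x hx => ?_⟩
  obtain ⟨u, hu⟩ := hs.eventually_eq hq hx
  refine ContDiffAt.contDiffWithinAt (ContDiffAt.congr_of_eventuallyEq
    ((h.const_smul ((u : ℤ) : ℂ)).contDiffAt (x := x)) ?_)
  filter_upwards [(Heis.continuous_ofCoords.tendsto x).eventually hu] with y hy
  rw [hy, apply_act_spinSign hψ]

theorem IsLift.isDirac_iff {s : Heis → S.P} (hs : S.IsLift Set.univ s) {ψ : S.P → Spinor3}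
    (hψ : S.IsSmoothSpinor ψ) {μ : ℂ} :
    S.IsDirac ψ (μ • ψ) ↔ ∀ g, μ • ψ (s g) = diracG d T (fun h => ψ (s h)) g := by
  refine ⟨fun h g => h _ _ hs g trivial, fun h U q hq g hg => ?_⟩
  obtain ⟨u, hu⟩ := hs.eventually_eq hq hg
  have h1 : (fun h => ψ (q h)) =ᶠ[𝓝 g] fun h => ((u : ℤ) : ℂ) • ψ (s h) := by
    filter_upwards [hu] with y hy
    rw [hy, apply_act_spinSign hψ.1]
  have hd : ∀ v, leftDeriv v (fun h => ((u : ℤ) : ℂ) • ψ (s h)) g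
      = ((u : ℤ) : ℂ) • leftDeriv v (fun h => ψ (s h)) g := fun v =>
    deriv_fun_const_smul _ (hψ.differentiableAt hs trivial v)
  have h2 : diracG d T (fun h => ((u : ℤ) : ℂ) • ψ (s h)) g
      = ((u : ℤ) : ℂ) • diracG d T (fun h => ψ (s h)) g := by
    simp only [diracG, spinConnection, hd, Matrix.mulVec_add, Matrix.mulVec_smul,
      Finset.smul_sum, smul_add, Matrix.mulVec_sum, smul_smul, mul_comm, mul_assoc, mul_left_comm]
  rw [diracG_congr h1, h2, ← h g, Pi.smul_apply, h1.eq_of_nhds, smul_comm]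

/-- The coordinate form of the eigenvalue equation. -/
theorem diracG_eq_smul_iff (hd : 0 < d) (hT : 0 < T) {σ : Heis → Spinor3}
    (hσ : ContDiff ℝ ∞ fun x => σ (Heis.ofCoords x)) (μ : ℂ) (p : ℝ × ℝ × ℝ) :
    μ • σ (Heis.ofCoords p) = diracG d T σ (Heis.ofCoords p) ↔
      (Complex.I * (T⁻¹ : ℝ) * fderiv ℝ (fun x => σ (Heis.ofCoords x) 0) p (0, 0, 1)
        - Complex.I * d * (fderiv ℝ (fun x => σ (Heis.ofCoords x) 1) p (1, 0, 0)
          + Complex.I * fderiv ℝ (fun x => σ (Heis.ofCoords x) 1) p (0, 1, p.1))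
        = (μ + (d ^ 2 * T / 4 : ℝ)) * σ (Heis.ofCoords p) 0 ∧
      -(Complex.I * d) * (fderiv ℝ (fun x => σ (Heis.ofCoords x) 0) p (1, 0, 0)
          - Complex.I * fderiv ℝ (fun x => σ (Heis.ofCoords x) 0) p (0, 1, p.1))
        - Complex.I * (T⁻¹ : ℝ) * fderiv ℝ (fun x => σ (Heis.ofCoords x) 1) p (0, 0, 1)
        = (μ + (d ^ 2 * T / 4 : ℝ)) * σ (Heis.ofCoords p) 1) := by
  rw [diracG_eq hd hT hσ, funext_iff, Fin.forall_fin_two]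
  have e : (Heis.ofCoords p).coords = p := rfl
  have e' : (Heis.ofCoords p).x = p.1 := rfl
  simp only [e, e', Pi.add_apply, Pi.smul_apply, smul_eq_mul, Matrix.cons_val_zero,
    Matrix.cons_val_one, Complex.ofReal_inv]
  push_cast
  refine and_congr ⟨fun h => ?_, fun h => ?_⟩ ⟨fun h => ?_, fun h => ?_⟩
  · linear_combination -h
  · linear_combination -h
  · linear_combination -h
  · linear_combination -h

/-- The elements γ with the asserted behaviour form a subgroup, and invariance under the three
generators is the definition of `heisFn`. -/
theorem apply_mul_of_heisFn {κ : Fin 3 → ℝ} {ε : heisLattice r →* ℤˣ}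
    (h0 : realChar (κ 0) 1 = ((ε (heisLattice.genX r) : ℤ) : ℂ))
    (h1 : realChar (κ 1) 1 = ((ε (heisLattice.genY r) : ℤ) : ℂ))
    (h2 : realChar (κ 2) 1 = ((ε (heisLattice.genZ r) : ℤ) : ℂ))
    (f : heisFn r (κ 0) (κ 1) (κ 2)) (γ : heisLattice r) (g : Heis) :
    f.1 ((γ : Heis) * g).coords = ((ε γ : ℤ) : ℂ) * f.1 g.coords := by
  have hu : ∀ u : ℤˣ, ((u : ℤ) : ℂ) * ((u : ℤ) : ℂ) = 1 := fun u => by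
    rw [← Int.cast_mul, Int.units_coe_mul_self, Int.cast_one]
  let K : Subgroup (heisLattice r) :=
    { carrier := {γ | ∀ g : Heis, f.1 ((γ : Heis) * g).coords = ((ε γ : ℤ) : ℂ) * f.1 g.coords}
      mul_mem' := fun {a b} ha hb g => by
        rw [Subgroup.coe_mul, mul_assoc, ha, hb, map_mul]
        push_cast
        ring
      one_mem' := fun g => by simp
      inv_mem' := fun {a} ha g => by
        have := ha ((a⁻¹ : heisLattice r) * g)
        rw [← mul_assoc, ← Subgroup.coe_mul, mul_inv_cancel, Subgroup.coe_one, one_mul] at this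
        rw [this, ← mul_assoc, map_inv, Int.units_inv_eq_self, hu, one_mul] }
  have hK : K = ⊤ := by
    refine heisLattice.eq_top_of_gen_mem (fun g => ?_) (fun g => ?_) fun g => ?_
    · rw [← h0, show f.1 g.coords = f.1 (g.x, g.y, g.z) from rfl, ← heisFn.add_x]
      simp [Heis.coords, heisLattice.genX, add_comm]
    · rw [← h1, show f.1 g.coords = f.1 (g.x, g.y, g.z) from rfl, ← heisFn.add_y]
      simp [Heis.coords, heisLattice.genY, add_comm]
    · rw [← h2, show f.1 g.coords = f.1 (g.x, g.y, g.z) from rfl, ← heisFn.add_z]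
      simp [Heis.coords, heisLattice.genZ, add_comm]
  exact (hK ▸ Subgroup.mem_top γ : γ ∈ K) g

theorem IsLift.mem_heisFn {s : Heis → S.P} (hs : S.IsLift Set.univ s) {κ : Fin 3 → ℝ}
    {ε : heisLattice r →* ℤˣ}
    (hsε : ∀ (γ : heisLattice r) (g : Heis), s ((γ : Heis) * g) = S.act (s g) (spinSign (ε γ)))
    (h0 : realChar (κ 0) 1 = ((ε (heisLattice.genX r) : ℤ) : ℂ))
    (h1 : realChar (κ 1) 1 = ((ε (heisLattice.genY r) : ℤ) : ℂ))
    (h2 : realChar (κ 2) 1 = ((ε (heisLattice.genZ r) : ℤ) : ℂ)) {ψ : S.P → Spinor3}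
    (hψ : S.IsSmoothSpinor ψ) (i : Fin 2) :
    (fun x => ψ (s (Heis.ofCoords x)) i) ∈ heisFn r (κ 0) (κ 1) (κ 2) := by
  have hγ : ∀ (γ : heisLattice r) (g : Heis),
      ψ (s ((γ : Heis) * g)) i = ((ε γ : ℤ) : ℂ) * ψ (s g) i := fun γ g => by
    rw [hsε, apply_act_spinSign hψ.1, Pi.smul_apply, smul_eq_mul]
  refine ⟨contDiff_pi.1 (hs.contDiff hψ) i, fun x y z => ?_, fun x y z => ?_, fun x y z => ?_⟩
  · beta_reduce
    rw [h0, ← hγ]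
    refine congrArg (fun h => ψ (s h) i) (Heis.ext ?_ ?_ ?_) <;>
      simp [Heis.ofCoords, heisLattice.genX, add_comm]
  · beta_reduce
    rw [h1, ← hγ]
    refine congrArg (fun h => ψ (s h) i) (Heis.ext ?_ ?_ ?_) <;>
      simp [Heis.ofCoords, heisLattice.genY, add_comm]
  · beta_reduce
    rw [h2, ← hγ]
    refine congrArg (fun h => ψ (s h) i) (Heis.ext ?_ ?_ ?_) <;>
      simp [Heis.ofCoords, heisLattice.genZ, add_comm]

/-- Equivariant functions on `G` are spinors. -/
theorem IsLift.exists_spinor {s : Heis → S.P} (hs : S.IsLift Set.univ s) {ε : heisLattice r →* ℤˣ}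
    (hsε : ∀ (γ : heisLattice r) (g : Heis), s ((γ : Heis) * g) = S.act (s g) (spinSign (ε γ)))
    {σ : Heis → Spinor3}
    (hσ : ∀ (γ : heisLattice r) (g : Heis), σ ((γ : Heis) * g) = ((ε γ : ℤ) : ℂ) • σ g)
    (hσs : ContDiff ℝ ∞ fun x => σ (Heis.ofCoords x)) :
    ∃ ψ, S.IsSmoothSpinor ψ ∧ ∀ g, ψ (s g) = σ g := by
  let ψ : S.P → Spinor3 := fun p =>
    (((Function.surjInv hs.surjective_ofLift p).2⁻¹ : Spin3) : Matrix (Fin 2) (Fin 2) ℂ)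
      *ᵥ σ (Function.surjInv hs.surjective_ofLift p).1
  -- The value does not depend on the chosen representative: the sign ε(γ) enters once through σ and
  -- once through A⁻¹.
  have hψ : ∀ g A, ψ (S.ofLift s (g, A)) = ((A⁻¹ : Spin3) : Matrix (Fin 2) (Fin 2) ℂ) *ᵥ σ g := by
    intro g A
    have h := Function.surjInv_eq hs.surjective_ofLift (S.ofLift s (g, A))
    rw [← Prod.mk.eta (p := Function.surjInv _ _), hs.ofLift_eq_iff hsε] at h
    obtain ⟨γ, h3, h4⟩ := h
    simp only [ψ]
    conv_rhs => rw [h4]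
    rw [← h3, hσ, mul_inv_rev, spinSign_inv, Submonoid.coe_mul, coe_spinSign, mul_smul_comm,
      mul_one, Matrix.smul_mulVec, Matrix.mulVec_smul]
  have hψs : ∀ g, ψ (s g) = σ g := fun g => by
    have := hψ g 1
    rwa [ofLift, S.act_one, inv_one, Submonoid.coe_one, Matrix.one_mulVec] at this
  have hequiv : ∀ p A, ψ (S.act p A) = ((A⁻¹ : Spin3) : Matrix (Fin 2) (Fin 2) ℂ) *ᵥ ψ p := by
    intro p B
    obtain ⟨⟨g, A⟩, rfl⟩ := hs.surjective_ofLift p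
    rw [ofLift_act, hψ, hψ, mul_inv_rev, Submonoid.coe_mul, Matrix.mulVec_mulVec]
  exact ⟨ψ, hs.isSmoothSpinor hequiv (by simpa only [hψs] using hσs), hψs⟩

/-- The Dirac eigenspaces are the eigenspaces on spinors on the Heisenberg group that are invariant
under the lattice up to the character. -/
theorem nonempty_eigenspace_equiv (hd : 0 < d) (hT : 0 < T) {κ : Fin 3 → ℝ}
    {ε : heisLattice r →* ℤˣ} (hε : S.HasHom ε)
    (h0 : realChar (κ 0) 1 = ((ε (heisLattice.genX r) : ℤ) : ℂ))
    (h1 : realChar (κ 1) 1 = ((ε (heisLattice.genY r) : ℤ) : ℂ))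
    (h2 : realChar (κ 2) 1 = ((ε (heisLattice.genZ r) : ℤ) : ℂ)) (μ : ℂ) :
    Nonempty (S.diracEigenspace μ ≃ₗ[ℂ]
      heisSpinors r (κ 0) (κ 1) (κ 2) d T (μ + (d ^ 2 * T / 4 : ℝ))) := by
  obtain ⟨s, hs, hsε⟩ := hε
  have hsm : ∀ (ψ : S.P → Spinor3), S.IsSmoothSpinor ψ → ContDiff ℝ ∞
      fun x => (fun h => ψ (s h)) (Heis.ofCoords x) := fun ψ hψ => hs.contDiff hψ
  have hmem := fun ψ : S.diracEigenspace μ => hs.mem_heisFn hsε h0 h1 h2 ψ.2.1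
  let F : S.diracEigenspace μ →ₗ[ℂ]
      heisSpinors r (κ 0) (κ 1) (κ 2) d T (μ + (d ^ 2 * T / 4 : ℝ)) :=
    { toFun ψ := ⟨(⟨_, hmem ψ 0⟩, ⟨_, hmem ψ 1⟩), fun p =>
        (diracG_eq_smul_iff (σ := fun h => ψ.1 (s h)) hd hT (hsm ψ.1 ψ.2.1) μ p).1
          ((hs.isDirac_iff ψ.2.1).1 ψ.2.2 _)⟩
      map_add' _ _ := rfl
      map_smul' _ _ := rfl }
  refine ⟨LinearEquiv.ofBijective F ⟨?_, ?_⟩⟩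
  · rw [injective_iff_map_eq_zero]
    rintro ⟨ψ, hψ⟩ h
    refine Subtype.ext (funext fun p => ?_)
    obtain ⟨⟨g, A⟩, rfl⟩ := hs.surjective_ofLift p
    have hg : ψ (s g) = 0 := by
      ext i
      fin_cases i
      · exact congrArg (fun u => u.1.1.1 g.coords) h
      · exact congrArg (fun u => u.1.2.1 g.coords) h
    change ψ (S.act (s g) A) = 0
    rw [hψ.1.1, hg, Matrix.mulVec_zero]
  · rintro ⟨⟨f₀, f₁⟩, hf⟩
    let σ : Heis → Spinor3 := fun g => ![f₀.1 g.coords, f₁.1 g.coords]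
    have hσ : ∀ (γ : heisLattice r) (g : Heis),
        σ ((γ : Heis) * g) = ((ε γ : ℤ) : ℂ) • σ g := fun γ g => by
      simp [σ, apply_mul_of_heisFn h0 h1 h2]
    have hσs : ContDiff ℝ ∞ fun x => σ (Heis.ofCoords x) := by
      refine contDiff_pi.2 fun i => ?_
      fin_cases i
      · exact f₀.2.1
      · exact f₁.2.1
    obtain ⟨ψ, hsmooth, hψs⟩ := hs.exists_spinor hsε hσ hσs
    refine ⟨⟨ψ, hsmooth, (hs.isDirac_iff hsmooth).2 fun g => ?_⟩, ?_⟩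
    · simp only [hψs]
      exact (diracG_eq_smul_iff hd hT hσs μ g.coords).2 (hf g.coords)
    · refine Subtype.ext (Prod.ext (Subtype.ext (funext fun x => ?_))
        (Subtype.ext (funext fun x => ?_)))
      · exact congrFun (hψs (Heis.ofCoords x)) 0
      · exact congrFun (hψs (Heis.ofCoords x)) 1

theorem HasTriple.nonempty_eigenspace_equiv (hd : 0 < d) (hT : 0 < T) {δ : Fin 3 → ℤˣ}
    (hδ : S.HasTriple δ) (μ : ℂ) : Nonempty (S.diracEigenspace μ ≃ₗ[ℂ]
      heisSpinors r (signLog (δ 0)) (signLog (δ 1)) (signLog (δ 2)) d T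
        (μ + (d ^ 2 * T / 4 : ℝ))) := by
  obtain ⟨ε, hε, h0, h1, h2⟩ := hasTriple_iff.1 hδ
  exact SpinStructure.nonempty_eigenspace_equiv hd hT (κ := fun i => signLog (δ i)) hε
    (by rw [realChar_signLog, h0]) (by rw [realChar_signLog, h1]) (by rw [realChar_signLog, h2]) μ

end SpinStructure

/-! ### The covering `Spin(3) → SO(3)` -/

theorem spinCover_mul (A B : Spin3) : spinCover (A * B) = spinCover A * spinCover B := by
  ext i j
  have h : cliffordGamma i * (A * B : Matrix (Fin 2) (Fin 2) ℂ) * cliffordGamma j *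
      (A * B : Matrix (Fin 2) (Fin 2) ℂ)ᴴ = ∑ k, (spinCover B k j : ℂ) •
        (cliffordGamma i * (A : Matrix (Fin 2) (Fin 2) ℂ) * cliffordGamma k *
          (A : Matrix (Fin 2) (Fin 2) ℂ)ᴴ) := by
    have h1 := congrArg (fun M => cliffordGamma i * (A : Matrix (Fin 2) (Fin 2) ℂ) * M *
      (A : Matrix (Fin 2) (Fin 2) ℂ)ᴴ) (spinCover_spec B j)
    simp only [Matrix.mul_sum, Matrix.sum_mul, Matrix.mul_smul, Matrix.smul_mul] at h1
    rw [← h1, Matrix.conjTranspose_mul]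
    simp only [mul_assoc]
  rw [Matrix.mul_apply, spinCover, Matrix.of_apply, Submonoid.coe_mul, h, Matrix.trace_sum,
    Complex.re_sum, ← Finset.sum_neg_distrib, Finset.sum_div]
  refine Finset.sum_congr rfl fun k _ => ?_
  have h2 : spinCover A i k = -(cliffordGamma i * (A : Matrix (Fin 2) (Fin 2) ℂ) *
    cliffordGamma k * (A : Matrix (Fin 2) (Fin 2) ℂ)ᴴ).trace.re / 2 := rfl
  rw [Matrix.trace_smul, smul_eq_mul, Complex.re_ofReal_mul, h2]
  ring

theorem spinCover_one : spinCover 1 = 1 := by rw [← spinSign_one, spinCover_spinSign]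

theorem spinCover_inv (A : Spin3) : spinCover A⁻¹ = (spinCover A)ᵀ := by
  ext i j
  rw [Matrix.transpose_apply, spinCover, spinCover, Matrix.of_apply, Matrix.of_apply, coe_spin3_inv,
    Matrix.conjTranspose_conjTranspose, mul_assoc, Matrix.trace_mul_comm, ← mul_assoc]

theorem spinCover_transpose_mul_self (A : Spin3) : (spinCover A)ᵀ * spinCover A = 1 := by
  rw [← spinCover_inv, ← spinCover_mul, inv_mul_cancel, spinCover_one]

theorem continuous_spinCover : Continuous spinCover := by
  refine continuous_matrix fun i j => ?_
  have h : Continuous fun A : Spin3 => (A : Matrix (Fin 2) (Fin 2) ℂ) := continuous_subtype_val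
  have h1 : Continuous fun A : Spin3 => cliffordGamma i * (A : Matrix (Fin 2) (Fin 2) ℂ) *
      cliffordGamma j * (A : Matrix (Fin 2) (Fin 2) ℂ)ᴴ :=
    ((continuous_const.matrix_mul h).matrix_mul continuous_const).matrix_mul h.matrix_conjTranspose
  exact (Complex.continuous_re.comp h1.matrix_trace).neg.div_const 2

/-- The element of `Spin(3)` given by a unit quaternion. -/
def spinOfQuat (a b c d : ℝ) (h : a ^ 2 + b ^ 2 + c ^ 2 + d ^ 2 = 1) : Spin3 :=
  ⟨!![⟨a, d⟩, ⟨-c, b⟩; ⟨c, b⟩, ⟨a, -d⟩], by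
    rw [Matrix.mem_specialUnitaryGroup_iff, Matrix.mem_unitaryGroup_iff]
    constructor
    · ext i j
      fin_cases i <;> fin_cases j <;> apply Complex.ext <;>
        simp [Matrix.mul_apply, Fin.sum_univ_two] <;> linarith
    · rw [Matrix.det_fin_two]
      apply Complex.ext <;> simp <;> linarith⟩

/-- In SU(2) the conjugate transpose is the adjugate, so the first column determines the second. -/
theorem exists_spinOfQuat (A : Spin3) : ∃ a b c d h, A = spinOfQuat a b c d h := by
  obtain ⟨A, hA⟩ := A
  obtain ⟨hu, hdet⟩ := Matrix.mem_specialUnitaryGroup_iff.1 hA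
  have hinv : Aᴴ = A.adjugate := by
    have h1 : Aᴴ * A = 1 := Matrix.mem_unitaryGroup_iff'.1 hu
    have h2 : A * A.adjugate = 1 := by rw [Matrix.mul_adjugate, hdet, one_smul]
    rw [← mul_one Aᴴ, ← h2, ← mul_assoc, h1, one_mul]
  rw [Matrix.adjugate_fin_two] at hinv
  have h11 := congrFun (congrFun hinv 0) 0
  have h01 := congrFun (congrFun hinv 0) 1
  simp [Matrix.conjTranspose_apply, Complex.ext_iff] at h11 h01
  rw [Matrix.det_fin_two] at hdet
  have hre := congrArg Complex.re hdet
  simp [← h11.1, ← h11.2] at hre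
  refine ⟨(A 0 0).re, (A 1 0).im, (A 1 0).re, (A 0 0).im, ?_, ?_⟩
  · rw [← h01.2, show (A 0 1).re = -(A 1 0).re by linarith [h01.1]] at hre
    linear_combination hre
  · refine Subtype.ext ?_
    ext i j
    fin_cases i <;> fin_cases j <;> apply Complex.ext <;> simp [spinOfQuat] <;> linarith

theorem spinCover_spinOfQuat (a b c d : ℝ) (h : a ^ 2 + b ^ 2 + c ^ 2 + d ^ 2 = 1) :
    spinCover (spinOfQuat a b c d h) =
      !![a ^ 2 + b ^ 2 - c ^ 2 - d ^ 2, 2 * (b * c - a * d), 2 * (b * d + a * c);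
        2 * (b * c + a * d), a ^ 2 - b ^ 2 + c ^ 2 - d ^ 2, 2 * (c * d - a * b);
        2 * (b * d - a * c), 2 * (c * d + a * b), a ^ 2 - b ^ 2 - c ^ 2 + d ^ 2] := by
  ext i j
  fin_cases i <;> fin_cases j <;>
    simp [spinCover, spinOfQuat, cliffordGamma, Matrix.trace, Matrix.mul_apply, Fin.sum_univ_two] <;> ring

theorem det_spinCover (A : Spin3) : (spinCover A).det = 1 := by
  obtain ⟨a, b, c, d, h, rfl⟩ := exists_spinOfQuat A
  rw [spinCover_spinOfQuat, Matrix.det_fin_three]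
  simp
  have : (a ^ 2 + b ^ 2 + c ^ 2 + d ^ 2) ^ 3 = 1 := by rw [h, one_pow]
  linear_combination this

theorem eq_spinSign_of_spinCover_eq_one {A : Spin3} (h : spinCover A = 1) :
    ∃ u, A = spinSign u := by
  obtain ⟨a, b, c, d, hq, rfl⟩ := exists_spinOfQuat A
  rw [spinCover_spinOfQuat] at h
  have h0 := congrFun (congrFun h 0) 0
  have h1 := congrFun (congrFun h 1) 1
  simp at h0 h1
  have hc : c = 0 := by nlinarith
  have hd : d = 0 := by nlinarith
  have hb : b = 0 := by nlinarith
  subst hb hc hd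
  have ha : a * a = 1 := by linarith
  rcases mul_self_eq_one_iff.1 ha with rfl | rfl
  · refine ⟨1, Subtype.ext ?_⟩
    ext i j
    fin_cases i <;> fin_cases j <;> apply Complex.ext <;> simp [spinOfQuat, coe_spinSign]
  · refine ⟨-1, Subtype.ext ?_⟩
    ext i j
    fin_cases i <;> fin_cases j <;> apply Complex.ext <;> simp [spinOfQuat, coe_spinSign]

theorem exists_spinSign_mul_of_spinCover_eq {A B : Spin3} (h : spinCover A = spinCover B) :
    ∃ u, A = spinSign u * B := by
  have h1 : spinCover (A * B⁻¹) = 1 := by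
    rw [spinCover_mul, h, ← spinCover_mul, mul_inv_cancel, spinCover_one]
  obtain ⟨u, hu⟩ := eq_spinSign_of_spinCover_eq_one h1
  exact ⟨u, by rw [← hu, inv_mul_cancel_right]⟩

/-- Half-angle formulas for a rotation that takes the third basis vector to (x, y, z). They divide
by a = √((1 + z)/2), so the south pole is treated separately. -/
theorem exists_spinCover_col {x y z : ℝ} (h : x ^ 2 + y ^ 2 + z ^ 2 = 1) :
    ∃ A, spinCover A 0 2 = x ∧ spinCover A 1 2 = y ∧ spinCover A 2 2 = z := by
  by_cases hz : z = -1
  · have hx : x = 0 := by nlinarith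
    have hy : y = 0 := by nlinarith
    refine ⟨spinOfQuat 0 1 0 0 (by norm_num), ?_⟩
    rw [spinCover_spinOfQuat]
    simp [hx, hy, hz]
  · have hz1 : -1 < z := lt_of_le_of_ne (by nlinarith) (Ne.symm hz)
    set a := √((1 + z) / 2) with ha
    have ha2 : a ^ 2 = (1 + z) / 2 := Real.sq_sqrt (by linarith)
    have ha0 : a ≠ 0 := (Real.sqrt_pos.2 (by linarith)).ne'
    have hs : (-(y / (2 * a))) ^ 2 + (x / (2 * a)) ^ 2 = (1 - z) / 2 := by
      have : (-(y / (2 * a))) ^ 2 + (x / (2 * a)) ^ 2 = (x ^ 2 + y ^ 2) / (4 * a ^ 2) := by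
        field_simp
        ring
      rw [this, ha2, div_eq_div_iff (by linarith) two_ne_zero]
      linear_combination 2 * h
    refine ⟨spinOfQuat a (-(y / (2 * a))) (x / (2 * a)) 0 (by linarith), ?_⟩
    rw [spinCover_spinOfQuat]
    refine ⟨?_, ?_, ?_⟩
    · simp
      field_simp
    · simp
      field_simp
    · simp
      simp at hs
      linarith

/-- A complex square root of c + is supplies the half angle. -/
theorem exists_spinCover_rotation {c s : ℝ} (h : c ^ 2 + s ^ 2 = 1) :
    ∃ A, spinCover A = !![c, -s, 0; s, c, 0; 0, 0, 1] := by
  obtain ⟨w, hw⟩ := IsAlgClosed.exists_pow_nat_eq (⟨c, s⟩ : ℂ) two_pos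
  rw [sq, Complex.ext_iff] at hw
  simp only [Complex.mul_re, Complex.mul_im] at hw
  obtain ⟨h1, h2⟩ := hw
  have h3 : w.re ^ 2 + w.im ^ 2 = 1 := by
    have : (w.re ^ 2 + w.im ^ 2) ^ 2 = 1 := by
      rw [← h, ← h1, ← h2]
      ring
    exact (pow_eq_one_iff_of_nonneg (by positivity) two_ne_zero).1 this
  refine ⟨spinOfQuat w.re 0 0 w.im (by linarith), ?_⟩
  rw [spinCover_spinOfQuat]
  congr <;> linarith

/-- Removing a rotation with the same third column leaves an element of SO(3) that fixes the third
basis vector, hence a planar rotation. -/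
theorem exists_spinCover_eq {R : Matrix (Fin 3) (Fin 3) ℝ} (hR : Rᵀ * R = 1) (hdet : R.det = 1) :
    ∃ A, spinCover A = R := by
  have hcol : R 0 2 ^ 2 + R 1 2 ^ 2 + R 2 2 ^ 2 = 1 := by
    have := congrFun (congrFun hR 2) 2
    simp [Matrix.mul_apply, Fin.sum_univ_three] at this
    linarith
  obtain ⟨A, h0, h1, h2⟩ := exists_spinCover_col hcol
  set R' := (spinCover A)ᵀ * R with hR'
  have ho : R'ᵀ * R' = 1 := by
    have : spinCover A * (spinCover A)ᵀ = 1 := by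
      rw [← spinCover_inv, ← spinCover_mul, mul_inv_cancel, spinCover_one]
    rw [hR', Matrix.transpose_mul, Matrix.transpose_transpose, mul_assoc, ← mul_assoc (spinCover A),
      this, one_mul, hR]
  have ho' : R' * R'ᵀ = 1 := mul_eq_one_comm.1 ho
  have hd' : R'.det = 1 := by
    rw [hR', Matrix.det_mul, Matrix.det_transpose, det_spinCover, hdet, one_mul]
  have hc : ∀ i, R' i 2 = (1 : Matrix (Fin 3) (Fin 3) ℝ) i 2 := by
    intro i
    rw [← spinCover_transpose_mul_self A, hR', Matrix.mul_apply, Matrix.mul_apply]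
    simp only [Fin.sum_univ_three, h0, h1, h2]
  have e02 : R' 0 2 = 0 := by simpa using hc 0
  have e12 : R' 1 2 = 0 := by simpa using hc 1
  have e22 : R' 2 2 = 1 := by simpa using hc 2
  have r2 := congrFun (congrFun ho' 2) 2
  have c00 := congrFun (congrFun ho 0) 0
  have c11 := congrFun (congrFun ho 1) 1
  simp [Matrix.mul_apply, Fin.sum_univ_three, e22] at r2 c00 c11
  have e20 : R' 2 0 = 0 := by nlinarith [mul_self_nonneg (R' 2 0), mul_self_nonneg (R' 2 1)]
  have e21 : R' 2 1 = 0 := by nlinarith [mul_self_nonneg (R' 2 0), mul_self_nonneg (R' 2 1)]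
  rw [Matrix.det_fin_three] at hd'
  simp [e02, e12, e22, e20, e21] at hd' c00 c11
  have e11 : R' 1 1 = R' 0 0 := by
    nlinarith [sq_nonneg (R' 0 0 - R' 1 1), sq_nonneg (R' 0 1 + R' 1 0)]
  have e01 : R' 0 1 = -R' 1 0 := by
    nlinarith [sq_nonneg (R' 0 0 - R' 1 1), sq_nonneg (R' 0 1 + R' 1 0)]
  have hcs : R' 0 0 ^ 2 + R' 1 0 ^ 2 = 1 := by linarith
  obtain ⟨B, hB⟩ := exists_spinCover_rotation hcs
  have hB' : spinCover B = R' := by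
    rw [hB]
    ext i j
    fin_cases i <;> fin_cases j
    · rfl
    · exact e01.symm
    · exact e02.symm
    · rfl
    · exact e11.symm
    · exact e12.symm
    · exact e20.symm
    · exact e21.symm
    · exact e22.symm
  refine ⟨A * B, ?_⟩
  have : spinCover A * (spinCover A)ᵀ = 1 := by
    rw [← spinCover_inv, ← spinCover_mul, mul_inv_cancel, spinCover_one]
  rw [spinCover_mul, hB', hR', ← mul_assoc, this, one_mul]

/-! ### The oriented orthonormal frames as a quotient of `Spin(3)` -/

section FrameMap

variable {d T : ℝ}

theorem sum_smul_frame (R : Matrix (Fin 3) (Fin 3) ℝ) (j : Fin 3) :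
    ∑ i, R i j • HeisAlg.frame d T i = ![-(d * R 0 j), -(d * R 1 j), T⁻¹ * R 2 j] := by
  ext k
  fin_cases k <;> simp [Fin.sum_univ_three, HeisAlg.frame, mul_comm]

theorem metric_sum_smul_frame (hd : 0 < d) (hT : 0 < T) (R : Matrix (Fin 3) (Fin 3) ℝ)
    (i j : Fin 3) : HeisAlg.metric d T (∑ k, R k i • HeisAlg.frame d T k)
      (∑ k, R k j • HeisAlg.frame d T k) = (Rᵀ * R) i j := by
  have h1 := hd.ne'
  have h2 := hT.ne'
  rw [sum_smul_frame, sum_smul_frame, Matrix.mul_apply, Fin.sum_univ_three]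
  simp [HeisAlg.metric]
  field_simp

theorem det_sum_smul_frame (R : Matrix (Fin 3) (Fin 3) ℝ) :
    (Matrix.of fun j => ∑ i, R i j • HeisAlg.frame d T i).det
      = R.det * (Matrix.of (HeisAlg.frame d T)).det := by
  have : (Matrix.of fun j => ∑ i, R i j • HeisAlg.frame d T i)
      = Rᵀ * Matrix.of (HeisAlg.frame d T) := by
    ext j k
    simp [Matrix.mul_apply]
  rw [this, Matrix.det_mul, Matrix.det_transpose]

theorem det_frame_ne_zero (hd : 0 < d) (hT : 0 < T) : (Matrix.of (HeisAlg.frame d T)).det ≠ 0 := by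
  simp [Matrix.det_fin_three, HeisAlg.frame, hd.ne', hT.ne']

/-- The frame `(e₁, e₂, e₃) · Θ(A)`. -/
def frameMap (hd : 0 < d) (hT : 0 < T) (A : Spin3) : OrthFrame d T :=
  ⟨fun j => ∑ i, spinCover A i j • HeisAlg.frame d T i, fun i j => by
    rw [metric_sum_smul_frame hd hT, spinCover_transpose_mul_self, Matrix.one_apply], by
    rw [det_sum_smul_frame, det_spinCover, one_mul]
    exact mul_self_pos.2 (det_frame_ne_zero hd hT)⟩

variable (hd : 0 < d) (hT : 0 < T)

theorem frameMap_mul (A B : Spin3) (j : Fin 3) :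
    (frameMap hd hT (A * B)).1 j = ∑ i, spinCover B i j • (frameMap hd hT A).1 i := by
  simp only [frameMap, spinCover_mul, Matrix.mul_apply, Finset.sum_smul, Finset.smul_sum, smul_smul]
  rw [Finset.sum_comm]
  simp only [mul_comm]

theorem frameMap_one : (frameMap hd hT 1).1 = HeisAlg.frame d T := by
  ext1 j
  simp [frameMap, spinCover_one, Matrix.one_apply]

theorem frameMap_eq_iff {A B : Spin3} :
    frameMap hd hT A = frameMap hd hT B ↔ ∃ u, A = spinSign u * B := by
  constructor
  · intro h
    refine exists_spinSign_mul_of_spinCover_eq ?_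
    have h1 := hd.ne'
    have h2 := hT.ne'
    have h3 := fun j => congrFun (congrArg Subtype.val h) j
    simp only [frameMap, sum_smul_frame] at h3
    ext i j
    fin_cases i
    · simpa [h1] using congrFun (h3 j) 0
    · simpa [h1] using congrFun (h3 j) 1
    · simpa [h2] using congrFun (h3 j) 2
  · rintro ⟨u, rfl⟩
    exact Subtype.ext (by simp only [frameMap, spinCover_mul, spinCover_spinSign, one_mul])

theorem continuous_frameMap : Continuous (frameMap hd hT) := by
  refine Continuous.subtype_mk (continuous_pi fun j => continuous_finsetSum _ fun i _ => ?_) _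
  exact ((continuous_apply_apply i j).comp continuous_spinCover).smul continuous_const

theorem surjective_frameMap : Function.Surjective (frameMap hd hT) := by
  rintro ⟨b, hb, hdet⟩
  have h1 := hd.ne'
  have h2 := hT.ne'
  let R : Matrix (Fin 3) (Fin 3) ℝ := Matrix.of ![fun j => -(b j 0 / d), fun j => -(b j 1 / d),
    fun j => T * b j 2]
  have hR : b = fun j => ∑ i, R i j • HeisAlg.frame d T i := by
    ext j k
    rw [sum_smul_frame]
    fin_cases k <;> simp [R] <;> field_simp
  have hR1 : Rᵀ * R = 1 := by
    ext i j
    rw [← metric_sum_smul_frame hd hT, Matrix.one_apply, ← hb, hR]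
  -- Orthogonality gives (det R)² = 1, and the orientation condition selects the sign.
  have hR2 : R.det = 1 := by
    rw [hR, det_sum_smul_frame, mul_assoc] at hdet
    have h3 : 0 < R.det := pos_of_mul_pos_left hdet (mul_self_nonneg _)
    have h4 := congrArg Matrix.det hR1
    rw [Matrix.det_mul, Matrix.det_transpose, Matrix.det_one] at h4
    nlinarith
  obtain ⟨A, hA⟩ := exists_spinCover_eq hR1 hR2
  refine ⟨A, Subtype.ext ?_⟩
  change (fun j => ∑ i, spinCover A i j • HeisAlg.frame d T i) = b
  rw [hA, ← hR]

instance : CompactSpace Spin3 := by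
  have h : IsCompact (Set.univ.pi fun _ => Set.univ.pi fun _ => Metric.closedBall 0 1 :
      Set (Matrix (Fin 2) (Fin 2) ℂ)) :=
    isCompact_univ_pi fun _ => isCompact_univ_pi fun _ => isCompact_closedBall 0 1
  have hset : (Matrix.specialUnitaryGroup (Fin 2) ℂ : Set (Matrix (Fin 2) (Fin 2) ℂ))
      = {A | A * Aᴴ = 1} ∩ {A | A.det = 1} := by
    ext A
    rw [SetLike.mem_coe, Matrix.mem_specialUnitaryGroup_iff, Matrix.mem_unitaryGroup_iff]
    rfl
  refine isCompact_iff_compactSpace.1 (h.of_isClosed_subset ?_ ?_)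
  · rw [hset]
    exact (isClosed_eq (continuous_id.matrix_mul continuous_id.matrix_conjTranspose)
      continuous_const).inter (isClosed_eq continuous_id.matrix_det continuous_const)
  · intro A hA i _ j _
    rw [mem_closedBall_zero_iff]
    exact entry_norm_bound_of_unitary (Matrix.mem_specialUnitaryGroup_iff.1 hA).1 i j

/-- A continuous surjection from a compact to a Hausdorff space is a quotient map, and the
saturation of an open V is V ∪ -V, which is open. -/
theorem isOpenMap_frameMap : IsOpenMap (frameMap hd hT) := by
  intro V hV
  have hq : Topology.IsQuotientMap (frameMap hd hT) :=
    (continuous_frameMap hd hT).isClosedMap.isQuotientMap (continuous_frameMap hd hT)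
      (surjective_frameMap hd hT)
  rw [← hq.isOpen_preimage]
  have : frameMap hd hT ⁻¹' (frameMap hd hT '' V) = ⋃ u : ℤˣ, (fun A => spinSign u * A) ⁻¹' V := by
    ext A
    simp only [Set.mem_preimage, Set.mem_image, Set.mem_iUnion, frameMap_eq_iff hd hT]
    constructor
    · rintro ⟨B, hB, u, rfl⟩
      exact ⟨u, hB⟩
    · rintro ⟨u, hu⟩
      exact ⟨_, hu, u, rfl⟩
  rw [this]
  exact isOpen_iUnion fun u => hV.preimage (continuous_const.mul continuous_id)

end FrameMap

/-! ### Discreteness of the lattice -/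

/-- An open neighbourhood of `g` on which the projection to the manifold is injective. -/
def heisBox (g : Heis) : Set Heis :=
  {h | |h.x - g.x| < 1 / 2 ∧ |h.y - g.y| < 1 / 2 ∧ |h.z - g.z| < 1 / 2}

theorem isOpen_heisBox (g : Heis) : IsOpen (heisBox g) := by
  have h : ∀ (f : Heis → ℝ), Continuous f → IsOpen {h | |f h - f g| < 1 / 2} := fun f hf =>
    isOpen_lt (hf.sub continuous_const).abs continuous_const
  exact (h _ Heis.continuous_x).inter ((h _ Heis.continuous_y).inter (h _ Heis.continuous_z))

theorem mem_heisBox_self (g : Heis) : g ∈ heisBox g := by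
  refine ⟨?_, ?_, ?_⟩ <;> simp

theorem eq_one_of_mul_mem_heisBox {r : ℕ} (hr : 0 < r) {g h : Heis} {γ : heisLattice r}
    (h1 : h ∈ heisBox g) (h2 : (γ : Heis) * h ∈ heisBox g) : γ = 1 := by
  obtain ⟨_, a, b, c, rfl⟩ := γ
  obtain ⟨hx, hy, hz⟩ := h1
  obtain ⟨hx', hy', hz'⟩ := h2
  have key : ∀ (n : ℤ) (x x' : ℝ), |x| < 1 / 2 → |x'| < 1 / 2 → x' - x = n → n = 0 := by
    intro n x x' h h' e
    rw [abs_lt] at h h'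
    have h3 : (-1 : ℝ) < n := by linarith
    have h4 : (n : ℝ) < 1 := by linarith
    have h5 : -1 < n := by exact_mod_cast h3
    have h6 : n < 1 := by exact_mod_cast h4
    omega
  have ha : (r : ℤ) * a = 0 := key _ _ _ hx hx' (by simp only [Heis.mul_x]; push_cast; ring)
  have hb : b = 0 := key _ _ _ hy hy' (by simp only [Heis.mul_y]; ring)
  have ha' : a = 0 := by
    rcases mul_eq_zero.1 ha with h | h
    · omega
    · exact h
  subst ha' hb
  -- The z-coordinates differ by c + ra·y, which is c now that a = 0.
  have hc : c = 0 := key _ _ _ hz hz' (by simp only [Heis.mul_z]; push_cast; ring)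
  subst hc
  exact Subtype.ext (by ext <;> simp)

theorem heisProj_injOn_heisBox {r : ℕ} (hr : 0 < r) (g : Heis) :
    Set.InjOn (heisProj r) (heisBox g) := by
  intro h hh h' hh' e
  obtain ⟨γ, hγ⟩ := heisProj_eq_iff.1 e
  have := eq_one_of_mul_mem_heisBox hr hh' (hγ ▸ hh : (γ : Heis) * h' ∈ heisBox g)
  rw [← hγ, this, Subgroup.coe_one, one_mul]

/-! ### The homomorphism with a given triple -/

namespace heisLattice

variable {r : ℕ}

theorem coe_mul_mk (γ γ' : heisLattice r) {a b c a' b' c' : ℤ} (h : (γ : Heis) = ⟨r * a, b, c⟩)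
    (h' : (γ' : Heis) = ⟨r * a', b', c'⟩) :
    ((γ * γ' : heisLattice r) : Heis) = ⟨r * (a + a' : ℤ), (b + b' : ℤ), (c + c' + r * a * b' : ℤ)⟩ := by
  rw [Subgroup.coe_mul, h, h']
  ext <;> simp
  ring

theorem exists_hom (hr : 0 < r) (δ : Fin 3 → ℤˣ) (hδ : δ 2 = -1 → Even r) :
    ∃ ε : heisLattice r →* ℤˣ, ε (genX r) = δ 0 ∧ ε (genY r) = δ 1 ∧ ε (genZ r) = δ 2 := by
  have hr' : (r : ℝ) ≠ 0 := by exact_mod_cast hr.ne'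
  have hδr : δ 2 ^ r = 1 := by
    rcases Int.units_eq_one_or (δ 2) with h | h
    · rw [h, one_pow]
    · rw [h, (hδ h).neg_one_pow]
  -- The floor function recovers the integer coordinates. The product is multiplicative because the
  -- cocycle term in z is a multiple of r, and δ₃^r = 1.
  let f : heisLattice r → ℤˣ := fun γ =>
    δ 0 ^ ⌊(γ : Heis).x / r⌋ * δ 1 ^ ⌊(γ : Heis).y⌋ * δ 2 ^ ⌊(γ : Heis).z⌋
  have hf : ∀ (γ : heisLattice r) (a b c : ℤ), (γ : Heis) = ⟨r * a, b, c⟩ →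
      f γ = δ 0 ^ a * δ 1 ^ b * δ 2 ^ c := by
    intro γ a b c h
    simp only [f, h, mul_div_cancel_left₀ _ hr', Int.floor_intCast]
  refine ⟨MonoidHom.mk' f fun γ γ' => ?_, ?_, ?_, ?_⟩
  · obtain ⟨a, b, c, h⟩ := γ.2
    obtain ⟨a', b', c', h'⟩ := γ'.2
    rw [hf γ a b c h, hf γ' a' b' c' h', hf _ _ _ _ (coe_mul_mk γ γ' h h')]
    have : δ 2 ^ ((r : ℤ) * a * b') = 1 := by
      rw [mul_assoc, zpow_mul, zpow_natCast, hδr, one_zpow]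
    rw [zpow_add, zpow_add, zpow_add, zpow_add, this, mul_one]
    rw [mul_mul_mul_comm (δ 0 ^ a), mul_mul_mul_comm (δ 0 ^ a * δ 1 ^ b)]
  · exact (hf _ 1 0 0 (by simp [genX])).trans (by simp)
  · exact (hf _ 0 1 0 (by simp [genY])).trans (by simp)
  · exact (hf _ 0 0 1 (by simp [genZ])).trans (by simp)

end heisLattice

/-! ### The spin structure of a homomorphism -/

/-- The trivial `Spin(3)`-bundle over `G`, with the action of the lattice twisted by `ε`. -/
def TwistedSpinBundle {r : ℕ} (_ε : heisLattice r →* ℤˣ) : Type := Heis × Spin3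

namespace TwistedSpinBundle

open Topology

variable {r : ℕ} {ε : heisLattice r →* ℤˣ}

instance : TopologicalSpace (TwistedSpinBundle ε) := inferInstanceAs (TopologicalSpace (Heis × Spin3))

instance : MulAction (heisLattice r) (TwistedSpinBundle ε) where
  smul γ x := ((γ : Heis) * x.1, spinSign (ε γ) * x.2)
  one_smul x := Prod.ext (one_mul x.1) (by
    change spinSign (ε 1) * x.2 = x.2
    rw [map_one, spinSign_one, one_mul])
  mul_smul γ γ' x := Prod.ext (mul_assoc _ _ _) (by
    change spinSign (ε (γ * γ')) * x.2 = spinSign (ε γ) * (spinSign (ε γ') * x.2)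
    rw [map_mul, spinSign_mul, mul_assoc])

instance : ContinuousConstSMul (heisLattice r) (TwistedSpinBundle ε) :=
  ⟨fun γ => ((Heis.continuous_const_mul γ.1).comp continuous_fst).prodMk
    (continuous_const.mul continuous_snd)⟩

variable (ε) in
/-- The bundle `G ×_Γ Spin(3)`. -/
abbrev Assoc : Type := MulAction.orbitRel.Quotient (heisLattice r) (TwistedSpinBundle ε)

variable (ε) in
/-- The projection to `G ×_Γ Spin(3)`. -/
def proj (x : Heis × Spin3) : Assoc ε := Quotient.mk _ x

theorem isOpenQuotientMap_proj : IsOpenQuotientMap (proj ε) :=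
  MulAction.isOpenQuotientMap_quotientMk (Γ := heisLattice r) (T := TwistedSpinBundle ε)

theorem proj_eq_iff {x y : Heis × Spin3} : proj ε x = proj ε y ↔
    ∃ γ : heisLattice r, ((γ : Heis) * y.1, spinSign (ε γ) * y.2) = x := Quotient.eq

theorem proj_smul (γ : heisLattice r) (g : Heis) (A : Spin3) :
    proj ε ((γ : Heis) * g, spinSign (ε γ) * A) = proj ε (g, A) := proj_eq_iff.2 ⟨γ, rfl⟩

/-- The right action of `Spin(3)`. -/
def act (p : Assoc ε) (B : Spin3) : Assoc ε :=
  Quotient.lift (fun x : Heis × Spin3 => proj ε (x.1, x.2 * B)) (fun x y h => by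
    obtain ⟨γ, rfl⟩ := h
    exact proj_eq_iff.2 ⟨γ, Prod.ext rfl (mul_assoc _ _ _).symm⟩) p

theorem act_proj (g : Heis) (A B : Spin3) : act (proj ε (g, A)) B = proj ε (g, A * B) := rfl

theorem continuous_act : Continuous fun x : Assoc ε × Spin3 => act x.1 x.2 := by
  have h : IsOpenQuotientMap (Prod.map (proj ε) (id : Spin3 → Spin3)) :=
    isOpenQuotientMap_proj.prodMap IsOpenQuotientMap.id
  refine h.isQuotientMap.continuous_iff.2 ?_
  exact isOpenQuotientMap_proj.continuous.comp
    (f := fun x : (Heis × Spin3) × Spin3 => (x.1.1, x.1.2 * x.2)) (by fun_prop)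

variable {d T : ℝ} (hd : 0 < d) (hT : 0 < T)

/-- The map to the frame bundle. -/
def toFrame (p : Assoc ε) : FrameBundle r d T :=
  Quotient.lift (fun x : Heis × Spin3 => (heisProj r x.1, frameMap hd hT x.2)) (fun x y h => by
    obtain ⟨γ, rfl⟩ := h
    exact Prod.ext (heisProj_mul γ y.1) ((frameMap_eq_iff hd hT).2 ⟨ε γ, rfl⟩)) p

theorem toFrame_proj (g : Heis) (A : Spin3) :
    toFrame hd hT (proj ε (g, A)) = (heisProj r g, frameMap hd hT A) := rfl

theorem continuous_toFrame : Continuous (toFrame hd hT (ε := ε)) :=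
  isOpenQuotientMap_proj.isQuotientMap.continuous_iff.2
    (continuous_heisProj.prodMap (continuous_frameMap hd hT))

theorem surjective_toFrame : Function.Surjective (toFrame hd hT (ε := ε)) := by
  rintro ⟨m, b⟩
  obtain ⟨g, rfl⟩ := surjective_heisProj m
  obtain ⟨A, rfl⟩ := surjective_frameMap hd hT b
  exact ⟨proj ε (g, A), rfl⟩

theorem isOpenMap_toFrame : IsOpenMap (toFrame hd hT (ε := ε)) := by
  intro O hO
  have h := (isOpenMap_heisProj (r := r)).prodMap (isOpenMap_frameMap hd hT) _
    (hO.preimage (isOpenQuotientMap_proj (ε := ε)).continuous)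
  convert! h using 1
  ext b
  constructor
  · rintro ⟨p, hp, rfl⟩
    obtain ⟨x, rfl⟩ := isOpenQuotientMap_proj.surjective p
    exact ⟨x, hp, rfl⟩
  · rintro ⟨x, hx, rfl⟩
    exact ⟨proj ε x, hx, rfl⟩

/-- The action of the kernel of `Spin(3) → SO(3)`. -/
instance : MulAction ℤˣ (Assoc ε) where
  smul u p := act p (spinSign u)
  one_smul p := by
    obtain ⟨⟨g, A⟩, rfl⟩ := isOpenQuotientMap_proj.surjective p
    change act _ _ = _
    rw [act_proj, spinSign_one, mul_one]
  mul_smul u v p := by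
    obtain ⟨⟨g, A⟩, rfl⟩ := isOpenQuotientMap_proj.surjective p
    change act _ _ = act (act _ _) _
    rw [act_proj, act_proj, act_proj, mul_comm u, spinSign_mul, mul_assoc]

theorem units_smul_proj (u : ℤˣ) (g : Heis) (A : Spin3) :
    u • proj ε (g, A) = proj ε (g, spinSign u * A) := by
  change act _ _ = _
  rw [act_proj, spinSign_comm]

/-- The map is the quotient by the free action of ±1 on the spin bundle, and each point has a
neighbourhood disjoint from its image under -1. -/
theorem isQuotientCoveringMap_toFrame (hr : 0 < r) :
    IsQuotientCoveringMap (toFrame hd hT (ε := ε)) ℤˣ where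
  toIsQuotientMap := (isOpenMap_toFrame hd hT).isQuotientMap (continuous_toFrame hd hT)
    (surjective_toFrame hd hT)
  continuous_const_smul u := continuous_act.comp (Continuous.prodMk_left (spinSign u))
  apply_eq_iff_mem_orbit := by
    intro p q
    obtain ⟨⟨g, A⟩, rfl⟩ := isOpenQuotientMap_proj.surjective p
    obtain ⟨⟨g', A'⟩, rfl⟩ := isOpenQuotientMap_proj.surjective q
    rw [toFrame_proj, toFrame_proj, Prod.mk.injEq, heisProj_eq_iff, frameMap_eq_iff]
    constructor
    · rintro ⟨⟨γ, rfl⟩, u, rfl⟩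
      refine ⟨ε γ * u, ?_⟩
      beta_reduce
      rw [units_smul_proj, ← proj_smul γ, spinSign_mul, ← mul_assoc, ← mul_assoc, ← spinSign_mul,
        Int.units_mul_self, spinSign_one, one_mul]
    · rintro ⟨u, hu⟩
      beta_reduce at hu
      rw [units_smul_proj, proj_eq_iff] at hu
      obtain ⟨γ, hγ⟩ := hu
      obtain ⟨h1, h2⟩ := Prod.mk.inj hγ
      refine ⟨⟨γ⁻¹, ?_⟩, ε γ * u, ?_⟩
      · rw [← h1, Subgroup.coe_inv, inv_mul_cancel_left]
      · rw [spinSign_mul, mul_assoc, ← h2, ← mul_assoc, ← spinSign_mul, Int.units_mul_self,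
          spinSign_one, one_mul]
  disjoint := by
    intro p
    obtain ⟨⟨g, A⟩, rfl⟩ := isOpenQuotientMap_proj.surjective p
    have hne : A ≠ spinSign (-1) * A := fun h => by
      have h1 := mul_right_cancel ((one_mul A).trans h)
      rw [← spinSign_one] at h1
      exact absurd (spinSign_injective h1) (by decide)
    -- The neighbourhood is a box times a set that -1 moves off itself: the box forces γ = 1, and
    -- the second factor then excludes u = -1.
    obtain ⟨V, V', hV, hV', hAV, hAV', hVV⟩ := t2_separation hne
    have hW : IsOpen (V ∩ (fun B => spinSign (-1) * B) ⁻¹' V') :=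
      hV.inter (hV'.preimage (continuous_const.mul continuous_id))
    refine ⟨proj ε '' (heisBox g ×ˢ (V ∩ (fun B => spinSign (-1) * B) ⁻¹' V')),
      isOpenQuotientMap_proj.isOpenMap.image_mem_nhds
        (((isOpen_heisBox g).prod hW).mem_nhds ⟨mem_heisBox_self g, hAV, hAV'⟩), fun u hu => ?_⟩
    obtain ⟨_, ⟨_, ⟨⟨h, B⟩, ⟨hh, hB, hB'⟩, rfl⟩, rfl⟩, ⟨h', B'⟩, ⟨hh', hC, -⟩, e⟩ := hu
    rcases Int.units_eq_one_or u with rfl | rfl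
    · rfl
    · beta_reduce at e
      rw [units_smul_proj, proj_eq_iff] at e
      obtain ⟨γ, hγ⟩ := e
      obtain ⟨h1, h2⟩ := Prod.mk.inj hγ
      simp only at h1 h2
      have h3 := eq_one_of_mul_mem_heisBox hr (g := g) (γ := γ) hh (by rw [h1]; exact hh')
      rw [h3, map_one, spinSign_one, one_mul] at h2
      exact (Set.disjoint_left.1 hVV hC (h2 ▸ hB')).elim

/-- No nontrivial lattice element relates two points of the box W. So W × Spin(3) maps
homeomorphically both to the part of the bundle over U and to U × Spin(3); the trivialisation
compares the two. -/
theorem locally_trivial (hr : 0 < r) (m : HeisManifold r) :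
    ∃ U : Set (HeisManifold r), IsOpen U ∧ m ∈ U ∧
    ∃ e : {p : Assoc ε // (toFrame hd hT p).1 ∈ U} ≃ₜ U × Spin3,
      (∀ p, ((e p).1 : HeisManifold r) = (toFrame hd hT p.1).1) ∧
      ∀ p p' A, p'.1 = act p.1 A → (e p').2 = (e p).2 * A := by
  obtain ⟨g, rfl⟩ := surjective_heisProj m
  let W := heisBox g
  have hW : IsOpen W := isOpen_heisBox g
  let U := heisProj r '' W
  have hU : IsOpen U := isOpenMap_heisProj _ hW
  let j : W × Spin3 → {p : Assoc ε // (toFrame hd hT p).1 ∈ U} := fun x =>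
    ⟨proj ε (x.1, x.2), x.1, x.1.2, rfl⟩
  let k : W × Spin3 → U × Spin3 := fun x => (⟨heisProj r x.1, x.1, x.1.2, rfl⟩, x.2)
  have hincl : IsOpenMap fun x : W × Spin3 => ((x.1 : Heis), x.2) :=
    hW.isOpenMap_subtype_val.prodMap IsOpenMap.id
  have hjo : IsOpenMap j := by
    intro O hO
    have h1 := (isOpenQuotientMap_proj (ε := ε)).isOpenMap _ (hincl O hO)
    convert! h1.preimage (continuous_subtype_val (p := fun p => (toFrame hd hT p).1 ∈ U)) using 1
    ext p
    constructor
    · rintro ⟨x, hx, rfl⟩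
      exact ⟨_, ⟨x, hx, rfl⟩, rfl⟩
    · rintro ⟨_, ⟨x, hx, rfl⟩, hp⟩
      exact ⟨x, hx, Subtype.ext hp⟩
  have hjc : Continuous j := Continuous.subtype_mk
    (isOpenQuotientMap_proj.continuous.comp
      (f := fun x : W × Spin3 => ((x.1 : Heis), x.2)) (by fun_prop)) _
  have hjb : Function.Bijective j := by
    constructor
    · rintro ⟨⟨h, hh⟩, A⟩ ⟨⟨h', hh'⟩, A'⟩ e
      obtain ⟨γ, hγ⟩ := proj_eq_iff.1 (congrArg Subtype.val e)
      obtain ⟨h1, h2⟩ := Prod.mk.inj hγ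
      simp only at h1 h2
      have h3 := eq_one_of_mul_mem_heisBox hr (g := g) (γ := γ) hh' (by rw [h1]; exact hh)
      rw [h3, Subgroup.coe_one, one_mul] at h1
      rw [h3, map_one, spinSign_one, one_mul] at h2
      subst h1 h2
      rfl
    · rintro ⟨p, hp⟩
      obtain ⟨⟨h, A⟩, rfl⟩ := isOpenQuotientMap_proj.surjective p
      obtain ⟨w, hw, hwh⟩ := hp
      obtain ⟨γ, rfl⟩ := heisProj_eq_iff.1 hwh
      refine ⟨(⟨_, hw⟩, spinSign (ε γ) * A), Subtype.ext ?_⟩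
      exact proj_smul γ h A
  have hko : IsOpenMap k := by
    refine IsOpenMap.prodMap (f := fun x : W => (⟨heisProj r x, x, x.2, rfl⟩ : U)) ?_ IsOpenMap.id
    intro O hO
    have h1 := (isOpenMap_heisProj (r := r)) _ (hW.isOpenMap_subtype_val O hO)
    convert! h1.preimage (continuous_subtype_val (p := fun m => m ∈ U)) using 1
    ext p
    constructor
    · rintro ⟨x, hx, rfl⟩
      exact ⟨_, ⟨x, hx, rfl⟩, rfl⟩
    · rintro ⟨_, ⟨x, hx, rfl⟩, hp⟩
      exact ⟨x, hx, Subtype.ext hp⟩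
  have hkc : Continuous k := (Continuous.subtype_mk
    (continuous_heisProj.comp (continuous_subtype_val.comp continuous_fst)) _).prodMk continuous_snd
  have hkb : Function.Bijective k := by
    constructor
    · rintro ⟨⟨h, hh⟩, A⟩ ⟨⟨h', hh'⟩, A'⟩ e
      obtain ⟨h1, h2⟩ := Prod.mk.inj e
      have h3 := heisProj_injOn_heisBox hr g hh hh' (congrArg Subtype.val h1)
      subst h2 h3
      rfl
    · rintro ⟨⟨_, w, hw, rfl⟩, A⟩
      exact ⟨(⟨w, hw⟩, A), rfl⟩
  let ej := (Equiv.ofBijective j hjb).toHomeomorphOfContinuousOpen hjc hjo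
  let ek := (Equiv.ofBijective k hkb).toHomeomorphOfContinuousOpen hkc hko
  have he : ∀ x, (ej.symm.trans ek) (j x) = k x := fun x => congrArg ek (ej.symm_apply_apply x)
  refine ⟨U, hU, ⟨g, mem_heisBox_self g, rfl⟩, ej.symm.trans ek, fun p => ?_, fun p p' A h => ?_⟩
  · obtain ⟨x, rfl⟩ := hjb.2 p
    rw [he]
    rfl
  · obtain ⟨x, rfl⟩ := hjb.2 p
    have h' : p' = j (x.1, x.2 * A) := Subtype.ext h
    rw [h', he, he]

/-- The spin structure `G ×_Γ Spin(3)`. -/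
def spinStructure (ε : heisLattice r →* ℤˣ) (hr : 0 < r) : SpinStructure r d T where
  P := Assoc ε
  act := act
  continuous_act := continuous_act
  act_one p := by
    obtain ⟨⟨g, A⟩, rfl⟩ := isOpenQuotientMap_proj.surjective p
    rw [act_proj, mul_one]
  act_mul p A B := by
    obtain ⟨⟨g, C⟩, rfl⟩ := isOpenQuotientMap_proj.surjective p
    rw [act_proj, act_proj, act_proj, mul_assoc]
  φ := toFrame hd hT
  isCoveringMap := (isQuotientCoveringMap_toFrame hd hT hr).isCoveringMap
  twofold b := by
    obtain ⟨p, hp⟩ := surjective_toFrame hd hT (ε := ε) b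
    have h := Nat.card_congr ((isQuotientCoveringMap_toFrame hd hT hr).fiberEquivGroup ⟨p, hp⟩)
    rw [← Nat.card_coe_set_eq, h]
    simp
  proj_act p A := by
    obtain ⟨⟨g, B⟩, rfl⟩ := isOpenQuotientMap_proj.surjective p
    rfl
  frame_act p A j := by
    obtain ⟨⟨g, B⟩, rfl⟩ := isOpenQuotientMap_proj.surjective p
    exact frameMap_mul hd hT B A j
  locally_trivial := locally_trivial hd hT hr

theorem hasHom_spinStructure (ε : heisLattice r →* ℤˣ) (hr : 0 < r) :
    (spinStructure hd hT ε hr).HasHom ε := by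
  refine ⟨fun g => proj ε (g, 1), SpinStructure.isLift_univ_iff.2 ⟨?_, fun g => ?_⟩, fun γ g => ?_⟩
  · exact isOpenQuotientMap_proj.continuous.comp (Continuous.prodMk_left 1)
  · exact ⟨rfl, frameMap_one hd hT⟩
  · change _ = act (proj ε (g, 1)) (spinSign (ε γ))
    rw [act_proj, ← proj_smul γ, one_mul, ← spinSign_mul, Int.units_mul_self, spinSign_one]

end TwistedSpinBundle

theorem exists_hasTriple_iff {r : ℕ} (hr : 0 < r) {d T : ℝ} (hd : 0 < d) (hT : 0 < T)
    (δ : Fin 3 → ℤˣ) :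
    (∃ S : SpinStructure r d T, S.HasTriple δ) ↔ (δ 2 = -1 → Even r) := by
  refine ⟨fun ⟨S, hS⟩ h => hS.even h, fun h => ?_⟩
  obtain ⟨ε, h0, h1, h2⟩ := heisLattice.exists_hom hr δ h
  exact ⟨_, SpinStructure.hasTriple_iff.2
    ⟨ε, TwistedSpinBundle.hasHom_spinStructure hd hT ε hr, h0, h1, h2⟩⟩

end

/-! ### The main theorem -/

theorem theorem3p1 (r : ℕ) (hr : 0 < r) (d T : ℝ) (hd : 0 < d) (hT : 0 < T) :
    -- equivalence classes of spin structures correspond bijectively to the admissible triples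
    (∀ S : SpinStructure r d T, ∃! δ : Fin 3 → ℤˣ, S.HasTriple δ) ∧
    (∀ (S S' : SpinStructure r d T) (δ δ' : Fin 3 → ℤˣ), S.HasTriple δ → S'.HasTriple δ' →
      (S.Equivalent S' ↔ δ = δ')) ∧
    (∀ δ : Fin 3 → ℤˣ, (∃ S : SpinStructure r d T, S.HasTriple δ) ↔ (δ 2 = -1 → Even r)) ∧
    -- the eigenvalues for `δ₃ = 1`
    (∀ (S : SpinStructure r d T) (δ : Fin 3 → ℤˣ), S.HasTriple δ → δ 2 = 1 → ∀ μ : ℂ,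
      {i : EigenIndexA r δ | (eigenvalueA d T i : ℂ) = μ}.Finite ∧
      Module.Finite ℂ (S.diracEigenspace μ) ∧
      Module.finrank ℂ (S.diracEigenspace μ)
        = {i : EigenIndexA r δ | (eigenvalueA d T i : ℂ) = μ}.ncard) ∧
    -- the eigenvalues for `δ₃ = -1`
    (∀ (S : SpinStructure r d T) (δ : Fin 3 → ℤˣ), S.HasTriple δ → δ 2 = -1 → ∀ μ : ℂ,
      {i : EigenIndexB r | (eigenvalueB d T i : ℂ) = μ}.Finite ∧
      Module.Finite ℂ (S.diracEigenspace μ) ∧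
      Module.finrank ℂ (S.diracEigenspace μ)
        = {i : EigenIndexB r | (eigenvalueB d T i : ℂ) = μ}.ncard) := by
  -- Finiteness and dimension pass from `heisSpinors` to the Dirac eigenspaces along the linear
  -- equivalence.
  have hfin : ∀ {S : SpinStructure r d T} {δ : Fin 3 → ℤˣ} (μ : ℂ) {p : Prop} {n : ℕ},
      S.HasTriple δ →
      p ∧ Module.Finite ℂ (heisSpinors r (signLog (δ 0)) (signLog (δ 1)) (signLog (δ 2)) d T
          (μ + (d ^ 2 * T / 4 : ℝ))) ∧
        Module.finrank ℂ (heisSpinors r (signLog (δ 0)) (signLog (δ 1)) (signLog (δ 2)) d T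
          (μ + (d ^ 2 * T / 4 : ℝ))) = n →
      p ∧ Module.Finite ℂ (S.diracEigenspace μ) ∧ Module.finrank ℂ (S.diracEigenspace μ) = n := by
    rintro S δ μ p n hS ⟨hp, hf, hn⟩
    obtain ⟨e⟩ := hS.nonempty_eigenspace_equiv hd hT μ
    exact ⟨hp, Module.Finite.equiv e.symm, e.finrank_eq.trans hn⟩
  exact ⟨fun S => S.existsUnique_hasTriple hd hT, fun S S' δ δ' h h' => h.equivalent_iff h',
    exists_hasTriple_iff hr hd hT,
    fun S δ hS hδ μ => hfin μ hS (finrank_heisSpinors_of_eq_one hr hd hT hδ μ),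
    fun S δ hS hδ μ => hfin μ hS (finrank_heisSpinors_of_eq_neg_one hr (hS.even hδ) hd hT hδ μ)⟩
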